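/- **Setting.** Inner products are antilinear in the first argument. An *involutive R-matrix* on a Hilbert space $\mathcal V$ is a bounded operator $T$ on $\mathcal V\otimes\mathcal V$ with $T=T^*=T^{-1}$ and $(T\otimes1)(1\otimes T)(T\otimes1)=(1\otimes T)(T\otimes1)(1\otimes T)$; the set of these is $\mathcal R_0(\mathcal V)$. For $T$ on $\mathcal V\otimes\mathcal V$ and $Q$ on $\mathcal W\otimes\mathcal W$, the *box-sum* $T\boxplus Q$ acts on $(\mathcal V\oplus\mathcal W)^{\otimes2}$ as $T$ on $\mathcal V\otimes\mathcal V$, as $Q$ on $\mathcal W\otimes\mathcal W$, and as the flip $x\otimes y\mapsto y\otimes x$ on $(\mathcal V\otimes\mathcal W)\oplus(\mathcal W\otimes\mathcal V)$. Let $\mathcal H,\mathcal K$ be finite-dimensional complex Hilbert spaces with orthonormal bases $(e_\alpha)_{\alpha\in I}$, $(k_\xi)_{\xi\in J}$, let $\mathcal L$ be a complex Hilbert space, and let $S\in\mathcal R_0(\mathcal H)$, $R\in\mathcal R_0(\mathcal K)$. Put $\tilde{\mathcal H}=\mathcal H\otimes\mathcal L$, $\tilde{\mathcal K}=\mathcal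 K\otimes\mathcal L$, and let $\tilde S=F_2(S\otimes F)F_2$ on $\tilde{\mathcal H}\otimes\tilde{\mathcal H}$, where $F$ is the flip of $\mathcal L\otimes\mathcal L$ and $F_2$ exchanges the second and third tensor factors; similarly $\tilde R$. *Zamolodchikov algebra.* Let $(b_\alpha)_{\alpha\in I\sqcup J}$ be the orthonormal basis $(e_\alpha\oplus0)_{\alpha\in I},(0\oplus k_\xi)_{\xi\in J}$ of $\mathcal H\oplus\mathcal K$ and $M^{\alpha\beta}_{\delta\gamma}=\langle b_\alpha\otimes b_\beta,(S\boxplus R)(b_\delta\otimes b_\gamma)\rangle$. $\mathcal Z=\mathcal Z(S\boxplus R,\mathcal L)$ is the unital complex $*$-algebra generated by symbols $Z_\alpha(f)$, $\alpha\in I\sqcup J$, $f\in\mathcal L$, subject to $$Z_\alpha(f)Z_\beta(g)=\sum_{\gamma,\delta}M^{\beta\alpha}_{\delta\gamma}Z_\gamma(g)Z_\delta(f),\qquad Z_\alpha(f)Z_\beta^*(g)=\sum_{\gamma,\delta}M^{\alpha\gamma}_{\beta\delta}Z_\gamma^*(g)Z_\delta(f)+\delta_{\alpha\beta}\langle f,g\rangle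 1 .$$ A *vacuum functional* is a linear $\omega:\mathcal Z\to\mathbb C$ with $\omega(1)=1$ and $\omega(Z_\alpha^*(f)X)=0=\omega(XZ_\alpha(f))$ for all $\alpha,f,X$. *Fock spaces.* Let $T\in\mathcal R_0(\mathcal V)$. Let $D_n^T$ be the unitary representation of the symmetric group $\mathfrak S_n$ on $\mathcal V^{\otimes n}$ in which the transposition of $i$ and $i+1$ acts as $T$ on the tensor factors $i,i+1$, and let $P_n^T=\frac1{n!}\sum_{p\in\mathfrak S_n}D_n^T(p)$. Then $\mathcal F_T(\mathcal V)=\bigoplus_{n\ge0}P_n^T\mathcal V^{\otimes n}$ (Hilbert sum), with the dense subspace $\mathcal F_T^0(\mathcal V)$ of vectors of finite particle number and the vacuum $\Omega_T=1\oplus0\oplus\cdots$. On $\mathcal F^0_T(\mathcal V)$ define $z_T^*(\psi)x=\sqrt{n+1}\,P^T_{n+1}(\psi\otimes x)$ for $x\in P_n^T\mathcal V^{\otimes n}$, $\psi\in\mathcal V$, and let $z_T(\psi)$ be the adjoint of $z_T^*(\psi)$. On the algebraic tensor product $\mathcal F^0_{\tilde S}(\tilde{\mathcal H})\otimes\mathcal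 F^0_{\tilde R}(\tilde{\mathcal K})$, which is dense in the Hilbert space $\mathcal F_{\tilde S}(\tilde{\mathcal H})\otimes\mathcal F_{\tilde R}(\tilde{\mathcal K})$, put for $\psi\in\tilde{\mathcal H}$, $\chi\in\tilde{\mathcal K}$ $$z^{\#}_{\tilde S,\tilde R}(\psi\oplus\chi)=z^{\#}_{\tilde S}(\psi)\otimes1+1\otimes z^{\#}_{\tilde R}(\chi)\quad(z^\#=z\text{ or }z^*),\qquad \Omega_{\tilde S,\tilde R}=\Omega_{\tilde S}\otimes\Omega_{\tilde R}.$$ For $f\in\mathcal L$ let $f_\alpha=(e_\alpha\otimes f)\oplus0$ if $\alpha\in I$, and $f_\alpha=0\oplus(k_\alpha\otimes f)$ if $\alpha\in J$. A unital $*$-representation on a pre-Hilbert space $D$ is a unital algebra homomorphism $\pi$ into the linear operators $D\to D$ with $\langle\pi(X^*)\varphi,\psi\rangle=\langle\varphi,\pi(X)\psi\rangle$ for all $X$ and $\varphi,\psi\in D$. **Theorem.** (a) There is a unital $*$-representation $\pi_{\tilde S,\tilde R}$ of $\mathcal Z$ on $\mathcal F^0_{\tilde S}(\tilde{\mathcal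 H})\otimes\mathcal F^0_{\tilde R}(\tilde{\mathcal K})$ with $\pi_{\tilde S,\tilde R}(Z_\alpha(f))=z_{\tilde S,\tilde R}(f_\alpha)$ and $\pi_{\tilde S,\tilde R}(Z^*_\alpha(f))=z^*_{\tilde S,\tilde R}(f_\alpha)$ for all $\alpha\in I\sqcup J$, $f\in\mathcal L$. The vector $\Omega_{\tilde S,\tilde R}$ is cyclic, i.e. $\pi_{\tilde S,\tilde R}(\mathcal Z)\Omega_{\tilde S,\tilde R}$ is dense in $\mathcal F_{\tilde S}(\tilde{\mathcal H})\otimes\mathcal F_{\tilde R}(\tilde{\mathcal K})$. There is exactly one vacuum functional $\omega$ on $\mathcal Z$, and $\omega(X)=\langle\Omega_{\tilde S,\tilde R},\pi_{\tilde S,\tilde R}(X)\Omega_{\tilde S,\tilde R}\rangle$ for all $X\in\mathcal Z$. (b) There is a unital $*$-representation $\pi_{\tilde S\boxplus\tilde R}$ of $\mathcal Z$ on $\mathcal F^0_{\tilde S\boxplus\tilde R}(\tilde{\mathcal H}\oplus\tilde{\mathcal K})$ with $Z_\alpha(f)\mapsto z_{\tilde S\boxplus\tilde R}(f_\alpha)$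 and $Z^*_\alpha(f)\mapsto z^*_{\tilde S\boxplus\tilde R}(f_\alpha)$, and there is a unitary $V$ from $\mathcal F_{\tilde S\boxplus\tilde R}(\tilde{\mathcal H}\oplus\tilde{\mathcal K})$ onto $\mathcal F_{\tilde S}(\tilde{\mathcal H})\otimes\mathcal F_{\tilde R}(\tilde{\mathcal K})$ such that $V\Omega_{\tilde S\boxplus\tilde R}=\Omega_{\tilde S,\tilde R}$, $V^*$ maps $\mathcal F^0_{\tilde S}(\tilde{\mathcal H})\otimes\mathcal F^0_{\tilde R}(\tilde{\mathcal K})$ into $\mathcal F^0_{\tilde S\boxplus\tilde R}(\tilde{\mathcal H}\oplus\tilde{\mathcal K})$, and $V\,\pi_{\tilde S\boxplus\tilde R}(X)\,V^*\psi=\pi_{\tilde S,\tilde R}(X)\psi$ for all $X\in\mathcal Z$ and $\psi\in\mathcal F^0_{\tilde S}(\tilde{\mathcal H})\otimes\mathcal F^0_{\tilde R}(\tilde{\mathcal K})$. -/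

import Mathlib

open scoped TensorProduct InnerProductSpace
open UniformSpace

set_option maxSynthPendingDepth 3

universe u v w

noncomputable section

namespace Zam

/-! ### Involutive R-matrices, box-sum and box-product

For finite-dimensional `H` and a Hilbert space `L` the algebraic tensor products `H ⊗ H` and
`H ⊗ L` (with Mathlib's inner product) are already Hilbert spaces. -/

section RMatrix

variable {V : Type u} [NormedAddCommGroup V] [InnerProductSpace ℂ V]

/-- `T ⊗ 1` on `V ⊗ V ⊗ V`. -/
def leg12 (T : V ⊗[ℂ] V →L[ℂ] V ⊗[ℂ] V) : (V ⊗[ℂ] V) ⊗[ℂ] V →L[ℂ] (V ⊗[ℂ] V) ⊗[ℂ] V :=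
  T.rTensor V

/-- `1 ⊗ T` on `V ⊗ V ⊗ V`. -/
def leg23 (T : V ⊗[ℂ] V →L[ℂ] V ⊗[ℂ] V) : (V ⊗[ℂ] V) ⊗[ℂ] V →L[ℂ] (V ⊗[ℂ] V) ⊗[ℂ] V :=
  ((TensorProduct.assocIsometry ℂ V V V).symm : V ⊗[ℂ] (V ⊗[ℂ] V) →L[ℂ] (V ⊗[ℂ] V) ⊗[ℂ] V) ∘L
    T.lTensor V ∘L
      (TensorProduct.assocIsometry ℂ V V V : (V ⊗[ℂ] V) ⊗[ℂ] V →L[ℂ] V ⊗[ℂ] (V ⊗[ℂ] V))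

/-- `T = T* = T⁻¹` and `T` solves the Yang-Baxter equation. -/
structure IsInvolutiveRMatrix (T : V ⊗[ℂ] V →L[ℂ] V ⊗[ℂ] V) : Prop where
  selfAdjoint : ∀ x y : V ⊗[ℂ] V, ⟪T x, y⟫_ℂ = ⟪x, T y⟫_ℂ
  involutive : T ∘L T = ContinuousLinearMap.id ℂ (V ⊗[ℂ] V)
  yangBaxter : leg12 T ∘L leg23 T ∘L leg12 T = leg23 T ∘L leg12 T ∘L leg23 T

/-- The matrix elements `S^{αβ}_{δγ} = ⟨e_α ⊗ e_β, S (e_δ ⊗ e_γ)⟩`. -/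
def matrixCoeff {ι : Type*} [Fintype ι] (e : OrthonormalBasis ι ℂ V)
    (S : V ⊗[ℂ] V →L[ℂ] V ⊗[ℂ] V) (α β δ γ : ι) : ℂ :=
  ⟪e α ⊗ₜ[ℂ] e β, S (e δ ⊗ₜ[ℂ] e γ)⟫_ℂ

variable {W : Type v} [NormedAddCommGroup W] [InnerProductSpace ℂ W]

/-- The tensor flip `V ⊗ W → W ⊗ V`. -/
def flip (V : Type u) [NormedAddCommGroup V] [InnerProductSpace ℂ V]
    (W : Type v) [NormedAddCommGroup W] [InnerProductSpace ℂ W] : V ⊗[ℂ] W →L[ℂ] W ⊗[ℂ] V :=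
  (TensorProduct.commIsometry ℂ V W : V ⊗[ℂ] W →L[ℂ] W ⊗[ℂ] V)

/-- The exchange of the two inner tensor factors, `(a ⊗ b) ⊗ (c ⊗ d) ↦ (a ⊗ c) ⊗ (b ⊗ d)`. -/
def exchangeInner (A B C D : Type*)
    [NormedAddCommGroup A] [InnerProductSpace ℂ A] [NormedAddCommGroup B] [InnerProductSpace ℂ B]
    [NormedAddCommGroup C] [InnerProductSpace ℂ C] [NormedAddCommGroup D] [InnerProductSpace ℂ D] :
    (A ⊗[ℂ] B) ⊗[ℂ] (C ⊗[ℂ] D) →L[ℂ] (A ⊗[ℂ] C) ⊗[ℂ] (B ⊗[ℂ] D) :=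
  ((TensorProduct.assocIsometry ℂ A C (B ⊗[ℂ] D)).symm :
      A ⊗[ℂ] (C ⊗[ℂ] (B ⊗[ℂ] D)) →L[ℂ] (A ⊗[ℂ] C) ⊗[ℂ] (B ⊗[ℂ] D)) ∘L
    ((TensorProduct.assocIsometry ℂ C B D :
        (C ⊗[ℂ] B) ⊗[ℂ] D →L[ℂ] C ⊗[ℂ] (B ⊗[ℂ] D)) ∘L
      (flip B C).rTensor D ∘L
      ((TensorProduct.assocIsometry ℂ B C D).symm :
        B ⊗[ℂ] (C ⊗[ℂ] D) →L[ℂ] (B ⊗[ℂ] C) ⊗[ℂ] D)).lTensor A ∘L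
    (TensorProduct.assocIsometry ℂ A B (C ⊗[ℂ] D) :
      (A ⊗[ℂ] B) ⊗[ℂ] (C ⊗[ℂ] D) →L[ℂ] A ⊗[ℂ] (B ⊗[ℂ] (C ⊗[ℂ] D)))

theorem exchangeInner_tmul {A B C D : Type*}
    [NormedAddCommGroup A] [InnerProductSpace ℂ A] [NormedAddCommGroup B] [InnerProductSpace ℂ B]
    [NormedAddCommGroup C] [InnerProductSpace ℂ C] [NormedAddCommGroup D] [InnerProductSpace ℂ D]
    (a : A) (b : B) (c : C) (d : D) :
    exchangeInner A B C D ((a ⊗ₜ b) ⊗ₜ (c ⊗ₜ d)) = (a ⊗ₜ c) ⊗ₜ (b ⊗ₜ d) := rfl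

/-- The box-product `S ⊠ R = F₂ (S ⊗ R) F₂` on `(V ⊗ W) ⊗ (V ⊗ W)`. -/
def boxTimes (S : V ⊗[ℂ] V →L[ℂ] V ⊗[ℂ] V) (R : W ⊗[ℂ] W →L[ℂ] W ⊗[ℂ] W) :
    (V ⊗[ℂ] W) ⊗[ℂ] (V ⊗[ℂ] W) →L[ℂ] (V ⊗[ℂ] W) ⊗[ℂ] (V ⊗[ℂ] W) :=
  exchangeInner V V W W ∘L TensorProduct.mapL S R ∘L exchangeInner V W V W

/-- `S̃ = S ⊠ F` with `F` the flip of `L ⊗ L`. -/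
def tilde (L : Type w) [NormedAddCommGroup L] [InnerProductSpace ℂ L]
    (S : V ⊗[ℂ] V →L[ℂ] V ⊗[ℂ] V) :
    (V ⊗[ℂ] L) ⊗[ℂ] (V ⊗[ℂ] L) →L[ℂ] (V ⊗[ℂ] L) ⊗[ℂ] (V ⊗[ℂ] L) :=
  boxTimes S (flip L L)

/-- The Hilbert space direct sum. -/
def DSum (V : Type u) (W : Type v) : Type (max u v) := WithLp 2 (V × W)

instance : NormedAddCommGroup (DSum V W) := inferInstanceAs (NormedAddCommGroup (WithLp 2 (V × W)))

instance : InnerProductSpace ℂ (DSum V W) :=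
  inferInstanceAs (InnerProductSpace ℂ (WithLp 2 (V × W)))

/-- The inclusion of the first summand. -/
def inlL (V : Type u) [NormedAddCommGroup V] [InnerProductSpace ℂ V]
    (W : Type v) [NormedAddCommGroup W] [InnerProductSpace ℂ W] : V →L[ℂ] DSum V W :=
  (((WithLp.prodContinuousLinearEquiv 2 ℂ V W).symm : V × W →L[ℂ] WithLp 2 (V × W)) ∘L
    ContinuousLinearMap.inl ℂ V W : V →L[ℂ] WithLp 2 (V × W))

/-- The inclusion of the second summand. -/
def inrL (V : Type u) [NormedAddCommGroup V] [InnerProductSpace ℂ V]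
    (W : Type v) [NormedAddCommGroup W] [InnerProductSpace ℂ W] : W →L[ℂ] DSum V W :=
  (((WithLp.prodContinuousLinearEquiv 2 ℂ V W).symm : V × W →L[ℂ] WithLp 2 (V × W)) ∘L
    ContinuousLinearMap.inr ℂ V W : W →L[ℂ] WithLp 2 (V × W))

/-- The projection to the first summand. -/
def projL (V : Type u) [NormedAddCommGroup V] [InnerProductSpace ℂ V]
    (W : Type v) [NormedAddCommGroup W] [InnerProductSpace ℂ W] : DSum V W →L[ℂ] V :=
  (WithLp.fstL 2 ℂ V W : WithLp 2 (V × W) →L[ℂ] V)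

/-- The projection to the second summand. -/
def projR (V : Type u) [NormedAddCommGroup V] [InnerProductSpace ℂ V]
    (W : Type v) [NormedAddCommGroup W] [InnerProductSpace ℂ W] : DSum V W →L[ℂ] W :=
  (WithLp.sndL 2 ℂ V W : WithLp 2 (V × W) →L[ℂ] W)

/-- The union of orthonormal bases of the summands. -/
def sumBasis {ι κ : Type*} [Fintype ι] [Fintype κ] (e : OrthonormalBasis ι ℂ V)
    (k : OrthonormalBasis κ ℂ W) : OrthonormalBasis (ι ⊕ κ) ℂ (DSum V W) :=
  (e.prod k : OrthonormalBasis (ι ⊕ κ) ℂ (WithLp 2 (V × W)))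

/-- The box-sum `S ⊞ R`: it acts as `S` on `V ⊗ V`, as `R` on `W ⊗ W`, and as the flip on
`(V ⊗ W) ⊕ (W ⊗ V)`. -/
def boxSum (S : V ⊗[ℂ] V →L[ℂ] V ⊗[ℂ] V) (R : W ⊗[ℂ] W →L[ℂ] W ⊗[ℂ] W) :
    DSum V W ⊗[ℂ] DSum V W →L[ℂ] DSum V W ⊗[ℂ] DSum V W :=
  let p : DSum V W →L[ℂ] V := projL V W
  let q : DSum V W →L[ℂ] W := projR V W
  TensorProduct.mapL (inlL V W) (inlL V W) ∘L S ∘L TensorProduct.mapL p p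
    + TensorProduct.mapL (inrL V W) (inrL V W) ∘L R ∘L TensorProduct.mapL q q
    + TensorProduct.mapL (inrL V W) (inlL V W) ∘L flip V W ∘L TensorProduct.mapL p q
    + TensorProduct.mapL (inlL V W) (inrL V W) ∘L flip W V ∘L TensorProduct.mapL q p

/-- The matrix elements of `S ⊞ R` in the orthonormal basis of `H ⊕ K` that consists of a basis of
`H` and a basis of `K`. -/
def boxCoeff {ι κ : Type*} [Fintype ι] [Fintype κ] (e : OrthonormalBasis ι ℂ V)
    (k : OrthonormalBasis κ ℂ W) (S : V ⊗[ℂ] V →L[ℂ] V ⊗[ℂ] V) (R : W ⊗[ℂ] W →L[ℂ] W ⊗[ℂ] W) :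
    ι ⊕ κ → ι ⊕ κ → ι ⊕ κ → ι ⊕ κ → ℂ :=
  matrixCoeff (sumBasis e k) (boxSum S R)

end RMatrix

/-! ### The Zamolodchikov algebra -/

section Algebra

/-- The generators `Z_α(f)` and `Z*_α(f)`. -/
inductive Gen (ι : Type u) (L : Type w) : Type (max u w)
  | ann (α : ι) (f : L) : Gen ι L
  | cre (α : ι) (f : L) : Gen ι L

/-- The exchange of `Z_α(f)` and `Z*_α(f)`. -/
def Gen.swap {ι : Type u} {L : Type w} : Gen ι L → Gen ι L
  | .ann α f => .cre α f
  | .cre α f => .ann α f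

/-- The free complex algebra on the generators `Z_α(f)`, `Z*_α(f)`. -/
abbrev FreeZ (ι : Type u) (L : Type w) : Type (max u w) := FreeAlgebra ℂ (Gen ι L)

/-- The opposite of the free algebra, with the complex conjugate scalar action. -/
@[reducible] def conjOpAlgebra (ι : Type u) (L : Type w) : Algebra ℂ (FreeZ ι L)ᵐᵒᵖ :=
  ((algebraMap ℂ (FreeZ ι L)ᵐᵒᵖ).comp (starRingEnd ℂ)).toAlgebra' fun c x =>
    Algebra.commutes (starRingEnd ℂ c) x

/-- The involution as a homomorphism into the opposite algebra. -/
def freeStarHom (ι : Type u) (L : Type w) : FreeZ ι L →+* (FreeZ ι L)ᵐᵒᵖ :=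
  letI := conjOpAlgebra ι L
  (FreeAlgebra.lift ℂ fun x : Gen ι L =>
    MulOpposite.op (FreeAlgebra.ι ℂ x.swap)).toRingHom

/-- The conjugate linear, anti-multiplicative involution of the free algebra that exchanges
`Z_α(f)` and `Z*_α(f)`. -/
def freeStar {ι : Type u} {L : Type w} (x : FreeZ ι L) : FreeZ ι L :=
  (freeStarHom ι L x).unop

section
variable {ι : Type u} {L : Type w}

theorem freeStar_gen (x : Gen ι L) :
    freeStar (FreeAlgebra.ι ℂ x) = FreeAlgebra.ι ℂ x.swap := by
  let := conjOpAlgebra ι L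
  exact congrArg MulOpposite.unop (FreeAlgebra.lift_ι_apply
    (fun x : Gen ι L => MulOpposite.op (FreeAlgebra.ι ℂ x.swap)) x)

theorem freeStar_algebraMap (c : ℂ) :
    freeStar (algebraMap ℂ (FreeZ ι L) c) = algebraMap ℂ (FreeZ ι L) (star c) := by
  let := conjOpAlgebra ι L
  exact congrArg MulOpposite.unop (AlgHom.commutes (FreeAlgebra.lift ℂ
    (fun x : Gen ι L => MulOpposite.op (FreeAlgebra.ι ℂ x.swap))) c)

theorem freeStar_add (x y : FreeZ ι L) : freeStar (x + y) = freeStar x + freeStar y := by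
  simp [freeStar]

theorem freeStar_mul (x y : FreeZ ι L) : freeStar (x * y) = freeStar y * freeStar x := by
  simp [freeStar]

theorem freeStar_freeStar (x : FreeZ ι L) : freeStar (freeStar x) = x := by
  induction x using FreeAlgebra.induction with
  | grade0 c => simp [freeStar_algebraMap]
  | grade1 x => rw [freeStar_gen, freeStar_gen]; cases x <;> rfl
  | mul a b ha hb => rw [freeStar_mul, freeStar_mul, ha, hb]
  | add a b ha hb => rw [freeStar_add, freeStar_add, ha, hb]

/-- The *-ring structure given by `freeStar`; it is kept a definition, since Mathlib has another
(linear) one on free algebras. -/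
@[reducible] def freeStarRing (ι : Type u) (L : Type w) : StarRing (FreeZ ι L) where
  star := freeStar
  star_involutive := freeStar_freeStar
  star_mul := freeStar_mul
  star_add := freeStar_add

end

variable {ι : Type u} [Fintype ι] (L : Type w) [NormedAddCommGroup L] [InnerProductSpace ℂ L]

/-- `Z_α(f)` in the free algebra. -/
abbrev fAnn {L : Type w} (α : ι) (f : L) : FreeZ ι L := FreeAlgebra.ι ℂ (Gen.ann α f)

/-- `Z*_α(f)` in the free algebra. -/
abbrev fCre {L : Type w} (α : ι) (f : L) : FreeZ ι L := FreeAlgebra.ι ℂ (Gen.cre α f)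

open Classical in
/-- The exchange relations
`Z_α(f) Z_β(g) = ∑ S^{βα}_{δγ} Z_γ(g) Z_δ(f)` and
`Z_α(f) Z*_β(g) = ∑ S^{αγ}_{βδ} Z*_γ(g) Z_δ(f) + δ_{αβ} ⟨f, g⟩ 1`, and their adjoints. -/
inductive Rel (S : ι → ι → ι → ι → ℂ) : FreeZ ι L → FreeZ ι L → Prop
  | exchange (α β : ι) (f g : L) : Rel S (fAnn α f * fAnn β g)
      (∑ γ, ∑ δ, S β α δ γ • (fAnn γ g * fAnn δ f))
  | mixed (α β : ι) (f g : L) : Rel S (fAnn α f * fCre β g)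
      ((∑ γ, ∑ δ, S α γ β δ • (fCre γ g * fAnn δ f)) + (if α = β then ⟪f, g⟫_ℂ else 0) • 1)
  | adjoint {x y : FreeZ ι L} : Rel S x y → Rel S (freeStar x) (freeStar y)

/-- The Zamolodchikov algebra `𝒵(S, L)`: the unital complex *-algebra generated by the `Z_α(f)`
subject to the exchange relations. -/
def Zalg (S : ι → ι → ι → ι → ℂ) : Type (max u w) := RingQuot (Rel L S)

namespace Zalg

variable {L} (S : ι → ι → ι → ι → ℂ)

instance : Ring (Zalg L S) := inferInstanceAs (Ring (RingQuot (Rel L S)))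

instance : Algebra ℂ (Zalg L S) := inferInstanceAs (Algebra ℂ (RingQuot (Rel L S)))

instance : StarRing (Zalg L S) :=
  @RingQuot.starRing (FreeZ ι L) _ (freeStarRing ι L) (Rel L S) fun _ _ h => Rel.adjoint h

/-- The quotient map from the free algebra. -/
def mk : FreeZ ι L →ₐ[ℂ] Zalg L S := RingQuot.mkAlgHom ℂ (Rel L S)

/-- The generator `Z_α(f)`. -/
def Z (α : ι) (f : L) : Zalg L S := mk S (fAnn α f)

theorem mk_surjective : Function.Surjective (mk (L := L) S) :=
  RingQuot.mkAlgHom_surjective ℂ (Rel L S)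

theorem star_mk (x : FreeZ ι L) : star (mk S x) = mk S (freeStar x) := by
  have h : ∀ y : FreeZ ι L, mk S y = (⟨Quot.mk _ y⟩ : RingQuot (Rel L S)) := fun y => by
    simp only [mk, RingQuot.mkAlgHom_def, RingQuot.mkRingHom_def]
    rfl
  rw [h, h]
  rfl

theorem star_Z (α : ι) (f : L) : star (Z S α f) = mk S (fCre α f) := by
  rw [Z, star_mk, freeStar_gen]
  rfl

instance : StarModule ℂ (Zalg L S) where
  star_smul c x := by
    obtain ⟨x, rfl⟩ := mk_surjective S x
    rw [← map_smul, star_mk, star_mk, ← map_smul, Algebra.smul_def, freeStar_mul,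
      freeStar_algebraMap, ← Algebra.commutes, ← Algebra.smul_def]

end Zalg

/-- The defining properties of the vacuum functional: it is normalised and vanishes on
`Z*_α(f) X` and on `X Z_α(f)`. -/
structure IsVacuumFunctional {L : Type w} [NormedAddCommGroup L] [InnerProductSpace ℂ L]
    {S : ι → ι → ι → ι → ℂ} (ω : Zalg L S →ₗ[ℂ] ℂ) : Prop where
  map_one : ω 1 = 1
  star_mul : ∀ (α : ι) (f : L) (X : Zalg L S), ω (star (Zalg.Z S α f) * X) = 0
  mul : ∀ (α : ι) (f : L) (X : Zalg L S), ω (X * Zalg.Z S α f) = 0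

end Algebra

/-- `π` is a *-representation on the pre-Hilbert space `D` (by possibly unbounded operators):
`⟨π(X*) φ, ψ⟩ = ⟨φ, π(X) ψ⟩` for all `φ, ψ ∈ D`. Unitality is part of `A →ₐ[ℂ] _`. -/
def IsStarRep {A : Type*} [Ring A] [Algebra ℂ A] [StarRing A]
    {D : Type*} [NormedAddCommGroup D] [InnerProductSpace ℂ D]
    (π : A →ₐ[ℂ] Module.End ℂ D) : Prop :=
  ∀ (X : A) (φ ψ : D), ⟪π (star X) φ, ψ⟫_ℂ = ⟪φ, π X ψ⟫_ℂ

/-! ### Tensor powers and the action of the symmetric groups -/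

/-- A bundled complex inner product space. -/
structure PreHilb : Type (u + 1) where
  carrier : Type u
  [grp : NormedAddCommGroup carrier]
  [ips : InnerProductSpace ℂ carrier]

attribute [instance] PreHilb.grp PreHilb.ips

/-- `V^{⊗0} = ℂ` (as the one-dimensional Euclidean space) and `V^{⊗(n+1)} = V ⊗ V^{⊗n}`. -/
def tpowAux (V : Type u) [NormedAddCommGroup V] [InnerProductSpace ℂ V] : ℕ → PreHilb.{u}
  | 0 => ⟨EuclideanSpace ℂ PUnit.{u + 1}⟩
  | n + 1 => ⟨V ⊗[ℂ] (tpowAux V n).carrier⟩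

/-- The algebraic tensor power `V^{⊗n}` with its inner product; its completion is the Hilbert space
tensor power. -/
def TPow (V : Type u) [NormedAddCommGroup V] [InnerProductSpace ℂ V] (n : ℕ) : Type u :=
  (tpowAux V n).carrier

section TPow

variable (V : Type u) [NormedAddCommGroup V] [InnerProductSpace ℂ V]

instance (n : ℕ) : NormedAddCommGroup (TPow V n) :=
  inferInstanceAs (NormedAddCommGroup (tpowAux V n).carrier)

instance (n : ℕ) : InnerProductSpace ℂ (TPow V n) :=
  inferInstanceAs (InnerProductSpace ℂ (tpowAux V n).carrier)

/-- The unit vector `1 ∈ ℂ = V^{⊗0}`. -/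
def TPow.one : TPow V 0 := (EuclideanSpace.single PUnit.unit 1 : EuclideanSpace ℂ PUnit.{u + 1})

/-- The identification `V ⊗ V^{⊗n} = V^{⊗(n+1)}`. -/
def TPow.cons (n : ℕ) : V ⊗[ℂ] TPow V n ≃ₗᵢ[ℂ] TPow V (n + 1) :=
  LinearIsometryEquiv.refl ℂ (V ⊗[ℂ] (tpowAux V n).carrier)

variable {V}

/-- `ψ ⊗ · : V^{⊗n} → V^{⊗(n+1)}`. -/
def TPow.consL (ψ : V) (n : ℕ) : TPow V n →L[ℂ] TPow V (n + 1) :=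
  (TPow.cons V n : V ⊗[ℂ] TPow V n →L[ℂ] TPow V (n + 1)) ∘L TensorProduct.mkL ℂ V (TPow V n) ψ

/-- `T ⊗ 1` on `V^{⊗(n+2)} = V ⊗ V ⊗ V^{⊗n}`. -/
def actHead (T : V ⊗[ℂ] V →L[ℂ] V ⊗[ℂ] V) (n : ℕ) : TPow V (n + 2) →L[ℂ] TPow V (n + 2) :=
  let E : (V ⊗[ℂ] V) ⊗[ℂ] TPow V n ≃ₗᵢ[ℂ] TPow V (n + 2) :=
    ((TensorProduct.assocIsometry ℂ V V (TPow V n)).trans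
      ((TPow.cons V n).lTensor V)).trans (TPow.cons V (n + 1))
  (E : (V ⊗[ℂ] V) ⊗[ℂ] TPow V n →L[ℂ] TPow V (n + 2)) ∘L T.rTensor (TPow V n) ∘L
    (E.symm : TPow V (n + 2) →L[ℂ] (V ⊗[ℂ] V) ⊗[ℂ] TPow V n)

/-- `1 ⊗ A` on `V^{⊗(n+1)} = V ⊗ V^{⊗n}`. -/
def actTail {n : ℕ} (A : TPow V n →L[ℂ] TPow V n) : TPow V (n + 1) →L[ℂ] TPow V (n + 1) :=
  (TPow.cons V n : V ⊗[ℂ] TPow V n →L[ℂ] TPow V (n + 1)) ∘L A.lTensor V ∘L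
    ((TPow.cons V n).symm : TPow V (n + 1) →L[ℂ] V ⊗[ℂ] TPow V n)

/-- `D_n(τ_k) = 1^{⊗k} ⊗ T ⊗ 1^{⊗(n-k-2)}` on `V^{⊗n}`: the operator of the transposition of the
neighbouring tensor factors `k` and `k + 1`, counted from `0` (the identity if `k + 1 ≥ n`). -/
def adjAct (T : V ⊗[ℂ] V →L[ℂ] V ⊗[ℂ] V) : (n k : ℕ) → (TPow V n →L[ℂ] TPow V n)
  | 0, _ => ContinuousLinearMap.id ℂ _
  | 1, _ => ContinuousLinearMap.id ℂ _
  | n + 2, 0 => actHead T n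
  | n + 2, k + 1 => actTail (adjAct T (n + 1) k)

end TPow

/-- The transposition `τ_k` of `k` and `k + 1` in the permutations of `{0, …, n-1}`
(the identity if `k + 1 ≥ n`). -/
def adjSwap (n k : ℕ) : Equiv.Perm (Fin n) :=
  if h : k + 1 < n then Equiv.swap ⟨k, by omega⟩ ⟨k + 1, h⟩ else 1

/-- A word in the neighbouring transpositions `τ_k` that represents the permutation `p`: with
`k = p 0`, it is `τ_{k-1} ⋯ τ_0` followed by the word, shifted by one, of the permutation of the
remaining letters. -/
def permWord : (n : ℕ) → Equiv.Perm (Fin n) → List ℕ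
  | 0, _ => []
  | n + 1, p => (List.range (p 0 : ℕ)).reverse ++
      (permWord n (Equiv.Perm.decomposeFin (Fin.cycleRange (p 0) * p)).2).map Nat.succ

theorem adjSwap_succ (n k : ℕ) :
    adjSwap (n + 1) (k + 1) = Equiv.Perm.decomposeFin.symm (0, adjSwap n k) := by
  ext i
  refine Fin.cases ?_ (fun i => ?_) i
  · simp only [Equiv.Perm.decomposeFin_symm_apply_zero, adjSwap]
    split_ifs
    · rw [Equiv.swap_apply_of_ne_of_ne] <;> simp [Fin.ext_iff]
    · rfl
  · simp only [Equiv.Perm.decomposeFin_symm_apply_succ, Equiv.swap_self, Equiv.refl_apply, adjSwap]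
    by_cases h : k + 1 < n
    · have h' : k + 1 + 1 < n + 1 := by omega
      simp only [h, h', dif_pos, Equiv.swap_apply_def, Fin.ext_iff, Fin.val_succ]
      split_ifs <;> simp_all
    · have h' : ¬ k + 1 + 1 < n + 1 := by omega
      simp [h]

theorem prod_map_adjSwap_succ (n : ℕ) (l : List ℕ) :
    ((l.map Nat.succ).map (adjSwap (n + 1))).prod
      = Equiv.Perm.decomposeFin.symm (0, (l.map (adjSwap n)).prod) := by
  induction l with
  | nil =>
    simp only [List.map_nil, List.prod_nil, Equiv.Perm.decomposeFin_symm_of_one, Equiv.swap_self]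
    rfl
  | cons a l ih =>
    simp only [List.map_cons, List.prod_cons, ih, Nat.succ_eq_add_one, adjSwap_succ]
    ext i
    refine Fin.cases ?_ (fun i => ?_) i <;> simp

theorem prod_map_adjSwap_range (n : ℕ) (k : Fin (n + 1)) :
    ((List.range (k : ℕ)).reverse.map (adjSwap (n + 1))).prod = (Fin.cycleRange k)⁻¹ := by
  obtain ⟨k, hk⟩ := k
  induction k with
  | zero => simp
  | succ k ih =>
    have hk' : k < n + 1 := by omega
    simp only [List.range_succ, List.reverse_append, List.reverse_singleton, List.singleton_append,
      List.map_cons, List.prod_cons]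
    have ih' := ih hk'
    simp only at ih'
    rw [ih']
    have hs : (adjSwap (n + 1) k)⁻¹ = adjSwap (n + 1) k := by
      unfold adjSwap; split_ifs <;> simp
    rw [← hs, ← mul_inv_rev, inv_inj]
    ext i
    simp only [Equiv.Perm.mul_apply, adjSwap, hk, dif_pos, Equiv.swap_apply_def]
    have e1 : ∀ (j : Fin (n+1)) (m : ℕ) (hm : m < n + 1), ((Fin.cycleRange ⟨m, hm⟩ j : Fin (n+1)) : ℕ)
        = if (j : ℕ) < m then (j : ℕ) + 1 else if (j : ℕ) = m then 0 else (j : ℕ) := by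
      intro j m hm
      split_ifs with h1 h2
      · exact Fin.coe_cycleRange_of_lt (by simpa [Fin.lt_def] using h1)
      · have : j = ⟨m, hm⟩ := Fin.ext h2
        rw [this, Fin.cycleRange_self]; rfl
      · rw [Fin.cycleRange_of_gt]; simp only [Fin.lt_def]; omega
    rw [e1, e1]
    simp only [Fin.ext_iff]
    split_ifs <;> simp_all <;> omega

theorem permWord_prod (n : ℕ) (p : Equiv.Perm (Fin n)) :
    ((permWord n p).map (adjSwap n)).prod = p := by
  induction n with
  | zero => exact Subsingleton.elim _ _
  | succ n ih =>
    rw [permWord, List.map_append, List.prod_append, prod_map_adjSwap_range, prod_map_adjSwap_succ,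
      ih]
    have h : (Equiv.Perm.decomposeFin (Fin.cycleRange (p 0) * p)).1 = 0 := by
      have h1 := Equiv.Perm.decomposeFin_symm_apply_zero
        (Equiv.Perm.decomposeFin (Fin.cycleRange (p 0) * p)).1
        (Equiv.Perm.decomposeFin (Fin.cycleRange (p 0) * p)).2
      rw [Prod.mk.eta, Equiv.symm_apply_apply] at h1
      rw [← h1]; simp
    rw [inv_mul_eq_iff_eq_mul, Equiv.symm_apply_eq]
    exact Prod.ext h.symm rfl

section Fock

variable {V : Type u} [NormedAddCommGroup V] [InnerProductSpace ℂ V]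

/-- `D_n(p)` for a permutation `p`: the product of the operators `D_n(τ_k)` along a word that
represents `p`. For an involutive R-matrix `T` it does not depend on the word, and `D_n` is the
unitary representation of the symmetric group generated by the `D_n(τ_k)`. -/
def permOp (T : V ⊗[ℂ] V →L[ℂ] V ⊗[ℂ] V) {n : ℕ} (p : Equiv.Perm (Fin n)) :
    TPow V n →L[ℂ] TPow V n :=
  ((permWord n p).map (adjAct T n)).prod

/-- `P_n = (1 / n!) ∑_p D_n(p)` on the algebraic tensor power. -/
def symAlg (T : V ⊗[ℂ] V →L[ℂ] V ⊗[ℂ] V) (n : ℕ) : TPow V n →L[ℂ] TPow V n :=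
  ((n.factorial : ℂ)⁻¹) • ∑ p : Equiv.Perm (Fin n), permOp T p

/-- The bounded operator `P_n` on the Hilbert space tensor power. -/
def symProj (T : V ⊗[ℂ] V →L[ℂ] V ⊗[ℂ] V) (n : ℕ) :
    Completion (TPow V n) →L[ℂ] Completion (TPow V n) :=
  (symAlg T n).completion

/-- The `n`-particle space, the range of `P_n`. (For an involutive R-matrix, `P_n` is an orthogonal
projection, so that its range is closed and taking the closure changes nothing.) -/
def Particle (T : V ⊗[ℂ] V →L[ℂ] V ⊗[ℂ] V) (n : ℕ) : Submodule ℂ (Completion (TPow V n)) :=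
  (LinearMap.range (symProj T n : Completion (TPow V n) →ₗ[ℂ] Completion (TPow V n))).topologicalClosure

instance (T : V ⊗[ℂ] V →L[ℂ] V ⊗[ℂ] V) (n : ℕ) : CompleteSpace (Particle T n) :=
  inferInstanceAs (CompleteSpace (Submodule.topologicalClosure _))

theorem symProj_mem (T : V ⊗[ℂ] V →L[ℂ] V ⊗[ℂ] V) (n : ℕ) (x : Completion (TPow V n)) :
    symProj T n x ∈ Particle T n :=
  Submodule.le_topologicalClosure _ ⟨x, rfl⟩

/-- The `T`-symmetrised Fock space, the Hilbert sum of the `n`-particle spaces. -/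
def Fock (T : V ⊗[ℂ] V →L[ℂ] V ⊗[ℂ] V) : Type u := lp (fun n => Particle T n) 2

instance (T : V ⊗[ℂ] V →L[ℂ] V ⊗[ℂ] V) : NormedAddCommGroup (Fock T) :=
  inferInstanceAs (NormedAddCommGroup (lp (fun n => Particle T n) 2))

instance (T : V ⊗[ℂ] V →L[ℂ] V ⊗[ℂ] V) : InnerProductSpace ℂ (Fock T) :=
  inferInstanceAs (InnerProductSpace ℂ (lp (fun n => Particle T n) 2))

instance (T : V ⊗[ℂ] V →L[ℂ] V ⊗[ℂ] V) : CompleteSpace (Fock T) :=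
  inferInstanceAs (CompleteSpace (lp (fun n => Particle T n) 2))

/-- The `n`-particle component of a vector of the Fock space. -/
def Fock.component {T : V ⊗[ℂ] V →L[ℂ] V ⊗[ℂ] V} (n : ℕ) : Fock T →ₗ[ℂ] Particle T n where
  toFun φ := (show lp (fun n => Particle T n) 2 from φ) n
  map_add' _ _ := rfl
  map_smul' _ _ := rfl

theorem Fock.ext {T : V ⊗[ℂ] V →L[ℂ] V ⊗[ℂ] V} {φ χ : Fock T}
    (h : ∀ n, Fock.component n φ = Fock.component n χ) : φ = χ :=
  lp.ext (funext h)

/-- The subspace of vectors of finite particle number. -/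
def Fock0 (T : V ⊗[ℂ] V →L[ℂ] V ⊗[ℂ] V) : Submodule ℂ (Fock T) where
  carrier := {φ | {n | Fock.component n φ ≠ 0}.Finite}
  zero_mem' := by simp
  add_mem' {φ χ} hφ hχ := (hφ.union hχ).subset fun n hn => by
    by_contra h
    simp only [Set.mem_union, Set.mem_ofPred_eq, not_or, not_not] at h
    exact hn (by simp [h.1, h.2])
  smul_mem' c φ hφ := hφ.subset fun n hn h => hn (by simp [h])

/-- A finitely supported sequence of `n`-particle vectors as a vector of finite particle number. -/
def Fock0.ofFinite {T : V ⊗[ℂ] V →L[ℂ] V ⊗[ℂ] V} (x : ∀ n, Particle T n)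
    (hx : {n | x n ≠ 0}.Finite) : Fock0 T :=
  ⟨(⟨x, (memℓp_zero hx).of_exponent_ge zero_le⟩ : lp (fun n => Particle T n) 2), hx⟩

/-- The vacuum vector `1 ⊕ 0 ⊕ ⋯`. -/
def vac (T : V ⊗[ℂ] V →L[ℂ] V ⊗[ℂ] V) : Fock0 T :=
  Fock0.ofFinite
    (fun n => match n with
      | 0 => ⟨((TPow.one V : TPow V 0) : Completion (TPow V 0)), by
          have h : symProj T 0 ((TPow.one V : TPow V 0) : Completion (TPow V 0))
              = ((TPow.one V : TPow V 0) : Completion (TPow V 0)) := by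
            simp [symProj, symAlg, permOp, permWord]
          rw [← h]
          exact symProj_mem T 0 _⟩
      | _ + 1 => 0)
    ((Set.finite_singleton 0).subset fun n hn => by
      cases n with
      | zero => rfl
      | succ n => exact absurd rfl hn)

/-- The creation operator from the `n`- to the `(n+1)`-particle space,
`x ↦ √(n+1) P_{n+1} (ψ ⊗ x)`. -/
def creN (T : V ⊗[ℂ] V →L[ℂ] V ⊗[ℂ] V) (ψ : V) (n : ℕ) : Particle T n →L[ℂ] Particle T (n + 1) :=
  (Real.sqrt (n + 1) : ℂ) •
    (symProj T (n + 1) ∘L (TPow.consL ψ n).completion ∘L (Particle T n).subtypeL).codRestrict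
      (Particle T (n + 1)) fun _ => symProj_mem T (n + 1) _

/-- The annihilation operator from the `(n+1)`- to the `n`-particle space, the adjoint of the
creation operator. -/
def annN (T : V ⊗[ℂ] V →L[ℂ] V ⊗[ℂ] V) (ψ : V) (n : ℕ) : Particle T (n + 1) →L[ℂ] Particle T n :=
  (creN T ψ n).adjoint

/-- The creation operator `z*(ψ)` on the vectors of finite particle number. -/
def cre (T : V ⊗[ℂ] V →L[ℂ] V ⊗[ℂ] V) (ψ : V) : Fock0 T →ₗ[ℂ] Fock0 T where
  toFun φ := Fock0.ofFinite
    (fun n => match n with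
      | 0 => 0
      | n + 1 => creN T ψ n (Fock.component n (φ : Fock T)))
    ((φ.2.image Nat.succ).subset fun n hn => by
      cases n with
      | zero => exact absurd rfl hn
      | succ n => exact ⟨n, fun h => hn (by simp [h]), rfl⟩)
  map_add' φ χ := by
    refine Subtype.ext (Fock.ext fun n => ?_)
    cases n with
    | zero => exact (add_zero (0 : Particle T 0)).symm
    | succ n => exact (creN T ψ n).map_add _ _
  map_smul' c φ := by
    refine Subtype.ext (Fock.ext fun n => ?_)
    cases n with
    | zero => exact (smul_zero c).symm
    | succ n => exact (creN T ψ n).map_smul _ _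

/-- The annihilation operator `z(ψ) = z*(ψ)*` on the vectors of finite particle number. -/
def ann (T : V ⊗[ℂ] V →L[ℂ] V ⊗[ℂ] V) (ψ : V) : Fock0 T →ₗ[ℂ] Fock0 T where
  toFun φ := Fock0.ofFinite (fun n => annN T ψ n (Fock.component (n + 1) (φ : Fock T)))
    ((φ.2.preimage (Nat.succ_injective.injOn)).subset fun n hn h => hn (by simp [h]))
  map_add' φ χ := by
    refine Subtype.ext (Fock.ext fun n => ?_)
    exact (annN T ψ n).map_add _ _
  map_smul' c φ := by
    refine Subtype.ext (Fock.ext fun n => ?_)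
    exact (annN T ψ n).map_smul _ _

end Fock

/-! ### The tensor product of two Fock spaces -/

section TensorFock

variable {V : Type u} [NormedAddCommGroup V] [InnerProductSpace ℂ V]
  {W : Type v} [NormedAddCommGroup W] [InnerProductSpace ℂ W]
  (T : V ⊗[ℂ] V →L[ℂ] V ⊗[ℂ] V) (Q : W ⊗[ℂ] W →L[ℂ] W ⊗[ℂ] W)

/-- The Hilbert space tensor product of two Fock spaces. -/
def FockTensor : Type (max u v) := Completion (Fock T ⊗[ℂ] Fock Q)

instance : NormedAddCommGroup (FockTensor T Q) :=
  inferInstanceAs (NormedAddCommGroup (Completion (Fock T ⊗[ℂ] Fock Q)))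

instance : InnerProductSpace ℂ (FockTensor T Q) :=
  inferInstanceAs (InnerProductSpace ℂ (Completion (Fock T ⊗[ℂ] Fock Q)))

instance : CompleteSpace (FockTensor T Q) :=
  inferInstanceAs (CompleteSpace (Completion (Fock T ⊗[ℂ] Fock Q)))

/-- The (algebraic) tensor product of the spaces of vectors of finite particle number. -/
def Fock0Tensor : Type (max u v) := Fock0 T ⊗[ℂ] Fock0 Q

instance : NormedAddCommGroup (Fock0Tensor T Q) :=
  inferInstanceAs (NormedAddCommGroup (Fock0 T ⊗[ℂ] Fock0 Q))

instance : InnerProductSpace ℂ (Fock0Tensor T Q) :=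
  inferInstanceAs (InnerProductSpace ℂ (Fock0 T ⊗[ℂ] Fock0 Q))

/-- The inclusion of `Fock0Tensor` into the Hilbert space tensor product. -/
def tensorIncl : Fock0Tensor T Q →ₗᵢ[ℂ] FockTensor T Q :=
  ((Completion.toComplₗᵢ (𝕜 := ℂ) (E := Fock T ⊗[ℂ] Fock Q)).comp
    (TensorProduct.mapInclIsometry (Fock0 T) (Fock0 Q)) :
      Fock0 T ⊗[ℂ] Fock0 Q →ₗᵢ[ℂ] Completion (Fock T ⊗[ℂ] Fock Q))

/-- The vacuum vector `Ω_{T,Q} = Ω_T ⊗ Ω_Q`. -/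
def tensorVac : Fock0Tensor T Q := (vac T ⊗ₜ[ℂ] vac Q : Fock0 T ⊗[ℂ] Fock0 Q)

/-- `z_{T,Q}(ψ ⊕ χ) = z_T(ψ) ⊗ 1 + 1 ⊗ z_Q(χ)`. -/
def tensorAnn (ψ : DSum V W) : Module.End ℂ (Fock0Tensor T Q) :=
  (TensorProduct.map (ann T (projL V W ψ)) LinearMap.id + TensorProduct.map LinearMap.id (ann Q (projR V W ψ)) :
    Module.End ℂ (Fock0 T ⊗[ℂ] Fock0 Q))

/-- `z*_{T,Q}(ψ ⊕ χ) = z*_T(ψ) ⊗ 1 + 1 ⊗ z*_Q(χ)`. -/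
def tensorCre (ψ : DSum V W) : Module.End ℂ (Fock0Tensor T Q) :=
  (TensorProduct.map (cre T (projL V W ψ)) LinearMap.id + TensorProduct.map LinearMap.id (cre Q (projR V W ψ)) :
    Module.End ℂ (Fock0 T ⊗[ℂ] Fock0 Q))

end TensorFock

/-- The vector `f_α ⊕ 0 = (e_α ⊗ f) ⊕ 0`, resp. `0 ⊕ f_ξ = 0 ⊕ (k_ξ ⊗ f)`, of `(H ⊗ L) ⊕ (K ⊗ L)`. -/
def genVec {H : Type u} [NormedAddCommGroup H] [InnerProductSpace ℂ H]
    {K : Type v} [NormedAddCommGroup K] [InnerProductSpace ℂ K]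
    {L : Type w} [NormedAddCommGroup L] [InnerProductSpace ℂ L]
    {ι κ : Type*} [Fintype ι] [Fintype κ]
    (e : OrthonormalBasis ι ℂ H) (k : OrthonormalBasis κ ℂ K) :
    ι ⊕ κ → L → DSum (H ⊗[ℂ] L) (K ⊗[ℂ] L)
  | .inl α, f => inlL (H ⊗[ℂ] L) (K ⊗[ℂ] L) (e α ⊗ₜ[ℂ] f)
  | .inr ξ, f => inrL (H ⊗[ℂ] L) (K ⊗[ℂ] L) (k ξ ⊗ₜ[ℂ] f)

end Zam

end

noncomputable section

namespace Zam

/-! ### Box-sums and the operators S̃ as involutive R-matrices -/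

section RMatrixLemmas

/-! Both Fock constructions yield *-representations of the Zamolodchikov algebra with a cyclic unit
vector annihilated by all `Z_α(f)`, and such representations are unitarily equivalent. Indeed, the
mixed relation moves annihilators to the right, so every element is a sum of products `c * a` with
`c` a polynomial in the `Z*` and `a` a polynomial in the `Z` (`Zalg.mem_creAlg_mul_annAlg`). On such
a product a vacuum functional sees only constant terms, so there is at most one
(`Zalg.vacuumFunctional_unique`). The inner products of the vectors `π(X)Ω` are values of this
functional, and the GNS argument produces the unitary (`Zalg.exists_linearIsometryEquiv`).

It remains to construct the representations. S̃, R̃ and S̃ ⊞ R̃ are again involutive R-matrices. The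
cosets of 𝔖ₙ in 𝔖ₙ₊₁ give the recursion `symAlg_succ`, Pₙ₊₁ = (n+1)⁻¹ ∑ₖ τₖ₋₁⋯τ₀ (1 ⊗ Pₙ), and the
braid relations turn it into τⱼ Pₙ = Pₙ (`adjAct_mul_symAlg`). Hence Pₙ is an orthogonal projection;
independence of `permOp` from the chosen word is never needed. The relation between two creators is
Pₙ τ₀ = Pₙ, the one between two annihilators is its adjoint, and the mixed relation is the recursion
contracted in the first tensor factor (`add_one_smul_contr_symAlg_cons`). All this uses R-matrices
only through their action on the spanning vectors v_α(f), as recorded in `IsExchangeFamily`; the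
same argument therefore serves S̃, R̃ and S̃ ⊞ R̃. On the tensor product of Fock spaces, the
generators belonging to H and to K act in different factors and commute, which is what the flip
blocks of S ⊞ R demand.

Finally, the unitary maps n-particle vectors to vectors obtained by n creations from the tensor
vacuum. These are orthogonal to a given vector of finite particle number once n is large, so V*
respects the finite-particle domains (`symm_tensorIncl_mem_Fock0`). -/

theorem inner_map_map_of_adjoint {A B C D : Type*}
    [NormedAddCommGroup A] [InnerProductSpace ℂ A] [NormedAddCommGroup B] [InnerProductSpace ℂ B]
    [NormedAddCommGroup C] [InnerProductSpace ℂ C] [NormedAddCommGroup D] [InnerProductSpace ℂ D]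
    {f : A →ₗ[ℂ] B} {f' : B →ₗ[ℂ] A} {g : C →ₗ[ℂ] D} {g' : D →ₗ[ℂ] C}
    (hf : ∀ a b, ⟪f a, b⟫_ℂ = ⟪a, f' b⟫_ℂ) (hg : ∀ c d, ⟪g c, d⟫_ℂ = ⟪c, g' d⟫_ℂ)
    (x : A ⊗[ℂ] C) (y : B ⊗[ℂ] D) :
    ⟪TensorProduct.map f g x, y⟫_ℂ = ⟪x, TensorProduct.map f' g' y⟫_ℂ := by
  induction x with
  | zero => simp
  | add x x' hx hx' => simp [inner_add_left, hx, hx']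
  | tmul a c =>
    induction y with
    | zero => simp
    | add y y' hy hy' => simp only [inner_add_right, map_add, hy, hy']
    | tmul b d => simp [hf, hg]

variable {V : Type u} [NormedAddCommGroup V] [InnerProductSpace ℂ V]
  {W : Type v} [NormedAddCommGroup W] [InnerProductSpace ℂ W]

theorem leg12_tmul (T : V ⊗[ℂ] V →L[ℂ] V ⊗[ℂ] V) (x : V ⊗[ℂ] V) (c : V) :
    leg12 T (x ⊗ₜ c) = T x ⊗ₜ c := rfl

theorem leg23_tmul (T : V ⊗[ℂ] V →L[ℂ] V ⊗[ℂ] V) (a b c : V) :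
    leg23 T ((a ⊗ₜ b) ⊗ₜ c) = (TensorProduct.assoc ℂ V V V).symm (a ⊗ₜ T (b ⊗ₜ c)) := rfl

section boxSum

@[simp] theorem projL_inlL (a : V) : projL V W (inlL V W a) = a := rfl
@[simp] theorem projR_inlL (a : V) : projR V W (inlL V W a) = 0 := rfl
@[simp] theorem projL_inrL (b : W) : projL V W (inrL V W b) = 0 := rfl
@[simp] theorem projR_inrL (b : W) : projR V W (inrL V W b) = b := rfl

theorem inlL_add_inrL (x : DSum V W) : inlL V W (projL V W x) + inrL V W (projR V W x) = x := by
  refine WithLp.ofLp_injective 2 (Prod.ext ?_ ?_)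
  · exact add_zero _
  · exact zero_add _

theorem DSum.inner_def (x y : DSum V W) :
    ⟪x, y⟫_ℂ = ⟪projL V W x, projL V W y⟫_ℂ + ⟪projR V W x, projR V W y⟫_ℂ :=
  WithLp.prod_inner_apply (𝕜 := ℂ) (E := V) (F := W) x y

theorem inner_inlL (a : V) (x : DSum V W) : ⟪inlL V W a, x⟫_ℂ = ⟪a, projL V W x⟫_ℂ := by
  simp [DSum.inner_def]

theorem inner_inrL (b : W) (x : DSum V W) : ⟪inrL V W b, x⟫_ℂ = ⟪b, projR V W x⟫_ℂ := by
  simp [DSum.inner_def]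

theorem inner_projL (x : DSum V W) (a : V) : ⟪projL V W x, a⟫_ℂ = ⟪x, inlL V W a⟫_ℂ := by
  simp [DSum.inner_def]

theorem inner_projR (x : DSum V W) (b : W) : ⟪projR V W x, b⟫_ℂ = ⟪x, inrL V W b⟫_ℂ := by
  simp [DSum.inner_def]

variable (T : V ⊗[ℂ] V →L[ℂ] V ⊗[ℂ] V) (Q : W ⊗[ℂ] W →L[ℂ] W ⊗[ℂ] W)

theorem boxSum_inl_inl (x : V ⊗[ℂ] V) :
    boxSum T Q (TensorProduct.map (inlL V W : V →ₗ[ℂ] DSum V W) (inlL V W : V →ₗ[ℂ] DSum V W) x) =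
      TensorProduct.map (inlL V W : V →ₗ[ℂ] DSum V W) (inlL V W : V →ₗ[ℂ] DSum V W) (T x) := by
  induction x with
  | zero => simp
  | add x y hx hy => simp only [map_add, hx, hy]
  | tmul a b => simp [boxSum]

theorem boxSum_inr_inr (x : W ⊗[ℂ] W) :
    boxSum T Q (TensorProduct.map (inrL V W : W →ₗ[ℂ] DSum V W) (inrL V W : W →ₗ[ℂ] DSum V W) x) =
      TensorProduct.map (inrL V W : W →ₗ[ℂ] DSum V W) (inrL V W : W →ₗ[ℂ] DSum V W) (Q x) := by
  induction x with
  | zero => simp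
  | add x y hx hy => simp only [map_add, hx, hy]
  | tmul a b => simp [boxSum]

theorem boxSum_inl_inr (a : V) (b : W) :
    boxSum T Q (inlL V W a ⊗ₜ inrL V W b) = inrL V W b ⊗ₜ inlL V W a := by
  simp [boxSum, flip]

theorem boxSum_inr_inl (a : V) (b : W) :
    boxSum T Q (inrL V W b ⊗ₜ inlL V W a) = inlL V W a ⊗ₜ inrL V W b := by
  simp [boxSum, flip]

theorem DSum.tmul_induction {p : DSum V W ⊗[ℂ] DSum V W → Prop} (x : DSum V W ⊗[ℂ] DSum V W)
    (hadd : ∀ x y, p x → p y → p (x + y)) (hll : ∀ a b, p (inlL V W a ⊗ₜ inlL V W b))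
    (hlr : ∀ a b, p (inlL V W a ⊗ₜ inrL V W b)) (hrl : ∀ a b, p (inrL V W a ⊗ₜ inlL V W b))
    (hrr : ∀ a b, p (inrL V W a ⊗ₜ inrL V W b)) : p x := by
  induction x with
  | zero => simpa using hll 0 0
  | add x y hx hy => exact hadd x y hx hy
  | tmul x y =>
    rw [← inlL_add_inrL x, ← inlL_add_inrL y, TensorProduct.add_tmul, TensorProduct.tmul_add,
      TensorProduct.tmul_add]
    exact hadd _ _ (hadd _ _ (hll _ _) (hlr _ _)) (hadd _ _ (hrl _ _) (hrr _ _))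

theorem boxSum_involutive (hT : T ∘L T = ContinuousLinearMap.id ℂ _)
    (hQ : Q ∘L Q = ContinuousLinearMap.id ℂ _) :
    boxSum T Q ∘L boxSum T Q = ContinuousLinearMap.id ℂ _ := by
  ext x
  simp only [ContinuousLinearMap.comp_apply, ContinuousLinearMap.id_apply]
  have hT' : ∀ x, T (T x) = x := fun x => DFunLike.congr_fun hT x
  have hQ' : ∀ x, Q (Q x) = x := fun x => DFunLike.congr_fun hQ x
  induction x using DSum.tmul_induction with
  | hadd x y hx hy => simp only [map_add, hx, hy]
  | hll a b =>
    refine (congrArg (boxSum T Q) (boxSum_inl_inl T Q (a ⊗ₜ b))).trans ?_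
    rw [boxSum_inl_inl, hT', TensorProduct.map_tmul]
    rfl
  | hrr a b =>
    refine (congrArg (boxSum T Q) (boxSum_inr_inr T Q (a ⊗ₜ b))).trans ?_
    rw [boxSum_inr_inr, hQ', TensorProduct.map_tmul]
    rfl
  | hlr a b => rw [boxSum_inl_inr, boxSum_inr_inl]
  | hrl a b => rw [boxSum_inr_inl, boxSum_inl_inr]

theorem inner_flip (x : V ⊗[ℂ] W) (y : W ⊗[ℂ] V) : ⟪flip V W x, y⟫_ℂ = ⟪x, flip W V y⟫_ℂ := by
  have h : y = flip V W (flip W V y) := by simp [flip]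
  conv_lhs => rw [h]
  exact (TensorProduct.commIsometry ℂ V W).inner_map_map _ _

theorem boxSum_selfAdjoint (hT : ∀ x y, ⟪T x, y⟫_ℂ = ⟪x, T y⟫_ℂ)
    (hQ : ∀ x y, ⟪Q x, y⟫_ℂ = ⟪x, Q y⟫_ℂ) (x y : DSum V W ⊗[ℂ] DSum V W) :
    ⟪boxSum T Q x, y⟫_ℂ = ⟪x, boxSum T Q y⟫_ℂ := by
  have hl : ∀ (a : V) (x : DSum V W),
      ⟪(inlL V W : V →ₗ[ℂ] DSum V W) a, x⟫_ℂ = ⟪a, (projL V W : DSum V W →ₗ[ℂ] V) x⟫_ℂ := inner_inlL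
  have hr : ∀ (a : W) (x : DSum V W),
      ⟪(inrL V W : W →ₗ[ℂ] DSum V W) a, x⟫_ℂ = ⟪a, (projR V W : DSum V W →ₗ[ℂ] W) x⟫_ℂ := inner_inrL
  have hl' : ∀ (x : DSum V W) (a : V),
      ⟪(projL V W : DSum V W →ₗ[ℂ] V) x, a⟫_ℂ = ⟪x, (inlL V W : V →ₗ[ℂ] DSum V W) a⟫_ℂ := inner_projL
  have hr' : ∀ (x : DSum V W) (a : W),
      ⟪(projR V W : DSum V W →ₗ[ℂ] W) x, a⟫_ℂ = ⟪x, (inrL V W : W →ₗ[ℂ] DSum V W) a⟫_ℂ := inner_projR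
  simp only [boxSum, add_apply, ContinuousLinearMap.comp_apply, inner_add_left,
    inner_add_right, TensorProduct.mapL_apply]
  rw [inner_map_map_of_adjoint hl hl, hT, inner_map_map_of_adjoint hl' hl',
    inner_map_map_of_adjoint hr hr, hQ, inner_map_map_of_adjoint hr' hr',
    inner_map_map_of_adjoint hr hl, inner_flip, inner_map_map_of_adjoint hl' hr',
    inner_map_map_of_adjoint hl hr, inner_flip, inner_map_map_of_adjoint hr' hl']
  ring

/-- The Yang-Baxter equation on triples of vectors of which at least two are in the range of `i`,
for an operator that is `T` on this range and the flip between the ranges of `i` and `j`. -/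
theorem yangBaxter_of_flip {D : Type*} [NormedAddCommGroup D] [InnerProductSpace ℂ D]
    {B : D ⊗[ℂ] D →L[ℂ] D ⊗[ℂ] D} {i : V →ₗ[ℂ] D} {j : W →ₗ[ℂ] D}
    {T : V ⊗[ℂ] V →L[ℂ] V ⊗[ℂ] V}
    (hT : leg12 T ∘L leg23 T ∘L leg12 T = leg23 T ∘L leg12 T ∘L leg23 T)
    (hii : ∀ x, B (TensorProduct.map i i x) = TensorProduct.map i i (T x))
    (hij : ∀ a b, B (i a ⊗ₜ j b) = j b ⊗ₜ i a) (hji : ∀ a b, B (j b ⊗ₜ i a) = i a ⊗ₜ j b)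
    (a b c : V) (w : W) :
    (leg12 B (leg23 B (leg12 B ((i a ⊗ₜ i b) ⊗ₜ i c))) =
      leg23 B (leg12 B (leg23 B ((i a ⊗ₜ i b) ⊗ₜ i c)))) ∧
    (leg12 B (leg23 B (leg12 B ((i a ⊗ₜ i b) ⊗ₜ j w))) =
      leg23 B (leg12 B (leg23 B ((i a ⊗ₜ i b) ⊗ₜ j w)))) ∧
    (leg12 B (leg23 B (leg12 B ((i a ⊗ₜ j w) ⊗ₜ i b))) =
      leg23 B (leg12 B (leg23 B ((i a ⊗ₜ j w) ⊗ₜ i b)))) ∧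
    (leg12 B (leg23 B (leg12 B ((j w ⊗ₜ i a) ⊗ₜ i b))) =
      leg23 B (leg12 B (leg23 B ((j w ⊗ₜ i a) ⊗ₜ i b)))) := by
  have h12 : ∀ y, leg12 B (TensorProduct.map (TensorProduct.map i i) i y) =
      TensorProduct.map (TensorProduct.map i i) i (leg12 T y) := by
    intro y
    induction y with
    | zero => simp
    | add x y hx hy => simp only [map_add, hx, hy]
    | tmul x c => simp only [TensorProduct.map_tmul, leg12_tmul, hii]
  have hass : ∀ a x, (TensorProduct.assoc ℂ D D D).symm (i a ⊗ₜ TensorProduct.map i i x) =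
      TensorProduct.map (TensorProduct.map i i) i ((TensorProduct.assoc ℂ V V V).symm (a ⊗ₜ x)) := by
    intro a x
    induction x with
    | zero => simp
    | add x y hx hy => simp only [map_add, hx, hy, TensorProduct.tmul_add]
    | tmul b c => rfl
  have h23 : ∀ y, leg23 B (TensorProduct.map (TensorProduct.map i i) i y) =
      TensorProduct.map (TensorProduct.map i i) i (leg23 T y) := by
    intro y
    induction y with
    | zero => simp
    | add x y hx hy => simp only [map_add, hx, hy]
    | tmul x c =>
      induction x with
      | zero => simp
      | add x y hx hy => simp only [map_add, hx, hy, TensorProduct.add_tmul]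
      | tmul a b =>
        simp only [TensorProduct.map_tmul, leg23_tmul]
        rw [← hass, ← hii, TensorProduct.map_tmul]
  have hab : ∀ a b, B (i a ⊗ₜ i b) = TensorProduct.map i i (T (a ⊗ₜ b)) := fun a b => hii (a ⊗ₜ b)
  -- With a single factor `j w`, both sides of the equation carry it past the pair by flips and
  -- apply `T` once to the pair. The next three identities are these transports: last place to
  -- first, the coincidence of both routes into the middle, and first place to last.
  have e1 : ∀ x : V ⊗[ℂ] V, leg12 B (leg23 B (TensorProduct.map i i x ⊗ₜ j w)) =
      (TensorProduct.assoc ℂ D D D).symm (j w ⊗ₜ TensorProduct.map i i x) := by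
    intro x
    induction x with
    | zero => simp
    | add x y hx hy => simp only [map_add, hx, hy, TensorProduct.add_tmul, TensorProduct.tmul_add]
    | tmul a b =>
      simp [leg23_tmul, hij, leg12_tmul]
  have e2 : ∀ x : V ⊗[ℂ] V, leg12 B ((TensorProduct.assoc ℂ D D D).symm
      (j w ⊗ₜ TensorProduct.map i i x)) = leg23 B (TensorProduct.map i i x ⊗ₜ j w) := by
    intro x
    induction x with
    | zero => simp
    | add x y hx hy => simp only [map_add, hx, hy, TensorProduct.add_tmul, TensorProduct.tmul_add]
    | tmul a b =>
      simp [leg23_tmul, hij, hji, leg12_tmul]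
  have e3 : ∀ x : V ⊗[ℂ] V, leg23 B (leg12 B ((TensorProduct.assoc ℂ D D D).symm
      (j w ⊗ₜ TensorProduct.map i i x))) = TensorProduct.map i i x ⊗ₜ j w := by
    intro x
    induction x with
    | zero => simp
    | add x y hx hy => simp only [map_add, hx, hy, TensorProduct.add_tmul, TensorProduct.tmul_add]
    | tmul a b =>
      simp [leg23_tmul, hji, leg12_tmul]
  refine ⟨?_, ?_, ?_, ?_⟩
  · have h := congrArg (TensorProduct.map (TensorProduct.map i i) i)
      (DFunLike.congr_fun hT ((a ⊗ₜ b) ⊗ₜ c))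
    simp only [ContinuousLinearMap.comp_apply, ← h12, ← h23] at h
    exact h
  · rw [leg12_tmul, hab, e1, leg23_tmul, hij]
    simp only [TensorProduct.assoc_symm_tmul, leg12_tmul, hij]
    rw [leg23_tmul, hab]
  · rw [leg12_tmul, hij, leg23_tmul, hab, e2]
    conv_rhs => rw [leg23_tmul, hji, TensorProduct.assoc_symm_tmul, leg12_tmul, hab]
  · rw [leg23_tmul, hab, e3, leg12_tmul, hji, leg23_tmul, hji, TensorProduct.assoc_symm_tmul,
      leg12_tmul, hab]

/-- Of three vectors, each from one of the two summands, at least two come from the same one. So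
`yangBaxter_of_flip`, used once with each summand as the majority, covers all eight blocks. -/
theorem IsInvolutiveRMatrix.boxSum {T : V ⊗[ℂ] V →L[ℂ] V ⊗[ℂ] V} {Q : W ⊗[ℂ] W →L[ℂ] W ⊗[ℂ] W}
    (hT : IsInvolutiveRMatrix T) (hQ : IsInvolutiveRMatrix Q) :
    IsInvolutiveRMatrix (boxSum T Q) where
  selfAdjoint := boxSum_selfAdjoint T Q hT.selfAdjoint hQ.selfAdjoint
  involutive := boxSum_involutive T Q hT.involutive hQ.involutive
  yangBaxter := by
    ext x
    simp only [ContinuousLinearMap.comp_apply]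
    have hl := yangBaxter_of_flip (i := (inlL V W : V →ₗ[ℂ] DSum V W))
      (j := (inrL V W : W →ₗ[ℂ] DSum V W)) hT.yangBaxter (boxSum_inl_inl T Q) (boxSum_inl_inr T Q)
      (boxSum_inr_inl T Q)
    have hr := yangBaxter_of_flip (i := (inrL V W : W →ₗ[ℂ] DSum V W))
      (j := (inlL V W : V →ₗ[ℂ] DSum V W)) hQ.yangBaxter (boxSum_inr_inr T Q)
      (fun a b => boxSum_inr_inl T Q b a) (fun a b => boxSum_inl_inr T Q b a)
    simp only [ContinuousLinearMap.coe_coe] at hl hr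
    induction x with
    | zero => simp
    | add x y hx hy => simp only [map_add, hx, hy]
    | tmul x z =>
      rw [← inlL_add_inrL z]
      induction x using DSum.tmul_induction with
      | hadd x y hx hy => simp only [map_add, hx, hy, TensorProduct.add_tmul]
      | hll a b =>
        -- The argument `0` fills the variable that does not occur in the selected conjunct.
        simp only [map_add, TensorProduct.tmul_add, (hl _ _ _ 0).1, (hl _ _ 0 _).2.1]
      | hlr a b =>
        simp only [map_add, TensorProduct.tmul_add, (hl _ _ 0 _).2.2.1, (hr _ _ 0 _).2.2.2]
      | hrl a b =>
        simp only [map_add, TensorProduct.tmul_add, (hr _ _ 0 _).2.2.1, (hl _ _ 0 _).2.2.2]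
      | hrr a b =>
        simp only [map_add, TensorProduct.tmul_add, (hr _ _ 0 _).2.1, (hr _ _ _ 0).1]

end boxSum

section tilde

variable (L : Type w) [NormedAddCommGroup L] [InnerProductSpace ℂ L]

theorem exchangeInner_exchangeInner {A B C D : Type*}
    [NormedAddCommGroup A] [InnerProductSpace ℂ A] [NormedAddCommGroup B] [InnerProductSpace ℂ B]
    [NormedAddCommGroup C] [InnerProductSpace ℂ C] [NormedAddCommGroup D] [InnerProductSpace ℂ D]
    (x : (A ⊗[ℂ] B) ⊗[ℂ] (C ⊗[ℂ] D)) :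
    exchangeInner A C B D (exchangeInner A B C D x) = x := by
  refine DFunLike.congr_fun (f := ((exchangeInner A C B D ∘L exchangeInner A B C D :
    (A ⊗[ℂ] B) ⊗[ℂ] (C ⊗[ℂ] D) →L[ℂ] (A ⊗[ℂ] B) ⊗[ℂ] (C ⊗[ℂ] D)) : _ →ₗ[ℂ] _))
    (g := LinearMap.id) ?_ x
  ext a b c d
  rfl

theorem inner_exchangeInner {A B C D : Type*}
    [NormedAddCommGroup A] [InnerProductSpace ℂ A] [NormedAddCommGroup B] [InnerProductSpace ℂ B]
    [NormedAddCommGroup C] [InnerProductSpace ℂ C] [NormedAddCommGroup D] [InnerProductSpace ℂ D]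
    (x : (A ⊗[ℂ] B) ⊗[ℂ] (C ⊗[ℂ] D)) (y : (A ⊗[ℂ] C) ⊗[ℂ] (B ⊗[ℂ] D)) :
    ⟪exchangeInner A B C D x, y⟫_ℂ = ⟪x, exchangeInner A C B D y⟫_ℂ := by
  induction x with
  | zero => simp
  | add x x' hx hx' => simp only [map_add, inner_add_left, hx, hx']
  | tmul p q =>
  induction p with
  | zero => simp
  | add x x' hx hx' => simp only [map_add, inner_add_left, hx, hx', TensorProduct.add_tmul]
  | tmul a b =>
  induction q with
  | zero => simp
  | add x x' hx hx' => simp only [map_add, inner_add_left, hx, hx', TensorProduct.tmul_add]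
  | tmul c d =>
  induction y with
  | zero => simp
  | add x x' hx hx' => simp only [map_add, inner_add_right, hx, hx']
  | tmul p q =>
  induction p with
  | zero => simp
  | add x x' hx hx' => simp only [map_add, inner_add_right, hx, hx', TensorProduct.add_tmul]
  | tmul a' b' =>
  induction q with
  | zero => simp
  | add x x' hx hx' => simp only [map_add, inner_add_right, hx, hx', TensorProduct.tmul_add]
  | tmul c' d' =>
    simp only [exchangeInner_tmul, TensorProduct.inner_tmul]
    ring

variable (S : V ⊗[ℂ] V →L[ℂ] V ⊗[ℂ] V)

theorem tilde_exchangeInner (x : V ⊗[ℂ] V) (f g : L) :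
    tilde L S (exchangeInner V V L L (x ⊗ₜ (f ⊗ₜ g))) =
      exchangeInner V V L L (S x ⊗ₜ (g ⊗ₜ f)) := by
  simp only [tilde, boxTimes, ContinuousLinearMap.comp_apply, exchangeInner_exchangeInner,
    TensorProduct.mapL_tmul]
  rfl

theorem tilde_tmul (a b : V) (f g : L) :
    tilde L S ((a ⊗ₜ f) ⊗ₜ (b ⊗ₜ g)) = exchangeInner V V L L (S (a ⊗ₜ b) ⊗ₜ (g ⊗ₜ f)) :=
  tilde_exchangeInner L S (a ⊗ₜ b) f g

theorem tmul4_induction {A B C D : Type*}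
    [NormedAddCommGroup A] [InnerProductSpace ℂ A] [NormedAddCommGroup B] [InnerProductSpace ℂ B]
    [NormedAddCommGroup C] [InnerProductSpace ℂ C] [NormedAddCommGroup D] [InnerProductSpace ℂ D]
    {p : (A ⊗[ℂ] B) ⊗[ℂ] (C ⊗[ℂ] D) → Prop} (x : (A ⊗[ℂ] B) ⊗[ℂ] (C ⊗[ℂ] D))
    (add : ∀ x y, p x → p y → p (x + y)) (tmul : ∀ a b c d, p ((a ⊗ₜ b) ⊗ₜ (c ⊗ₜ d))) : p x := by
  have h0 : p 0 := by simpa using tmul 0 0 0 0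
  induction x with
  | zero => exact h0
  | add x y hx hy => exact add x y hx hy
  | tmul x y =>
    induction x with
    | zero => simpa using h0
    | add x x' hx hx' => rw [TensorProduct.add_tmul]; exact add _ _ hx hx'
    | tmul a b =>
      induction y with
      | zero => simpa using h0
      | add y y' hy hy' => rw [TensorProduct.tmul_add]; exact add _ _ hy hy'
      | tmul c d => exact tmul a b c d

theorem IsInvolutiveRMatrix.tilde {S : V ⊗[ℂ] V →L[ℂ] V ⊗[ℂ] V} (hS : IsInvolutiveRMatrix S) :
    IsInvolutiveRMatrix (tilde L S) where
  selfAdjoint x y := by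
    simp only [Zam.tilde, boxTimes, ContinuousLinearMap.comp_apply, TensorProduct.mapL_apply]
    have hS' : ∀ x y, ⟪(S : V ⊗[ℂ] V →ₗ[ℂ] V ⊗[ℂ] V) x, y⟫_ℂ =
      ⟪x, (S : V ⊗[ℂ] V →ₗ[ℂ] V ⊗[ℂ] V) y⟫_ℂ := hS.selfAdjoint
    have hF : ∀ x y, ⟪(flip L L : L ⊗[ℂ] L →ₗ[ℂ] L ⊗[ℂ] L) x, y⟫_ℂ =
      ⟪x, (flip L L : L ⊗[ℂ] L →ₗ[ℂ] L ⊗[ℂ] L) y⟫_ℂ :=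
      inner_flip (V := L) (W := L)
    rw [inner_exchangeInner, inner_map_map_of_adjoint hS' hF, inner_exchangeInner]
  involutive := by
    ext x
    simp only [ContinuousLinearMap.comp_apply, ContinuousLinearMap.id_apply]
    have hS' : ∀ x, S (S x) = x := fun x => DFunLike.congr_fun hS.involutive x
    induction x using tmul4_induction with
    | add x y hx hy => simp only [map_add, hx, hy]
    | tmul a f b g => rw [tilde_tmul, tilde_exchangeInner, hS', exchangeInner_tmul]
  yangBaxter := by
    -- `E` regroups the factors so that the `V`-part and the `L`-part separate. There the legs of S̃
    -- become legs of `S` together with transpositions of `f`, `g`, `h`, and both triple products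
    -- reverse the order of `f`, `g`, `h`.
    let E : ((V ⊗[ℂ] V) ⊗[ℂ] V) ⊗[ℂ] ((L ⊗[ℂ] L) ⊗[ℂ] L) →ₗ[ℂ]
        ((V ⊗[ℂ] L) ⊗[ℂ] (V ⊗[ℂ] L)) ⊗[ℂ] (V ⊗[ℂ] L) :=
      (LinearMap.rTensor (V ⊗[ℂ] L) (exchangeInner V V L L).toLinearMap) ∘ₗ
        (exchangeInner (V ⊗[ℂ] V) V (L ⊗[ℂ] L) L).toLinearMap
    have hE : ∀ x c y h, E ((x ⊗ₜ c) ⊗ₜ (y ⊗ₜ h)) = exchangeInner V V L L (x ⊗ₜ y) ⊗ₜ (c ⊗ₜ h) :=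
      fun _ _ _ _ => rfl
    have h12 : ∀ (y : (V ⊗[ℂ] V) ⊗[ℂ] V) (f g h : L), leg12 (Zam.tilde L S)
        (E (y ⊗ₜ ((f ⊗ₜ g) ⊗ₜ h))) = E (leg12 S y ⊗ₜ ((g ⊗ₜ f) ⊗ₜ h)) := by
      intro y f g h
      induction y with
      | zero => simp
      | add x y hx hy => simp only [map_add, hx, hy, TensorProduct.add_tmul]
      | tmul x c => rw [hE, leg12_tmul, tilde_exchangeInner, leg12_tmul, hE]
    have hass : ∀ (a : V) (x : V ⊗[ℂ] V) (f g h : L),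
        (TensorProduct.assoc ℂ _ _ _).symm
          ((a ⊗ₜ[ℂ] f) ⊗ₜ exchangeInner V V L L (x ⊗ₜ (g ⊗ₜ h))) =
        E ((TensorProduct.assoc ℂ _ _ _).symm (a ⊗ₜ x) ⊗ₜ ((f ⊗ₜ g) ⊗ₜ h)) := by
      intro a x f g h
      induction x with
      | zero => simp
      | add x y hx hy => simp only [map_add, hx, hy, TensorProduct.add_tmul, TensorProduct.tmul_add]
      | tmul x c => rfl
    have h23 : ∀ (y : (V ⊗[ℂ] V) ⊗[ℂ] V) (f g h : L), leg23 (Zam.tilde L S)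
        (E (y ⊗ₜ ((f ⊗ₜ g) ⊗ₜ h))) = E (leg23 S y ⊗ₜ ((f ⊗ₜ h) ⊗ₜ g)) := by
      intro y f g h
      induction y with
      | zero => simp
      | add x y hx hy => simp only [map_add, hx, hy, TensorProduct.add_tmul]
      | tmul x c =>
        induction x with
        | zero => simp
        | add x y hx hy => simp only [map_add, hx, hy, TensorProduct.add_tmul]
        | tmul a b => rw [hE, exchangeInner_tmul, leg23_tmul, tilde_tmul, hass, leg23_tmul]
    ext x
    simp only [ContinuousLinearMap.comp_apply]
    induction x with
    | zero => simp
    | add x y hx hy => simp only [map_add, hx, hy]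
    | tmul x y =>
    induction y with
    | zero => simp
    | add x y hx hy => simp only [map_add, hx, hy, TensorProduct.tmul_add]
    | tmul c h =>
    induction x using tmul4_induction with
    | add x y hx hy => simp only [map_add, hx, hy, TensorProduct.add_tmul]
    | tmul a f b g =>
      have e : ((a ⊗ₜ[ℂ] f) ⊗ₜ[ℂ] (b ⊗ₜ[ℂ] g)) ⊗ₜ[ℂ] (c ⊗ₜ[ℂ] h) =
        E (((a ⊗ₜ b) ⊗ₜ c) ⊗ₜ ((f ⊗ₜ g) ⊗ₜ h)) := rfl
      have hy := DFunLike.congr_fun hS.yangBaxter ((a ⊗ₜ b) ⊗ₜ c)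
      simp only [ContinuousLinearMap.comp_apply] at hy
      rw [e, h12, h23, h12, h23, h12, h23, hy]

end tilde

end RMatrixLemmas

/-! ### The action of the symmetric groups and the symmetrisers -/

section SymmetricGroupAction

variable {V : Type u} [NormedAddCommGroup V] [InnerProductSpace ℂ V]

@[elab_as_elim]
theorem TPow.cons_induction {n : ℕ} {p : TPow V (n + 1) → Prop} (x : TPow V (n + 1))
    (add : ∀ x y, p x → p y → p (x + y)) (cons : ∀ a x, p (TPow.cons V n (a ⊗ₜ x))) : p x := by
  obtain ⟨x, rfl⟩ := (TPow.cons V n).surjective x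
  induction x with
  | zero => simpa using cons 0 0
  | add x y hx hy => rw [map_add]; exact add _ _ hx hy
  | tmul a x => exact cons a x

/-- The identification `(V ⊗ V) ⊗ V^{⊗n} = V^{⊗(n+2)}`. -/
def TPow.head (V : Type u) [NormedAddCommGroup V] [InnerProductSpace ℂ V] (n : ℕ) :
    (V ⊗[ℂ] V) ⊗[ℂ] TPow V n ≃ₗᵢ[ℂ] TPow V (n + 2) :=
  ((TensorProduct.assocIsometry ℂ V V (TPow V n)).trans
    ((TPow.cons V n).lTensor V)).trans (TPow.cons V (n + 1))

theorem TPow.head_tmul (n : ℕ) (a b : V) (x : TPow V n) :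
    TPow.head V n ((a ⊗ₜ b) ⊗ₜ x) = TPow.cons V (n + 1) (a ⊗ₜ TPow.cons V n (b ⊗ₜ x)) := rfl

theorem TPow.head_induction {n : ℕ} {p : TPow V (n + 2) → Prop} (x : TPow V (n + 2))
    (add : ∀ x y, p x → p y → p (x + y)) (head : ∀ w x, p (TPow.head V n (w ⊗ₜ x))) : p x := by
  obtain ⟨x, rfl⟩ := (TPow.head V n).surjective x
  induction x with
  | zero => simpa using head 0 0
  | add x y hx hy => rw [map_add]; exact add _ _ hx hy
  | tmul a x => exact head a x

theorem consL_apply (ψ : V) (n : ℕ) (x : TPow V n) :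
    TPow.consL ψ n x = TPow.cons V n (ψ ⊗ₜ x) := rfl

theorem actTail_cons {n : ℕ} (A : TPow V n →L[ℂ] TPow V n) (a : V) (x : TPow V n) :
    actTail A (TPow.cons V n (a ⊗ₜ x)) = TPow.cons V n (a ⊗ₜ A x) := rfl

theorem actHead_head (T : V ⊗[ℂ] V →L[ℂ] V ⊗[ℂ] V) (n : ℕ) (w : V ⊗[ℂ] V) (x : TPow V n) :
    actHead T n (TPow.head V n (w ⊗ₜ x)) = TPow.head V n (T w ⊗ₜ x) := by
  change (TPow.head V n) ((T.rTensor (TPow V n)) ((TPow.head V n).symm _)) = _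
  -- `TPow.head` is by definition the identification used inside `actHead`.
  rw [LinearIsometryEquiv.symm_apply_apply]
  rfl

theorem actTail_actTail_head {n : ℕ} (A : TPow V n →L[ℂ] TPow V n) (w : V ⊗[ℂ] V) (x : TPow V n) :
    actTail (actTail A) (TPow.head V n (w ⊗ₜ x)) = TPow.head V n (w ⊗ₜ A x) := by
  induction w with
  | zero => simp
  | add w w' h h' => simp only [TensorProduct.add_tmul, map_add, h, h']
  | tmul a b => rfl

theorem actTail_one {n : ℕ} : actTail (1 : TPow V n →L[ℂ] TPow V n) = 1 := by
  ext x
  induction x using TPow.cons_induction with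
  | add x y hx hy => rw [map_add, hx, hy, map_add]
  | cons a x => rfl

theorem actTail_mul {n : ℕ} (A B : TPow V n →L[ℂ] TPow V n) :
    actTail (A * B) = actTail A * actTail B := by
  ext x
  induction x using TPow.cons_induction with
  | add x y hx hy => rw [map_add, hx, hy, map_add]
  | cons a x => rfl

/-- `A ↦ 1 ⊗ A` as a homomorphism. -/
def actTailHom (V : Type u) [NormedAddCommGroup V] [InnerProductSpace ℂ V] (n : ℕ) :
    (TPow V n →L[ℂ] TPow V n) →* (TPow V (n + 1) →L[ℂ] TPow V (n + 1)) where
  toFun := actTail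
  map_one' := actTail_one
  map_mul' := actTail_mul

theorem actTail_add {n : ℕ} (A B : TPow V n →L[ℂ] TPow V n) :
    actTail (A + B) = actTail A + actTail B := by
  ext x
  simp [actTail]

theorem actTail_smul {n : ℕ} (c : ℂ) (A : TPow V n →L[ℂ] TPow V n) :
    actTail (c • A) = c • actTail A := by
  ext x
  simp [actTail]

theorem actTail_sum {n : ℕ} {ι : Type*} (s : Finset ι) (A : ι → TPow V n →L[ℂ] TPow V n) :
    actTail (∑ i ∈ s, A i) = ∑ i ∈ s, actTail (A i) :=
  map_sum (⟨⟨actTail, by simpa using actTail_smul (V := V) (n := n) 0 0⟩, actTail_add⟩ :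
    (TPow V n →L[ℂ] TPow V n) →+ (TPow V (n + 1) →L[ℂ] TPow V (n + 1))) A s

variable (T : V ⊗[ℂ] V →L[ℂ] V ⊗[ℂ] V)

theorem adjAct_succ (n k : ℕ) : adjAct T (n + 1) (k + 1) = actTail (adjAct T n k) := by
  cases n with
  | zero => exact actTail_one.symm
  | succ n => rfl

theorem adjAct_of_le {n k : ℕ} (h : n ≤ k + 1) : adjAct T n k = 1 := by
  induction n generalizing k with
  | zero => rfl
  | succ n ih =>
    cases k with
    | zero =>
      obtain rfl : n = 0 := by omega
      rfl
    | succ k => rw [adjAct_succ, ih (by omega), actTail_one]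

/-- Common leading factors are stripped by induction. What remains is an operator on the first two
factors against one of the form 1 ⊗ 1 ⊗ A. -/
theorem adjAct_commute {n j k : ℕ} (h : j + 2 ≤ k) :
    adjAct T n j * adjAct T n k = adjAct T n k * adjAct T n j := by
  induction n generalizing j k with
  | zero => rfl
  | succ n ih =>
    obtain ⟨k, rfl⟩ : ∃ k', k = k' + 2 := ⟨k - 2, by omega⟩
    cases j with
    | succ j => rw [adjAct_succ, adjAct_succ, ← actTail_mul, ih (by omega), actTail_mul]
    | zero =>
      cases n with
      | zero => rfl
      | succ n =>
        rw [adjAct_succ, adjAct_succ]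
        ext x
        simp only [mul_apply_eq_comp]
        induction x using TPow.head_induction with
        | add x y hx hy => simp only [map_add, hx, hy]
        | head w x => simp only [adjAct, actTail_actTail_head, actHead_head]

variable {T}

theorem actHead_braid (hT : IsInvolutiveRMatrix T) (n : ℕ) :
    actHead T (n + 1) * actTail (actHead T n) * actHead T (n + 1) =
      actTail (actHead T n) * actHead T (n + 1) * actTail (actHead T n) := by
  -- `E` isolates the first three tensor factors, where the claim is the Yang-Baxter equation.
  let E : ((V ⊗[ℂ] V) ⊗[ℂ] V) ⊗[ℂ] TPow V n →ₗ[ℂ] TPow V (n + 3) :=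
    (TPow.head V (n + 1)).toLinearEquiv.toLinearMap ∘ₗ
      (LinearMap.lTensor (V ⊗[ℂ] V) (TPow.cons V n).toLinearEquiv.toLinearMap) ∘ₗ
      (TensorProduct.assoc ℂ (V ⊗[ℂ] V) V (TPow V n)).toLinearMap
  have hE : ∀ w c x, E ((w ⊗ₜ c) ⊗ₜ x) = TPow.head V (n + 1) (w ⊗ₜ TPow.cons V n (c ⊗ₜ x)) :=
    fun _ _ _ => rfl
  have h12 : ∀ y x, actHead T (n + 1) (E (y ⊗ₜ x)) = E (leg12 T y ⊗ₜ x) := by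
    intro y x
    induction y with
    | zero => simp
    | add y y' h h' => simp only [TensorProduct.add_tmul, map_add, h, h']
    | tmul w c => rw [hE, actHead_head, leg12_tmul, hE]
  have hass : ∀ a w x, E ((TensorProduct.assoc ℂ V V V).symm (a ⊗ₜ w) ⊗ₜ x) =
      TPow.cons V (n + 2) (a ⊗ₜ TPow.head V n (w ⊗ₜ x)) := by
    intro a w x
    induction w with
    | zero => simp
    | add y y' h h' => simp only [TensorProduct.add_tmul, TensorProduct.tmul_add, map_add, h, h']
    | tmul b c => rfl
  have h23 : ∀ y x, actTail (actHead T n) (E (y ⊗ₜ x)) = E (leg23 T y ⊗ₜ x) := by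
    intro y x
    induction y with
    | zero => simp
    | add y y' h h' => simp only [TensorProduct.add_tmul, map_add, h, h']
    | tmul w c =>
      induction w with
      | zero => simp
      | add y y' h h' => simp only [TensorProduct.add_tmul, map_add, h, h']
      | tmul a b =>
        rw [leg23_tmul, hass, ← actHead_head, hE, TPow.head_tmul, actTail_cons, TPow.head_tmul]
  ext x
  simp only [mul_apply_eq_comp]
  induction x using TPow.head_induction with
  | add x y hx hy => simp only [map_add, hx, hy]
  | head w x =>
    induction x using TPow.cons_induction with
    | add x y hx hy => simp only [TensorProduct.tmul_add, map_add, hx, hy]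
    | cons c x =>
      have hy := DFunLike.congr_fun hT.yangBaxter (w ⊗ₜ c)
      simp only [ContinuousLinearMap.comp_apply] at hy
      rw [← hE, h12, h23, h12, h23, h12, h23, hy]

/-- The bound on `k` matters: for k + 2 = n the operator with index k + 1 is the identity by
convention, and the braid relation would force the other operator to be the identity too. -/
theorem adjAct_braid (hT : IsInvolutiveRMatrix T) {n k : ℕ} (h : k + 2 < n) :
    adjAct T n k * adjAct T n (k + 1) * adjAct T n k =
      adjAct T n (k + 1) * adjAct T n k * adjAct T n (k + 1) := by
  induction n generalizing k with
  | zero => omega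
  | succ n ih =>
    cases k with
    | succ k =>
      simp only [adjAct_succ, ← actTail_mul]
      rw [ih (by omega)]
    | zero =>
      obtain ⟨n, rfl⟩ : ∃ n', n = n' + 2 := ⟨n - 2, by omega⟩
      exact actHead_braid hT n

theorem adjAct_mul_self (hT : IsInvolutiveRMatrix T) (n k : ℕ) :
    adjAct T n k * adjAct T n k = 1 := by
  induction n generalizing k with
  | zero => rfl
  | succ n ih =>
    cases k with
    | succ k => rw [adjAct_succ, ← actTail_mul, ih, actTail_one]
    | zero =>
      cases n with
      | zero => rfl
      | succ n =>
        ext x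
        simp only [mul_apply_eq_comp, adjAct, one_apply_eq_self]
        induction x using TPow.head_induction with
        | add x y hx hy => simp only [map_add, hx, hy]
        | head w x =>
          rw [actHead_head, actHead_head]
          congr 2
          exact DFunLike.congr_fun hT.involutive w

theorem inner_actTail {n : ℕ} {A B : TPow V n →L[ℂ] TPow V n}
    (h : ∀ x y, ⟪A x, y⟫_ℂ = ⟪x, B y⟫_ℂ) (x y : TPow V (n + 1)) :
    ⟪actTail A x, y⟫_ℂ = ⟪x, actTail B y⟫_ℂ := by
  obtain ⟨x, rfl⟩ := (TPow.cons V n).surjective x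
  obtain ⟨y, rfl⟩ := (TPow.cons V n).surjective y
  have e : ∀ (A : TPow V n →L[ℂ] TPow V n) z, actTail A (TPow.cons V n z) =
      TPow.cons V n (TensorProduct.map LinearMap.id A.toLinearMap z) := by
    intro A z
    induction z with
    | zero => simp
    | add x y hx hy => simp only [map_add, hx, hy]
    | tmul a x => rfl
  rw [e, e, LinearIsometryEquiv.inner_map_map, LinearIsometryEquiv.inner_map_map]
  exact inner_map_map_of_adjoint (f := (LinearMap.id : V →ₗ[ℂ] V)) (f' := LinearMap.id)
    (g := A.toLinearMap) (g' := B.toLinearMap) (fun _ _ => rfl) h x y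

theorem inner_adjAct (hT : IsInvolutiveRMatrix T) (n k : ℕ) (x y : TPow V n) :
    ⟪adjAct T n k x, y⟫_ℂ = ⟪x, adjAct T n k y⟫_ℂ := by
  induction n generalizing k with
  | zero => rfl
  | succ n ih =>
    cases k with
    | succ k => rw [adjAct_succ]; exact inner_actTail (ih k) x y
    | zero =>
      cases n with
      | zero => rfl
      | succ n =>
        obtain ⟨x, rfl⟩ := (TPow.head V n).surjective x
        obtain ⟨y, rfl⟩ := (TPow.head V n).surjective y
        have h : ∀ z, adjAct T (n + 2) 0 (TPow.head V n z) =
            TPow.head V n (TensorProduct.map T.toLinearMap LinearMap.id z) := by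
          intro z
          induction z with
          | zero => simp
          | add x y hx hy => simp only [map_add, hx, hy]
          | tmul w x => exact actHead_head T n w x
        rw [h, h, LinearIsometryEquiv.inner_map_map, LinearIsometryEquiv.inner_map_map]
        exact inner_map_map_of_adjoint hT.selfAdjoint (fun _ _ => rfl) x y

variable (T)

/-- The operator `D_n(τ_{k-1}) ⋯ D_n(τ_0)` that moves the first tensor factor to position `k`. -/
def cycAct (n k : ℕ) : TPow V n →L[ℂ] TPow V n :=
  ((List.range k).reverse.map (adjAct T n)).prod

@[simp] theorem cycAct_zero (n : ℕ) : cycAct T n 0 = 1 := rfl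

theorem cycAct_succ (n k : ℕ) : cycAct T n (k + 1) = adjAct T n k * cycAct T n k := by
  simp [cycAct, List.range_succ]

/-- Splitting off the rightmost transposition instead of the leftmost: τₖ⋯τ₁ leaves the first factor
alone, so it commutes with contractions of that factor. -/
theorem cycAct_succ' (n k : ℕ) :
    cycAct T (n + 1) (k + 1) = actTail (cycAct T n k) * adjAct T (n + 1) 0 := by
  induction k with
  | zero => rw [cycAct_succ, cycAct_zero, cycAct_zero, actTail_one, one_mul, mul_one]
  | succ k ih => rw [cycAct_succ, ih, cycAct_succ, actTail_mul, adjAct_succ, mul_assoc]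

theorem adjAct_mul_cycAct_of_lt {n j k : ℕ} (h : k < j) :
    adjAct T n j * cycAct T n k = cycAct T n k * adjAct T n j := by
  induction k with
  | zero => simp
  | succ k ih =>
    rw [cycAct_succ, ← mul_assoc, ← adjAct_commute T (by omega : k + 2 ≤ j), mul_assoc,
      ih (by omega), mul_assoc]

variable {T}

/-- Moving τⱼ through the cycle τₖ₋₁⋯τ₀ shifts its index: it commutes with the transpositions down
to τⱼ₊₂, is turned into τⱼ₊₁ by one braid relation, and as such commutes with the rest. -/
theorem adjAct_mul_cycAct_of_add_two_le (hT : IsInvolutiveRMatrix T) {n j k : ℕ} (h : j + 2 ≤ k)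
    (hk : k < n) : adjAct T n j * cycAct T n k = cycAct T n k * adjAct T n (j + 1) := by
  induction k, h using Nat.le_induction with
  | base =>
    rw [cycAct_succ, cycAct_succ, mul_assoc, mul_assoc,
      ← adjAct_mul_cycAct_of_lt T (by omega : j < j + 1)]
    simp only [← mul_assoc]
    rw [adjAct_braid hT hk]
  | succ k h ih =>
    rw [cycAct_succ, ← mul_assoc, adjAct_commute T h, mul_assoc, ih (by omega), mul_assoc]

variable (T)

/-- This is the decomposition of 𝔖ₙ₊₁ into n + 1 cosets of 𝔖ₙ. Composing `p` with the cycle makes it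
fix `0`, so the first component of `decomposeFin` carries no information; injectivity and counting
finish the proof. -/
theorem bijective_permWord (n : ℕ) : Function.Bijective fun p : Equiv.Perm (Fin (n + 1)) =>
    (p 0, (Equiv.Perm.decomposeFin (Fin.cycleRange (p 0) * p)).2) := by
  have h0 : ∀ p : Equiv.Perm (Fin (n + 1)),
      (Equiv.Perm.decomposeFin (Fin.cycleRange (p 0) * p)).1 = 0 := by
    intro p
    have h1 := Equiv.Perm.decomposeFin_symm_apply_zero
      (Equiv.Perm.decomposeFin (Fin.cycleRange (p 0) * p)).1
      (Equiv.Perm.decomposeFin (Fin.cycleRange (p 0) * p)).2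
    rw [Prod.mk.eta, Equiv.symm_apply_apply] at h1
    rw [← h1]; simp
  rw [Fintype.bijective_iff_injective_and_card]
  refine ⟨fun p q h => ?_, ?_⟩
  · simp only [Prod.mk.injEq] at h
    have h2 := Equiv.Perm.decomposeFin.injective (Prod.ext ((h0 p).trans (h0 q).symm) h.2)
    rw [h.1] at h2
    exact mul_left_cancel h2
  · rw [← Fintype.card_congr (Equiv.Perm.decomposeFin (n := n))]

theorem permOp_succ (n : ℕ) (p : Equiv.Perm (Fin (n + 1))) :
    permOp T p = cycAct T (n + 1) (p 0) *
      actTail (permOp T (Equiv.Perm.decomposeFin (Fin.cycleRange (p 0) * p)).2) := by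
  rw [permOp, permWord, List.map_append, List.prod_append, cycAct]
  congr 1
  change _ = actTailHom V n _
  rw [permOp, map_list_prod, List.map_map, List.map_map]
  congr 2
  funext k
  exact adjAct_succ T n k

/-- The words chosen in `permWord` follow the coset decomposition, so the sum over 𝔖ₙ₊₁ factors.
From here on this recursion replaces the multiplicativity of `permOp`. -/
theorem symAlg_succ (n : ℕ) : symAlg T (n + 1) =
    ((n + 1 : ℂ)⁻¹) • ((∑ k : Fin (n + 1), cycAct T (n + 1) k) * actTail (symAlg T n)) := by
  have h : ∑ p : Equiv.Perm (Fin (n + 1)), permOp T p =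
      ∑ kq : Fin (n + 1) × Equiv.Perm (Fin n), cycAct T (n + 1) kq.1 * actTail (permOp T kq.2) := by
    rw [← (bijective_permWord n).sum_comp]
    exact Finset.sum_congr rfl fun p _ => permOp_succ T n p
  rw [symAlg, h, symAlg, actTail_smul, actTail_sum, mul_smul_comm, smul_smul, Finset.sum_mul_sum,
    Fintype.sum_prod_type, Nat.factorial_succ]
  push_cast
  rw [mul_inv]

variable {T}

/-- Left multiplication by τⱼ permutes the summands of the recursion. It exchanges the cycles with k
= j and k = j + 1. It passes through every other cycle, emerging as τⱼ or τⱼ₊₁ on its right, with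
positive index, and is then absorbed by 1 ⊗ Pₙ through the induction hypothesis. -/
theorem adjAct_mul_symAlg (hT : IsInvolutiveRMatrix T) (n j : ℕ) :
    adjAct T n j * symAlg T n = symAlg T n := by
  induction n generalizing j with
  | zero => rfl
  | succ n ih =>
    by_cases hj : n + 1 ≤ j + 1
    · rw [adjAct_of_le T hj, one_mul]
    have hA : ∀ i, adjAct T (n + 1) (i + 1) * actTail (symAlg T n) = actTail (symAlg T n) := by
      intro i
      rw [adjAct_succ, ← actTail_mul, ih]
    rw [symAlg_succ, mul_smul_comm, Finset.sum_mul, Finset.mul_sum]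
    congr 1
    rw [← Equiv.sum_comp (Equiv.swap (⟨j, by omega⟩ : Fin (n + 1)) ⟨j + 1, by omega⟩)]
    refine Finset.sum_congr rfl fun k _ => ?_
    rw [← mul_assoc]
    rcases eq_or_ne (k : ℕ) j with h | h
    · have hk : k = ⟨j, by omega⟩ := Fin.ext h
      rw [hk, Equiv.swap_apply_left]
      dsimp only
      rw [cycAct_succ, ← mul_assoc, adjAct_mul_self hT, one_mul]
    rcases eq_or_ne (k : ℕ) (j + 1) with h' | h'
    · have hk : k = ⟨j + 1, by omega⟩ := Fin.ext h'
      rw [hk, Equiv.swap_apply_right]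
      dsimp only
      rw [cycAct_succ]
    rw [Equiv.swap_apply_of_ne_of_ne (fun hk => h (congrArg Fin.val hk))
      (fun hk => h' (congrArg Fin.val hk))]
    rcases lt_or_gt_of_ne h with hlt | hgt
    · obtain ⟨i, rfl⟩ : ∃ i, j = i + 1 := ⟨j - 1, by omega⟩
      rw [adjAct_mul_cycAct_of_lt T hlt, mul_assoc, hA]
    · rw [adjAct_mul_cycAct_of_add_two_le hT (by omega) k.2, mul_assoc, hA]

theorem list_prod_adjAct_mul_symAlg (hT : IsInvolutiveRMatrix T) (n : ℕ) (l : List ℕ) :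
    (l.map (adjAct T n)).prod * symAlg T n = symAlg T n := by
  induction l with
  | nil => simp
  | cons a l ih => rw [List.map_cons, List.prod_cons, mul_assoc, ih, adjAct_mul_symAlg hT]

theorem inner_list_prod_adjAct (hT : IsInvolutiveRMatrix T) (n : ℕ) (l : List ℕ) (x y : TPow V n) :
    ⟪(l.map (adjAct T n)).prod x, y⟫_ℂ = ⟪x, (l.reverse.map (adjAct T n)).prod y⟫_ℂ := by
  induction l generalizing y with
  | nil => simp
  | cons a l ih =>
    simp only [List.map_cons, List.prod_cons, List.reverse_cons, List.map_append, List.prod_append,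
      List.map_nil, List.prod_nil, mul_one, mul_apply_eq_comp]
    rw [inner_adjAct hT, ih]

/-- The adjoint of Dₙ(p) is the product along the reversed word, which fixes the range of Pₙ;
averaging over `p` gives the claim. Both symmetry and idempotence of Pₙ follow from this one
identity. -/
theorem inner_symAlg_symAlg (hT : IsInvolutiveRMatrix T) (n : ℕ) (x y : TPow V n) :
    ⟪symAlg T n x, symAlg T n y⟫_ℂ = ⟪symAlg T n x, y⟫_ℂ := by
  have h : ∀ p : Equiv.Perm (Fin n), ⟪symAlg T n x, permOp T p y⟫_ℂ = ⟪symAlg T n x, y⟫_ℂ := by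
    intro p
    rw [← inner_conj_symm, permOp, inner_list_prod_adjAct hT, ← mul_apply_eq_comp,
      list_prod_adjAct_mul_symAlg hT, inner_conj_symm]
  have e : symAlg T n y = ((n.factorial : ℂ)⁻¹) • ∑ p : Equiv.Perm (Fin n), permOp T p y := by
    simp [symAlg]
  rw [e]
  simp only [inner_smul_right, inner_sum, h, Finset.sum_const, Finset.card_univ, Fintype.card_perm, Fintype.card_fin,
    nsmul_eq_mul]
  rw [← mul_assoc, inv_mul_cancel₀ (by exact_mod_cast n.factorial_ne_zero), one_mul]

theorem inner_symAlg (hT : IsInvolutiveRMatrix T) (n : ℕ) (x y : TPow V n) :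
    ⟪symAlg T n x, y⟫_ℂ = ⟪x, symAlg T n y⟫_ℂ := by
  rw [← inner_symAlg_symAlg hT, ← inner_conj_symm, inner_symAlg_symAlg hT, inner_conj_symm]

theorem symAlg_mul_self (hT : IsInvolutiveRMatrix T) (n : ℕ) :
    symAlg T n * symAlg T n = symAlg T n := by
  ext x
  refine ext_inner_right ℂ fun y => ?_
  rw [mul_apply_eq_comp, inner_symAlg hT, inner_symAlg_symAlg hT]

theorem symAlg_mul_adjAct (hT : IsInvolutiveRMatrix T) (n j : ℕ) :
    symAlg T n * adjAct T n j = symAlg T n := by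
  ext x
  refine ext_inner_right ℂ fun y => ?_
  rw [mul_apply_eq_comp, inner_symAlg hT, inner_adjAct hT,
    ← mul_apply_eq_comp, adjAct_mul_symAlg hT, inner_symAlg hT]

theorem symAlg_mul_actTail (hT : IsInvolutiveRMatrix T) (n : ℕ) :
    symAlg T (n + 1) * actTail (symAlg T n) = symAlg T (n + 1) := by
  rw [symAlg_succ, smul_mul_assoc, mul_assoc, ← actTail_mul, symAlg_mul_self hT]

/-- The adjoint of `symAlg_mul_actTail`. It says that contracting a symmetric tensor leaves a
symmetric tensor. -/
theorem actTail_mul_symAlg (hT : IsInvolutiveRMatrix T) (n : ℕ) :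
    actTail (symAlg T n) * symAlg T (n + 1) = symAlg T (n + 1) := by
  ext x
  refine ext_inner_right ℂ fun y => ?_
  rw [mul_apply_eq_comp, inner_actTail (inner_symAlg hT n), inner_symAlg hT,
    ← mul_apply_eq_comp, symAlg_mul_actTail hT, inner_symAlg hT]

theorem symAlg_zero : symAlg T 0 = 1 := by
  simp [symAlg, permOp, permWord]

/-- The contraction `φ ⊗ x ↦ ⟨ψ, φ⟩ x` of the first tensor factor. -/
def contr (ψ : V) (n : ℕ) : TPow V (n + 1) →ₗ[ℂ] TPow V n :=
  (TensorProduct.lid ℂ (TPow V n)).toLinearMap ∘ₗ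
    LinearMap.rTensor (TPow V n) (innerSL ℂ ψ).toLinearMap ∘ₗ
      (TPow.cons V n).symm.toLinearEquiv.toLinearMap

theorem contr_cons (ψ : V) (n : ℕ) (a : V) (x : TPow V n) :
    contr ψ n (TPow.cons V n (a ⊗ₜ x)) = ⟪ψ, a⟫_ℂ • x := by
  rfl

theorem inner_contr (ψ : V) (n : ℕ) (x : TPow V n) (y : TPow V (n + 1)) :
    ⟪x, contr ψ n y⟫_ℂ = ⟪TPow.cons V n (ψ ⊗ₜ x), y⟫_ℂ := by
  induction y using TPow.cons_induction with
  | add y y' h h' => simp only [map_add, inner_add_right, h, h']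
  | cons a y =>
    rw [contr_cons, inner_smul_right, LinearIsometryEquiv.inner_map_map, TensorProduct.inner_tmul]

theorem contr_actTail (ψ : V) {n : ℕ} (A : TPow V n →L[ℂ] TPow V n) (x : TPow V (n + 1)) :
    contr ψ n (actTail A x) = A (contr ψ n x) := by
  induction x using TPow.cons_induction with
  | add y y' h h' => simp only [map_add, h, h']
  | cons a y => rw [actTail_cons, contr_cons, contr_cons, map_smul]

theorem symAlg_contr_symAlg (hT : IsInvolutiveRMatrix T) (ψ : V) (n : ℕ) (x : TPow V (n + 1)) :
    symAlg T n (contr ψ n (symAlg T (n + 1) x)) = contr ψ n (symAlg T (n + 1) x) := by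
  rw [← contr_actTail, ← mul_apply_eq_comp, actTail_mul_symAlg hT]

theorem add_one_smul_symAlg_cons {n : ℕ} (φ : V) {x : TPow V n} (hx : symAlg T n x = x) :
    (n + 1 : ℂ) • symAlg T (n + 1) (TPow.cons V n (φ ⊗ₜ x)) =
      ∑ k : Fin (n + 1), cycAct T (n + 1) k (TPow.cons V n (φ ⊗ₜ x)) := by
  rw [symAlg_succ, smul_apply, smul_smul,
    mul_inv_cancel₀ (by exact_mod_cast n.succ_ne_zero), one_smul, mul_apply_eq_comp,
    actTail_cons, hx, sum_apply]

/-- In the contracted recursion the trivial cycle gives the scalar product. Every other cycle is 1 ⊗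
(a shorter cycle) after τ₀, and the contraction passes through the former. This is the mixed
exchange relation before symmetrisation. -/
theorem add_one_smul_contr_symAlg_cons {n : ℕ} (ψ φ : V) {x : TPow V n} (hx : symAlg T n x = x) :
    (n + 1 : ℂ) • contr ψ n (symAlg T (n + 1) (TPow.cons V n (φ ⊗ₜ x))) =
      ⟪ψ, φ⟫_ℂ • x + ∑ k : Fin n, cycAct T n k
        (contr ψ n (adjAct T (n + 1) 0 (TPow.cons V n (φ ⊗ₜ x)))) := by
  rw [← map_smul, add_one_smul_symAlg_cons φ hx, Fin.sum_univ_succ, map_add, map_sum]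
  refine congrArg₂ (· + ·) (contr_cons ψ n φ x) (Finset.sum_congr rfl fun k _ => ?_)
  rw [Fin.val_succ, cycAct_succ', mul_apply_eq_comp, contr_actTail]

end SymmetricGroupAction

/-! ### Creation and annihilation operators on symmetrised vectors -/

section FockOperators

variable {V : Type u} [NormedAddCommGroup V] [InnerProductSpace ℂ V]
  {T : V ⊗[ℂ] V →L[ℂ] V ⊗[ℂ] V}

theorem symProj_coe (T : V ⊗[ℂ] V →L[ℂ] V ⊗[ℂ] V) (n : ℕ) (x : TPow V n) :
    symProj T n (x : Completion (TPow V n)) = (symAlg T n x : Completion (TPow V n)) :=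
  ContinuousLinearMap.completion_apply_coe _ _

/-- The symmetrisation of a vector of the algebraic tensor power, as an `n`-particle vector. -/
def symVec (T : V ⊗[ℂ] V →L[ℂ] V ⊗[ℂ] V) (n : ℕ) : TPow V n →ₗ[ℂ] Particle T n :=
  ((symProj T n : Completion (TPow V n) →ₗ[ℂ] Completion (TPow V n)).codRestrict (Particle T n)
    (symProj_mem T n)) ∘ₗ (Completion.toComplₗᵢ (𝕜 := ℂ) (E := TPow V n)).toLinearMap

theorem coe_symVec (n : ℕ) (x : TPow V n) :
    (symVec T n x : Completion (TPow V n)) = (symAlg T n x : Completion (TPow V n)) :=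
  symProj_coe T n x

theorem denseRange_symVec (T : V ⊗[ℂ] V →L[ℂ] V ⊗[ℂ] V) (n : ℕ) : DenseRange (symVec T n) := by
  refine Subtype.dense_iff.mpr ?_
  have h := (symProj T n).continuous.range_subset_closure_image_dense
    (Completion.denseRange_coe (α := TPow V n))
  intro x hx
  refine closure_minimal (h.trans (closure_mono ?_)) isClosed_closure hx
  rintro _ ⟨_, ⟨x, rfl⟩, rfl⟩
  exact ⟨symVec T n x, ⟨x, rfl⟩, rfl⟩

/-- Reduces identities between bounded operators on n-particle spaces to algebraic tensors, where
the formulas for Pₙ and contractions are available. -/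
theorem Particle.clm_ext {n : ℕ} {E : Type*} [NormedAddCommGroup E] [NormedSpace ℂ E]
    {A B : Particle T n →L[ℂ] E} (h : ∀ x, A (symVec T n x) = B (symVec T n x)) (y : Particle T n) :
    A y = B y :=
  congrFun ((denseRange_symVec T n).equalizer A.continuous B.continuous (funext h)) y

theorem symVec_symAlg (hT : IsInvolutiveRMatrix T) (n : ℕ) (x : TPow V n) :
    symVec T n (symAlg T n x) = symVec T n x := by
  refine Subtype.ext ?_
  rw [coe_symVec, coe_symVec, ← mul_apply_eq_comp, symAlg_mul_self hT]

theorem symVec_adjAct (hT : IsInvolutiveRMatrix T) (n j : ℕ) (x : TPow V n) :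
    symVec T n (adjAct T n j x) = symVec T n x := by
  refine Subtype.ext ?_
  rw [coe_symVec, coe_symVec, ← mul_apply_eq_comp, symAlg_mul_adjAct hT]

theorem symVec_cycAct (hT : IsInvolutiveRMatrix T) (n k : ℕ) (x : TPow V n) :
    symVec T n (cycAct T n k x) = symVec T n x := by
  induction k with
  | zero => rfl
  | succ k ih => rw [cycAct_succ, mul_apply_eq_comp, symVec_adjAct hT, ih]

theorem inner_symVec (hT : IsInvolutiveRMatrix T) (n : ℕ) (x y : TPow V n) :
    ⟪symVec T n x, symVec T n y⟫_ℂ = ⟪x, symAlg T n y⟫_ℂ := by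
  rw [Submodule.coe_inner, coe_symVec, coe_symVec, Completion.inner_coe, inner_symAlg_symAlg hT,
    inner_symAlg hT]

theorem creN_symVec (hT : IsInvolutiveRMatrix T) (φ : V) (n : ℕ) (x : TPow V n) :
    creN T φ n (symVec T n x) =
      (Real.sqrt (n + 1) : ℂ) • symVec T (n + 1) (TPow.cons V n (φ ⊗ₜ x)) := by
  refine Subtype.ext ?_
  change (Real.sqrt (n + 1) : ℂ) • symProj T (n + 1) ((TPow.consL φ n).completion
    (symVec T n x : Completion (TPow V n))) = (Real.sqrt (n + 1) : ℂ) • (symVec T (n + 1) _ : _)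
  rw [coe_symVec, coe_symVec, ContinuousLinearMap.completion_apply_coe, symProj_coe, consL_apply,
    ← actTail_cons, ← mul_apply_eq_comp, symAlg_mul_actTail hT]

theorem sqrt_mul_sqrt_natCast_add_one (n : ℕ) :
    (Real.sqrt (n + 1) : ℂ) * (Real.sqrt (n + 1) : ℂ) = n + 1 := by
  rw [← Complex.ofReal_mul, Real.mul_self_sqrt (by positivity)]
  push_cast
  rfl

/-- Contraction with ψ is adjoint to ψ ⊗ ·. Since it preserves symmetry, no further projection is
needed after it. -/
theorem annN_symVec (hT : IsInvolutiveRMatrix T) (ψ : V) (n : ℕ) (y : TPow V (n + 1)) :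
    annN T ψ n (symVec T (n + 1) y) =
      (Real.sqrt (n + 1) : ℂ) • symVec T n (contr ψ n (symAlg T (n + 1) y)) := by
  refine (denseRange_symVec T n).eq_of_inner_right (𝕜 := ℂ) fun x => ?_
  rw [annN, ContinuousLinearMap.adjoint_inner_right, creN_symVec hT, inner_smul_left,
    inner_smul_right, inner_symVec hT, inner_symVec hT, symAlg_contr_symAlg hT, inner_contr,
    Complex.conj_ofReal]

theorem component_cre_zero (ψ : V) (φ : Fock0 T) :
    Fock.component 0 (cre T ψ φ : Fock T) = 0 := rfl

theorem component_cre_succ (ψ : V) (φ : Fock0 T) (n : ℕ) :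
    Fock.component (n + 1) (cre T ψ φ : Fock T) = creN T ψ n (Fock.component n (φ : Fock T)) := rfl

theorem component_ann (ψ : V) (φ : Fock0 T) (n : ℕ) :
    Fock.component n (ann T ψ φ : Fock T) = annN T ψ n (Fock.component (n + 1) (φ : Fock T)) := rfl

theorem Fock0.ext {φ χ : Fock0 T}
    (h : ∀ n, Fock.component n (φ : Fock T) = Fock.component n (χ : Fock T)) : φ = χ :=
  Subtype.ext (Fock.ext h)

theorem Fock.inner_eq_tsum (φ χ : Fock T) :
    ⟪φ, χ⟫_ℂ = ∑' n, ⟪Fock.component n φ, Fock.component n χ⟫_ℂ :=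
  lp.inner_eq_tsum (𝕜 := ℂ) (G := fun n => Particle T n) φ χ

theorem inner_cre (ψ : V) (φ χ : Fock0 T) : ⟪cre T ψ φ, χ⟫_ℂ = ⟪φ, ann T ψ χ⟫_ℂ := by
  rw [Submodule.coe_inner, Submodule.coe_inner, Fock.inner_eq_tsum, Fock.inner_eq_tsum,
    -- The vacuum component of a created vector is zero, so the series lives on successors.
    ← Nat.succ_injective.tsum_eq]
  · refine tsum_congr fun n => ?_
    rw [Nat.succ_eq_add_one, component_cre_succ, component_ann, annN,
      ContinuousLinearMap.adjoint_inner_right]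
  · intro n hn
    cases n with
    | zero => exact absurd (inner_zero_left _) hn
    | succ n => exact ⟨n, rfl⟩

/-- The inclusion of the `n`-particle vectors. -/
def Fock0.single (T : V ⊗[ℂ] V →L[ℂ] V ⊗[ℂ] V) (n : ℕ) (y : Particle T n) : Fock0 T :=
  Fock0.ofFinite (Pi.single n y) ((Set.finite_singleton n).subset fun k hk => by
    by_contra h
    exact hk (Pi.single_eq_of_ne (M := fun n => Particle T n) h y))

theorem Fock0.component_single (n k : ℕ) (y : Particle T n) :
    Fock.component k (Fock0.single T n y : Fock T) = (Pi.single n y : ∀ k, Particle T k) k := rfl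

theorem Fock0.single_add (n : ℕ) (x y : Particle T n) :
    Fock0.single T n (x + y) = Fock0.single T n x + Fock0.single T n y :=
  Fock0.ext fun k => congrFun (Pi.single_add (f := fun n => Particle T n) n x y) k

theorem Fock0.single_smul (n : ℕ) (c : ℂ) (x : Particle T n) :
    Fock0.single T n (c • x) = c • Fock0.single T n x :=
  Fock0.ext fun k => congrFun (Pi.single_smul (f := fun n => Particle T n) n c x) k

theorem cre_single (ψ : V) (n : ℕ) (y : Particle T n) :
    cre T ψ (Fock0.single T n y) = Fock0.single T (n + 1) (creN T ψ n y) := by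
  refine Fock0.ext fun k => ?_
  cases k with
  | zero => rw [component_cre_zero, Fock0.component_single, Pi.single_eq_of_ne (by omega)]
  | succ k =>
    rw [component_cre_succ, Fock0.component_single, Fock0.component_single]
    by_cases h : k = n
    · subst h
      rw [Pi.single_eq_same, Pi.single_eq_same]
    · rw [Pi.single_eq_of_ne h, Pi.single_eq_of_ne (by omega), map_zero]

theorem vac_eq_single : vac T = Fock0.single T 0 (symVec T 0 (TPow.one V)) := by
  refine Fock0.ext fun k => ?_
  cases k with
  | zero =>
    rw [Fock0.component_single, Pi.single_eq_same]
    refine Subtype.ext ?_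
    rw [coe_symVec, symAlg_zero]
    rfl
  | succ k => rw [Fock0.component_single, Pi.single_eq_of_ne (by omega)]; rfl

theorem ann_vac (ψ : V) : ann T ψ (vac T) = 0 :=
  Fock0.ext fun n => (component_ann ψ (vac T) n).trans (map_zero (annN T ψ n))

theorem TPow.eq_smul_one (x : TPow V 0) : ∃ c : ℂ, x = c • TPow.one V := by
  refine ⟨(show EuclideanSpace ℂ PUnit from x) PUnit.unit, ?_⟩
  refine PiLp.ext (p := 2) (α := fun _ : PUnit => ℂ) fun i => ?_
  change _ = (show EuclideanSpace ℂ PUnit from x) PUnit.unit *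
    (EuclideanSpace.single PUnit.unit (1 : ℂ) : EuclideanSpace ℂ PUnit) i
  simp

theorem inner_vac_vac : ⟪vac T, vac T⟫_ℂ = 1 := by
  have h : ⟪TPow.one V, TPow.one V⟫_ℂ = 1 := by
    change ⟪(EuclideanSpace.single PUnit.unit (1 : ℂ) : EuclideanSpace ℂ PUnit),
      EuclideanSpace.single PUnit.unit (1 : ℂ)⟫_ℂ = 1
    simp
  rw [Submodule.coe_inner, Fock.inner_eq_tsum, tsum_eq_single 0]
  · rw [vac_eq_single, Fock0.component_single, Pi.single_eq_same, Submodule.coe_inner, coe_symVec,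
      Completion.inner_coe, symAlg_zero]
    exact h
  · intro n hn
    rw [vac_eq_single, Fock0.component_single, Pi.single_eq_of_ne hn, inner_zero_left]

/-- The density criterion behind cyclicity: symmetrised algebraic tensors are dense in each
n-particle space, and finite sums of n-particle vectors are dense in the Hilbert sum. -/
theorem Fock.eq_top_of_single_mem {C : Submodule ℂ (Fock T)} (hC : IsClosed (C : Set (Fock T)))
    (h : ∀ n x, (Fock0.single T n (symVec T n x) : Fock T) ∈ C) : C = ⊤ := by
  have h1 : ∀ n y, (Fock0.single T n y : Fock T) ∈ C := by
    intro n y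
    refine (denseRange_symVec T n).induction_on (p := fun y => (Fock0.single T n y : Fock T) ∈ C) y
      ?_ (h n)
    exact hC.preimage (lp.singleContinuousLinearMap ℂ (fun n => Particle T n) 2 n).continuous
  rw [eq_top_iff]
  intro φ _
  refine hC.mem_of_tendsto (lp.hasSum_single (E := fun n => Particle T n) (p := 2)
    (by simp) φ) (Filter.Eventually.of_forall fun s => ?_)
  exact C.sum_mem fun n _ => h1 n _

/-! ### The exchange relations on Fock space -/

variable {ι : Type*} [Fintype ι] {L : Type w} [NormedAddCommGroup L] [InnerProductSpace ℂ L]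

open Classical in
/-- A spanning family of vectors `v_α(f)` on which `T` acts by the matrix `M` and the flip of the
vectors `f`. -/
structure IsExchangeFamily (T : V ⊗[ℂ] V →L[ℂ] V ⊗[ℂ] V) (M : ι → ι → ι → ι → ℂ)
    (v : ι → L → V) : Prop where
  exchange : ∀ α β f g, T (v α f ⊗ₜ v β g) = ∑ γ, ∑ δ, M γ δ α β • (v γ g ⊗ₜ[ℂ] v δ f)
  inner : ∀ α β f g, ⟪v α f, v β g⟫_ℂ = if α = β then ⟪f, g⟫_ℂ else 0
  span : ⊤ ≤ Submodule.span ℂ (Set.range fun x : ι × L => v x.1 x.2)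
  hermitian : ∀ α β γ δ, star (M α β γ δ) = M γ δ α β

namespace IsExchangeFamily

variable {M : ι → ι → ι → ι → ℂ} {v : ι → L → V}

@[elab_as_elim]
theorem cons_induction (hv : IsExchangeFamily T M v) {n : ℕ} {p : TPow V (n + 1) → Prop}
    (x : TPow V (n + 1)) (zero : p 0) (add : ∀ x y, p x → p y → p (x + y)) (smul : ∀ (c : ℂ) x, p x → p (c • x))
    (cons : ∀ α f x, p (TPow.cons V n (v α f ⊗ₜ x))) : p x := by
  induction x using TPow.cons_induction with
  | add x y hx hy => exact add x y hx hy
  | cons a x =>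
    refine Submodule.span_induction (p := fun a _ => p (TPow.cons V n (a ⊗ₜ x))) ?_ ?_ ?_ ?_
      (hv.span (Submodule.mem_top (x := a)))
    · rintro _ ⟨⟨α, f⟩, rfl⟩
      exact cons α f x
    · rw [TensorProduct.zero_tmul, map_zero]; exact zero
    · intro a b _ _ ha hb
      rw [TensorProduct.add_tmul, map_add]
      exact add _ _ ha hb
    · intro c a _ ha
      rw [← TensorProduct.smul_tmul', map_smul]
      exact smul c _ ha

theorem creN_creN (hv : IsExchangeFamily T M v) (hT : IsInvolutiveRMatrix T) (α β : ι) (f g : L)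
    (n : ℕ) (y : Particle T n) :
    creN T (v α f) (n + 1) (creN T (v β g) n y) =
      ∑ γ, ∑ δ, M γ δ α β • creN T (v γ g) (n + 1) (creN T (v δ f) n y) := by
  have h : ∀ (ψ φ : V) (x : TPow V n), creN T ψ (n + 1) (creN T φ n (symVec T n x)) =
      ((Real.sqrt (n + 1) : ℂ) * (Real.sqrt ((n + 1 : ℕ) + 1) : ℂ)) •
        symVec T (n + 2) (TPow.head V n ((ψ ⊗ₜ φ) ⊗ₜ x)) := by
    intro ψ φ x
    rw [creN_symVec hT, map_smul, creN_symVec hT, smul_smul, TPow.head_tmul]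
  have key := Particle.clm_ext (T := T) (A := creN T (v α f) (n + 1) ∘L creN T (v β g) n)
    (B := ∑ γ, ∑ δ, M γ δ α β • (creN T (v γ g) (n + 1) ∘L creN T (v δ f) n)) (fun x => ?_) y
  · simpa using key
  · simp only [ContinuousLinearMap.comp_apply, sum_apply, smul_apply, h]
    -- Symmetrisation does not see τ₀, which acts on the two created vectors by the exchange matrix.
    rw [← symVec_adjAct hT _ 0]
    change _ • symVec T (n + 2) (actHead T n _) = _
    rw [actHead_head, hv.exchange]
    simp only [TensorProduct.sum_tmul, map_sum, ← TensorProduct.smul_tmul', map_smul,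
      Finset.smul_sum]
    refine Finset.sum_congr rfl fun γ _ => Finset.sum_congr rfl fun δ _ => smul_comm _ _ _

/-- On spanning vectors orthogonality collapses both double sums: contracting with `v α f` selects
the first index on the left, and the contracted vector of `x` selects the second index on the right.
-/
theorem contr_adjAct (hv : IsExchangeFamily T M v) (α β : ι) (f g : L) (n : ℕ)
    (x : TPow V (n + 1)) :
    contr (v α f) (n + 1) (adjAct T (n + 2) 0 (TPow.cons V (n + 1) (v β g ⊗ₜ x))) =
      ∑ γ, ∑ δ, M α γ β δ • TPow.cons V n (v γ g ⊗ₜ contr (v δ f) n x) := by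
  classical
  induction x using hv.cons_induction with
  | zero => simp
  | add x y hx hy =>
    simp only [TensorProduct.tmul_add, map_add, hx, hy, smul_add, Finset.sum_add_distrib]
  | smul c x hx =>
    simp only [TensorProduct.tmul_smul, map_smul, hx, Finset.smul_sum, smul_comm c]
  | cons ε h x =>
    have e : adjAct T (n + 2) 0 (TPow.cons V (n + 1) (v β g ⊗ₜ TPow.cons V n (v ε h ⊗ₜ x))) =
        TPow.head V n (T (v β g ⊗ₜ v ε h) ⊗ₜ x) := by
      rw [← TPow.head_tmul]
      exact actHead_head T n _ x
    rw [e, hv.exchange]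
    simp only [TensorProduct.sum_tmul, map_sum, ← TensorProduct.smul_tmul', map_smul,
      TPow.head_tmul, contr_cons, hv.inner, TensorProduct.tmul_smul]
    rw [Finset.sum_eq_single α (fun γ _ hγ => by simp [hγ.symm]) (by simp)]
    refine Finset.sum_congr rfl fun γ _ => ?_
    rw [Finset.sum_eq_single ε (fun δ _ hδ => by simp [hδ]) (by simp)]
    simp

theorem annN_creN_zero (hT : IsInvolutiveRMatrix T) (ψ φ : V) (y : Particle T 0) :
    annN T ψ 0 (creN T φ 0 y) = ⟪ψ, φ⟫_ℂ • y := by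
  have key := Particle.clm_ext (T := T) (A := annN T ψ 0 ∘L creN T φ 0)
    (B := ⟪ψ, φ⟫_ℂ • ContinuousLinearMap.id ℂ _) (fun x => ?_) y
  · simpa using key
  · have hx : symAlg T 0 x = x := by rw [symAlg_zero]; rfl
    simp only [ContinuousLinearMap.comp_apply, smul_apply, ContinuousLinearMap.id_apply]
    rw [creN_symVec hT, map_smul, annN_symVec hT, smul_smul, sqrt_mul_sqrt_natCast_add_one,
      ← map_smul, add_one_smul_contr_symAlg_cons ψ φ hx]
    simp

/-- The factor n + 2 from the two square roots cancels the normalisation of the symmetriser. The n +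
1 nontrivial cycles become equal after symmetrisation, and their number is the square of the factor
√(n+1) in `creN` and `annN` on the other side. -/
theorem annN_creN_succ (hv : IsExchangeFamily T M v) (hT : IsInvolutiveRMatrix T) (α β : ι)
    (f g : L) (n : ℕ) (y : Particle T (n + 1)) :
    annN T (v α f) (n + 1) (creN T (v β g) (n + 1) y) =
      (∑ γ, ∑ δ, M α γ β δ • creN T (v γ g) n (annN T (v δ f) n y)) +
        ⟪v α f, v β g⟫_ℂ • y := by
  have key := Particle.clm_ext (T := T) (A := annN T (v α f) (n + 1) ∘L creN T (v β g) (n + 1))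
    (B := (∑ γ, ∑ δ, M α γ β δ • (creN T (v γ g) n ∘L annN T (v δ f) n)) +
      ⟪v α f, v β g⟫_ℂ • ContinuousLinearMap.id ℂ _) (fun x => ?_) y
  · simpa using key
  -- A symmetric representative is chosen, as the contracted recursion requires one.
  · rw [← symVec_symAlg hT]
    have hx : symAlg T (n + 1) (symAlg T (n + 1) x) = symAlg T (n + 1) x := by
      rw [← mul_apply_eq_comp, symAlg_mul_self hT]
    set z := symAlg T (n + 1) x
    have h1 := sqrt_mul_sqrt_natCast_add_one (n + 1)
    have h2 := sqrt_mul_sqrt_natCast_add_one n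
    simp only [ContinuousLinearMap.comp_apply, smul_apply, ContinuousLinearMap.id_apply,
      add_apply, sum_apply]
    rw [creN_symVec hT, map_smul, annN_symVec hT, smul_smul, h1, ← map_smul,
      add_one_smul_contr_symAlg_cons _ _ hx, map_add, map_smul, map_sum]
    refine (add_comm _ _).trans (congrArg (· + _) ?_)
    simp only [symVec_cycAct hT, Finset.sum_const, Finset.card_univ, Fintype.card_fin,
      annN_symVec hT, map_smul, creN_symVec hT, smul_smul, h2, hx]
    rw [hv.contr_adjAct]
    simp only [map_sum, map_smul, Finset.smul_sum, ← Nat.cast_smul_eq_nsmul ℂ, smul_smul]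
    refine Finset.sum_congr rfl fun γ _ => Finset.sum_congr rfl fun δ _ => ?_
    push_cast
    rw [mul_comm]

theorem cre_mul_cre (hv : IsExchangeFamily T M v) (hT : IsInvolutiveRMatrix T) (α β : ι)
    (f g : L) (φ : Fock0 T) : cre T (v α f) (cre T (v β g) φ) =
      ∑ γ, ∑ δ, M γ δ α β • cre T (v γ g) (cre T (v δ f) φ) := by
  refine Fock0.ext fun n => ?_
  simp only [AddSubmonoidClass.coe_finsetSum, Submodule.coe_smul, map_sum, map_smul]
  rcases n with _ | _ | n
  · simp only [component_cre_zero, smul_zero, Finset.sum_const_zero]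
  · simp only [component_cre_succ, component_cre_zero, map_zero, smul_zero, Finset.sum_const_zero]
  · simp only [component_cre_succ]
    exact hv.creN_creN hT α β f g n _

/-- The adjoint of the relation between creators; hermiticity of `M` turns the conjugated
coefficients into those of the algebra. -/
theorem ann_mul_ann (hv : IsExchangeFamily T M v) (hT : IsInvolutiveRMatrix T) (α β : ι)
    (f g : L) : ann T (v α f) * ann T (v β g) =
      ∑ γ, ∑ δ, M β α δ γ • (ann T (v γ g) * ann T (v δ f)) := by
  ext1 φ
  refine ext_inner_left ℂ fun χ => ?_
  simp only [Module.End.mul_apply, LinearMap.sum_apply, LinearMap.smul_apply, inner_sum,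
    inner_smul_right, ← inner_cre]
  rw [hv.cre_mul_cre hT]
  simp only [sum_inner, inner_smul_left]
  rw [Finset.sum_comm]
  refine Finset.sum_congr rfl fun γ _ => Finset.sum_congr rfl fun δ _ => ?_
  rw [← hv.hermitian]
  simp

open Classical in
theorem ann_mul_cre (hv : IsExchangeFamily T M v) (hT : IsInvolutiveRMatrix T) (α β : ι)
    (f g : L) : ann T (v α f) * cre T (v β g) =
      (∑ γ, ∑ δ, M α γ β δ • (cre T (v γ g) * ann T (v δ f))) +
        (if α = β then ⟪f, g⟫_ℂ else 0) • 1 := by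
  rw [← hv.inner]
  ext1 φ
  refine Fock0.ext fun n => ?_
  simp only [Module.End.mul_apply, LinearMap.add_apply, LinearMap.sum_apply, LinearMap.smul_apply,
    Module.End.one_apply, Submodule.coe_add, AddSubmonoidClass.coe_finsetSum, Submodule.coe_smul,
    map_add, map_sum, map_smul]
  rcases n with _ | n
  · rw [component_ann, component_cre_succ, annN_creN_zero hT]
    simp only [component_cre_zero, smul_zero, Finset.sum_const_zero, zero_add]
  · simp only [component_ann, component_cre_succ]
    exact hv.annN_creN_succ hT α β f g n _

/-- A subspace that contains the vacuum and is stable under the creation operators contains the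
symmetrised algebraic tensors. -/
theorem single_mem (hv : IsExchangeFamily T M v) (hT : IsInvolutiveRMatrix T)
    {D : Submodule ℂ (Fock0 T)} (hvac : vac T ∈ D)
    (hcre : ∀ α f, ∀ φ ∈ D, cre T (v α f) φ ∈ D) (n : ℕ) (x : TPow V n) :
    Fock0.single T n (symVec T n x) ∈ D := by
  induction n with
  | zero =>
    obtain ⟨c, rfl⟩ := TPow.eq_smul_one x
    rw [map_smul, Fock0.single_smul, ← vac_eq_single]
    exact D.smul_mem c hvac
  | succ n ih =>
    induction x using hv.cons_induction with
    | zero => rw [map_zero, ← zero_smul ℂ (0 : Particle T _), Fock0.single_smul, zero_smul]; exact D.zero_mem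
    | add x y hx hy => rw [map_add, Fock0.single_add]; exact D.add_mem hx hy
    | smul c x hx => rw [map_smul, Fock0.single_smul]; exact D.smul_mem c hx
    | cons α f x =>
      have h := hcre α f _ (ih x)
      rw [cre_single, creN_symVec hT, Fock0.single_smul] at h
      -- The normalisation √(n+1) of the creation operator is nonzero and can be divided out.
      refine (D.smul_mem_iff ?_).mp h
      exact_mod_cast (Real.sqrt_pos.mpr (by positivity : (0 : ℝ) < n + 1)).ne'

end IsExchangeFamily

end FockOperators

/-! ### Representations, normal ordering and vacuum functionals of the algebra -/

namespace Zalg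

variable {ι : Type u} [Fintype ι] {L : Type w} [NormedAddCommGroup L] [InnerProductSpace ℂ L]
  {M : ι → ι → ι → ι → ℂ}

open Classical in
/-- Mutually adjoint operators that satisfy the exchange relations define a *-representation of the
Zamolodchikov algebra. -/
theorem exists_isStarRep {D : Type*} [NormedAddCommGroup D] [InnerProductSpace ℂ D]
    (A C : ι → L → Module.End ℂ D) (hadj : ∀ α f x y, ⟪C α f x, y⟫_ℂ = ⟪x, A α f y⟫_ℂ)
    (hexchange : ∀ α β f g, A α f * A β g = ∑ γ, ∑ δ, M β α δ γ • (A γ g * A δ f))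
    (hmixed : ∀ α β f g, A α f * C β g =
      (∑ γ, ∑ δ, M α γ β δ • (C γ g * A δ f)) + (if α = β then ⟪f, g⟫_ℂ else 0) • 1) :
    ∃ π : Zalg L M →ₐ[ℂ] Module.End ℂ D,
      (∀ α f, π (Z M α f) = A α f ∧ π (star (Z M α f)) = C α f) ∧ IsStarRep π := by
  let φ : FreeZ ι L →ₐ[ℂ] Module.End ℂ D := FreeAlgebra.lift ℂ fun x => match x with
    | .ann α f => A α f
    | .cre α f => C α f
  have hann : ∀ α f, φ (fAnn α f) = A α f := fun α f => FreeAlgebra.lift_ι_apply _ _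
  have hcre : ∀ α f, φ (fCre α f) = C α f := fun α f => FreeAlgebra.lift_ι_apply _ _
  -- Adjointness is established on the free algebra first: it is what deduces the adjoint of a
  -- relation from the relation itself below.
  have hstar : ∀ X x y, ⟪φ (freeStar X) x, y⟫_ℂ = ⟪x, φ X y⟫_ℂ := by
    intro X
    induction X using FreeAlgebra.induction with
    | grade0 c =>
      intro x y
      rw [freeStar_algebraMap, AlgHom.commutes, AlgHom.commutes, Module.algebraMap_end_apply,
        Module.algebraMap_end_apply, inner_smul_left, inner_smul_right]
      simp
    | grade1 X =>
      intro x y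
      rw [freeStar_gen]
      cases X with
      | ann α f =>
        change ⟪φ (fCre α f) x, y⟫_ℂ = ⟪x, φ (fAnn α f) y⟫_ℂ
        rw [hann, hcre, hadj]
      | cre α f =>
        change ⟪φ (fAnn α f) x, y⟫_ℂ = ⟪x, φ (fCre α f) y⟫_ℂ
        rw [hann, hcre, ← inner_conj_symm, ← hadj, inner_conj_symm]
    | mul X Y hX hY =>
      intro x y
      rw [freeStar_mul, map_mul, map_mul, Module.End.mul_apply, Module.End.mul_apply, hY, hX]
    | add X Y hX hY =>
      intro x y
      rw [freeStar_add, map_add, map_add, LinearMap.add_apply, LinearMap.add_apply, inner_add_left,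
        inner_add_right, hY, hX]
  have hrel : ∀ ⦃X Y : FreeZ ι L⦄, Rel L M X Y → φ X = φ Y := by
    intro X Y h
    induction h with
    | exchange α β f g =>
      simp only [map_mul, map_sum, map_smul, hann]
      exact hexchange α β f g
    | mixed α β f g =>
      simp only [map_mul, map_sum, map_smul, map_add, map_one, hann, hcre]
      exact hmixed α β f g
    | adjoint _ ih =>
      ext1 x
      refine ext_inner_right ℂ fun y => ?_
      rw [hstar, hstar, ih]
  have hmk : ∀ X, RingQuot.liftAlgHom ℂ ⟨φ, hrel⟩ (mk M X) = φ X :=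
    fun X => RingQuot.liftAlgHom_mkAlgHom_apply ℂ φ hrel X
  refine ⟨RingQuot.liftAlgHom ℂ ⟨φ, hrel⟩, fun α f => ⟨(hmk _).trans (hann α f), ?_⟩, ?_⟩
  · rw [star_Z]
    exact (hmk _).trans (hcre α f)
  · intro X x y
    obtain ⟨X, rfl⟩ := mk_surjective M X
    rw [star_mk]
    refine (congrArg (fun Y : Module.End ℂ D => ⟪Y x, y⟫_ℂ) (hmk _)).trans ((hstar X x y).trans ?_)
    exact (congrArg (fun Y : Module.End ℂ D => ⟪x, Y y⟫_ℂ) (hmk X)).symm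

open Classical in
theorem Z_mul_star_Z (α β : ι) (f g : L) : Z M α f * star (Z M β g) =
    (∑ γ, ∑ δ, M α γ β δ • (star (Z M γ g) * Z M δ f)) + (if α = β then ⟪f, g⟫_ℂ else 0) • 1 := by
  have h : mk M _ = mk M _ := RingQuot.mkAlgHom_rel ℂ (Rel.mixed (S := M) α β f g)
  simp only [star_Z]
  simp only [Z]
  simpa only [map_mul, map_sum, map_smul, map_add, map_one] using h

variable (L M)

/-- The subalgebra generated by the `Z*_α(f)`. -/
def creAlg : Subalgebra ℂ (Zalg L M) :=
  Algebra.adjoin ℂ (Set.range fun x : ι × L => star (Z M x.1 x.2))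

/-- The subalgebra generated by the `Z_α(f)`. -/
def annAlg : Subalgebra ℂ (Zalg L M) :=
  Algebra.adjoin ℂ (Set.range fun x : ι × L => Z M x.1 x.2)

variable {L M}

theorem star_Z_mem_creAlg (α : ι) (f : L) : star (Z M α f) ∈ creAlg L M :=
  Algebra.subset_adjoin ⟨(α, f), rfl⟩

theorem Z_mem_annAlg (α : ι) (f : L) : Z M α f ∈ annAlg L M :=
  Algebra.subset_adjoin ⟨(α, f), rfl⟩

/-- Passing through a creator, one annihilator becomes a combination of single annihilators and
scalars. Hence the claim proved is `G * c` ⊆ `creAlg * G` with `G` spanned by `1` and all `Z`, which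
is stable under products of the elements `c`. -/
theorem Z_mul_mem (α : ι) (f : L) {c : Zalg L M} (hc : c ∈ creAlg L M) :
    Z M α f * c ∈ (creAlg L M).toSubmodule * (annAlg L M).toSubmodule := by
  let G : Submodule ℂ (Zalg L M) :=
    Submodule.span ℂ (insert 1 (Set.range fun x : ι × L => Z M x.1 x.2))
  have hG1 : (1 : Zalg L M) ∈ G := Submodule.subset_span (Set.mem_insert _ _)
  have hGZ : ∀ α f, Z M α f ∈ G := fun α f => Submodule.subset_span (Or.inr ⟨(α, f), rfl⟩)
  have hGA : G ≤ (annAlg L M).toSubmodule := by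
    refine Submodule.span_le.mpr ?_
    rintro _ (rfl | ⟨⟨α, f⟩, rfl⟩)
    · exact (annAlg L M).one_mem
    · exact Z_mem_annAlg α f
  have key : ∀ g ∈ G, g * c ∈ (creAlg L M).toSubmodule * G := by
    induction hc using Algebra.adjoin_induction with
    | mem c hc =>
      obtain ⟨⟨β, h⟩, rfl⟩ := hc
      intro g hg
      induction hg using Submodule.span_induction with
      | mem g hg =>
        obtain (rfl | ⟨⟨α, f⟩, rfl⟩) := hg
        · dsimp only
          rw [one_mul, ← mul_one (star _)]
          exact Submodule.mul_mem_mul (star_Z_mem_creAlg β h) hG1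
        · classical
          dsimp only
          rw [Z_mul_star_Z]
          refine Submodule.add_mem _ (Submodule.sum_mem _ fun γ _ => Submodule.sum_mem _ fun δ _ =>
            Submodule.smul_mem _ _ (Submodule.mul_mem_mul (star_Z_mem_creAlg γ h) (hGZ δ f)))
            (Submodule.smul_mem _ _ ?_)
          rw [← mul_one (1 : Zalg L M)]
          exact Submodule.mul_mem_mul (creAlg L M).one_mem hG1
      | zero => rw [zero_mul]; exact Submodule.zero_mem _
      | add x y _ _ hx hy => rw [add_mul]; exact Submodule.add_mem _ hx hy
      | smul r x _ hx => rw [smul_mul_assoc]; exact Submodule.smul_mem _ _ hx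
    | algebraMap r =>
      intro g hg
      rw [← Algebra.commutes]
      exact Submodule.mul_mem_mul ((creAlg L M).algebraMap_mem r) hg
    | add x y _ _ hx hy =>
      intro g hg
      rw [mul_add]
      exact Submodule.add_mem _ (hx g hg) (hy g hg)
    | mul x y _ _ hx hy =>
      intro g hg
      rw [← mul_assoc]
      refine Submodule.mul_induction_on (hx g hg) (fun c hc g' hg' => ?_) fun a b ha hb => ?_
      · rw [mul_assoc]
        have h := Submodule.mul_mem_mul hc (hy g' hg')
        rwa [← mul_assoc (creAlg L M).toSubmodule, Subalgebra.isIdempotentElem_toSubmodule] at h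
      · rw [add_mul]
        exact Submodule.add_mem _ ha hb
  exact mul_le_mul' le_rfl hGA (key _ (hGZ α f))

/-- The normal ordered products span the Zamolodchikov algebra. -/
theorem mem_creAlg_mul_annAlg (X : Zalg L M) :
    X ∈ (creAlg L M).toSubmodule * (annAlg L M).toSubmodule := by
  -- The normal ordered elements form a left ideal; it contains `1`.
  have key : ∀ Y ∈ (creAlg L M).toSubmodule * (annAlg L M).toSubmodule,
      X * Y ∈ (creAlg L M).toSubmodule * (annAlg L M).toSubmodule := by
    obtain ⟨X, rfl⟩ := mk_surjective M X
    induction X using FreeAlgebra.induction with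
    | grade0 c =>
      intro Y hY
      rw [AlgHom.commutes, ← Algebra.smul_def]
      exact Submodule.smul_mem _ _ hY
    | grade1 X =>
      intro Y hY
      refine Submodule.mul_induction_on hY (fun c hc a ha => ?_) fun a b ha hb => ?_
      · rw [← mul_assoc]
        cases X with
        | ann α f =>
          have h := Submodule.mul_mem_mul (Z_mul_mem α f hc) ha
          rwa [mul_assoc (creAlg L M).toSubmodule, Subalgebra.isIdempotentElem_toSubmodule] at h
        | cre α f =>
          refine Submodule.mul_mem_mul ((creAlg L M).mul_mem ?_ hc) ha
          rw [← star_Z]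
          exact star_Z_mem_creAlg α f
      · rw [mul_add]
        exact Submodule.add_mem _ ha hb
    | mul a b ha hb =>
      intro Y hY
      rw [map_mul, mul_assoc]
      exact ha _ (hb _ hY)
    | add a b ha hb =>
      intro Y hY
      rw [map_add, add_mul]
      exact Submodule.add_mem _ (ha _ hY) (hb _ hY)
  rw [← mul_one X]
  refine key 1 ?_
  rw [← mul_one (1 : Zalg L M)]
  exact Submodule.mul_mem_mul (creAlg L M).one_mem (annAlg L M).one_mem

/-- Here `r` is the constant term of an expression for `c`. The order of quantifiers is the point:
one `r` serves all vacuum functionals, which gives uniqueness. -/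
theorem vacuumFunctional_creAlg {c : Zalg L M} (hc : c ∈ creAlg L M) :
    ∃ r : ℂ, ∀ ω : Zalg L M →ₗ[ℂ] ℂ, IsVacuumFunctional ω → ∀ X, ω (c * X) = r * ω X := by
  induction hc using Algebra.adjoin_induction with
  | mem c hc =>
    obtain ⟨⟨β, h⟩, rfl⟩ := hc
    exact ⟨0, fun ω hω X => by rw [zero_mul]; exact hω.star_mul β h X⟩
  | algebraMap r => exact ⟨r, fun ω _ X => by rw [← Algebra.smul_def, map_smul, smul_eq_mul]⟩
  | add x y _ _ hx hy =>
    obtain ⟨r, hr⟩ := hx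
    obtain ⟨s, hs⟩ := hy
    exact ⟨r + s, fun ω hω X => by rw [add_mul, map_add, hr ω hω, hs ω hω, add_mul]⟩
  | mul x y _ _ hx hy =>
    obtain ⟨r, hr⟩ := hx
    obtain ⟨s, hs⟩ := hy
    exact ⟨r * s, fun ω hω X => by rw [mul_assoc, hr ω hω, hs ω hω, mul_assoc]⟩

theorem vacuumFunctional_annAlg {a : Zalg L M} (ha : a ∈ annAlg L M) :
    ∃ r : ℂ, ∀ ω : Zalg L M →ₗ[ℂ] ℂ, IsVacuumFunctional ω → ∀ X, ω (X * a) = r * ω X := by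
  induction ha using Algebra.adjoin_induction with
  | mem c hc =>
    obtain ⟨⟨β, h⟩, rfl⟩ := hc
    exact ⟨0, fun ω hω X => by rw [zero_mul]; exact hω.mul β h X⟩
  | algebraMap r =>
    exact ⟨r, fun ω _ X => by rw [← Algebra.commutes, ← Algebra.smul_def, map_smul, smul_eq_mul]⟩
  | add x y _ _ hx hy =>
    obtain ⟨r, hr⟩ := hx
    obtain ⟨s, hs⟩ := hy
    exact ⟨r + s, fun ω hω X => by rw [mul_add, map_add, hr ω hω, hs ω hω, add_mul]⟩
  | mul x y _ _ hx hy =>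
    obtain ⟨r, hr⟩ := hx
    obtain ⟨s, hs⟩ := hy
    exact ⟨s * r, fun ω hω X => by rw [← mul_assoc, hs ω hω, hr ω hω, mul_assoc]⟩

theorem vacuumFunctional_unique {ω ω' : Zalg L M →ₗ[ℂ] ℂ} (hω : IsVacuumFunctional ω)
    (hω' : IsVacuumFunctional ω') : ω = ω' := by
  ext X
  refine Submodule.mul_induction_on (mem_creAlg_mul_annAlg X) (fun c hc a ha => ?_)
    fun x y hx hy => by rw [map_add, map_add, hx, hy]
  obtain ⟨r, hr⟩ := vacuumFunctional_creAlg hc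
  obtain ⟨s, hs⟩ := vacuumFunctional_annAlg ha
  rw [hr ω hω, hr ω' hω', ← one_mul a, hs ω hω, hs ω' hω', hω.map_one, hω'.map_one]

/-- The vector state `X ↦ ⟨Ω, π(X) Ω⟩`. -/
def vectorFunctional {D : Type*} [NormedAddCommGroup D] [InnerProductSpace ℂ D]
    (π : Zalg L M →ₐ[ℂ] Module.End ℂ D) (Ω : D) : Zalg L M →ₗ[ℂ] ℂ :=
  (innerSL ℂ Ω).toLinearMap ∘ₗ LinearMap.applyₗ Ω ∘ₗ π.toLinearMap

theorem vectorFunctional_apply {D : Type*} [NormedAddCommGroup D] [InnerProductSpace ℂ D]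
    (π : Zalg L M →ₐ[ℂ] Module.End ℂ D) (Ω : D) (X : Zalg L M) :
    vectorFunctional π Ω X = ⟪Ω, π X Ω⟫_ℂ := rfl

theorem isVacuumFunctional_vectorFunctional {D : Type*} [NormedAddCommGroup D]
    [InnerProductSpace ℂ D] {π : Zalg L M →ₐ[ℂ] Module.End ℂ D} (hπ : IsStarRep π) {Ω : D}
    (hΩ : ⟪Ω, Ω⟫_ℂ = 1) (hann : ∀ α f, π (Z M α f) Ω = 0) :
    IsVacuumFunctional (vectorFunctional π Ω) where
  map_one := by rw [vectorFunctional_apply, map_one, Module.End.one_apply, hΩ]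
  star_mul α f X := by
    rw [vectorFunctional_apply, map_mul, Module.End.mul_apply, ← hπ, star_star, hann,
      inner_zero_left]
  mul α f X := by
    rw [vectorFunctional_apply, map_mul, Module.End.mul_apply, hann, map_zero, inner_zero_right]

theorem inner_apply_apply {D : Type*} [NormedAddCommGroup D] [InnerProductSpace ℂ D]
    {π : Zalg L M →ₐ[ℂ] Module.End ℂ D} (hπ : IsStarRep π) (Ω : D) (X Y : Zalg L M) :
    ⟪π X Ω, π Y Ω⟫_ℂ = vectorFunctional π Ω (star X * Y) := by
  rw [vectorFunctional_apply, map_mul, Module.End.mul_apply, ← hπ (star X), star_star]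

end Zalg

/-! ### The exchange families of S̃ and of S̃ ⊞ R̃ -/

section ExchangeFamilies

variable {H : Type u} [NormedAddCommGroup H] [InnerProductSpace ℂ H]
  {K : Type v} [NormedAddCommGroup K] [InnerProductSpace ℂ K]
  {L : Type w} [NormedAddCommGroup L] [InnerProductSpace ℂ L]
  {ι κ : Type*} [Fintype ι] [Fintype κ]
  (e : OrthonormalBasis ι ℂ H) (k : OrthonormalBasis κ ℂ K)
  {S : H ⊗[ℂ] H →L[ℂ] H ⊗[ℂ] H} {R : K ⊗[ℂ] K →L[ℂ] K ⊗[ℂ] K}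

theorem star_matrixCoeff (hS : IsInvolutiveRMatrix S) (α β γ δ : ι) :
    star (matrixCoeff e S α β γ δ) = matrixCoeff e S γ δ α β := by
  rw [matrixCoeff, matrixCoeff, ← hS.selfAdjoint]
  exact inner_conj_symm _ _

theorem apply_tmul_eq_sum_matrixCoeff (S : H ⊗[ℂ] H →L[ℂ] H ⊗[ℂ] H) (α β : ι) :
    S (e α ⊗ₜ e β) = ∑ γ, ∑ δ, matrixCoeff e S γ δ α β • (e γ ⊗ₜ[ℂ] e δ) := by
  classical
  rw [← (e.tensorProduct e).sum_repr' (S (e α ⊗ₜ e β)), Fintype.sum_prod_type]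
  simp only [OrthonormalBasis.tensorProduct_apply]
  rfl

/-- The matrix of a box-sum in terms of the matrices of the summands. -/
def boxMatrix [DecidableEq ι] [DecidableEq κ] (M : ι → ι → ι → ι → ℂ) (N : κ → κ → κ → κ → ℂ) :
    ι ⊕ κ → ι ⊕ κ → ι ⊕ κ → ι ⊕ κ → ℂ
  | .inl γ, .inl δ, .inl α, .inl β => M γ δ α β
  | .inr γ, .inr δ, .inr α, .inr β => N γ δ α β
  | .inr γ, .inl δ, .inl α, .inr β => if δ = α then if γ = β then 1 else 0 else 0
  | .inl γ, .inr δ, .inr α, .inl β => if δ = α then if γ = β then 1 else 0 else 0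
  | _, _, _, _ => 0

theorem sumBasis_inl (α : ι) : sumBasis e k (.inl α) = inlL H K (e α) :=
  OrthonormalBasis.prod_apply e k (.inl α)

theorem sumBasis_inr (ξ : κ) : sumBasis e k (.inr ξ) = inrL H K (k ξ) :=
  OrthonormalBasis.prod_apply e k (.inr ξ)

/-- The inclusions of the summands are adjoint to the projections, so each of the sixteen blocks is
read off from the orthonormality of the two bases. -/
theorem boxCoeff_eq_boxMatrix [DecidableEq ι] [DecidableEq κ] (S : H ⊗[ℂ] H →L[ℂ] H ⊗[ℂ] H)
    (R : K ⊗[ℂ] K →L[ℂ] K ⊗[ℂ] K) :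
    boxCoeff e k S R = boxMatrix (matrixCoeff e S) (matrixCoeff k R) := by
  have hl : ∀ (x y : DSum H K) (w : H ⊗[ℂ] H), ⟪x ⊗ₜ y, TensorProduct.map
      (inlL H K : H →ₗ[ℂ] DSum H K) (inlL H K : H →ₗ[ℂ] DSum H K) w⟫_ℂ =
      ⟪projL H K x ⊗ₜ projL H K y, w⟫_ℂ := fun x y w =>
    (inner_map_map_of_adjoint (f := (projL H K).toLinearMap) (g := (projL H K).toLinearMap)
      inner_projL inner_projL (x ⊗ₜ y) w).symm
  have hr : ∀ (x y : DSum H K) (w : K ⊗[ℂ] K), ⟪x ⊗ₜ y, TensorProduct.map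
      (inrL H K : K →ₗ[ℂ] DSum H K) (inrL H K : K →ₗ[ℂ] DSum H K) w⟫_ℂ =
      ⟪projR H K x ⊗ₜ projR H K y, w⟫_ℂ := fun x y w =>
    (inner_map_map_of_adjoint (f := (projR H K).toLinearMap) (g := (projR H K).toLinearMap)
      inner_projR inner_projR (x ⊗ₜ y) w).symm
  have hll : ∀ a b : H, boxSum S R (inlL H K a ⊗ₜ inlL H K b) = TensorProduct.map
      (inlL H K : H →ₗ[ℂ] DSum H K) (inlL H K : H →ₗ[ℂ] DSum H K) (S (a ⊗ₜ b)) :=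
    fun a b => boxSum_inl_inl S R (a ⊗ₜ b)
  have hrr : ∀ a b : K, boxSum S R (inrL H K a ⊗ₜ inrL H K b) = TensorProduct.map
      (inrL H K : K →ₗ[ℂ] DSum H K) (inrL H K : K →ₗ[ℂ] DSum H K) (R (a ⊗ₜ b)) :=
    fun a b => boxSum_inr_inr S R (a ⊗ₜ b)
  have he : ∀ α β, ⟪e α, e β⟫_ℂ = if α = β then 1 else 0 :=
    orthonormal_iff_ite.mp e.orthonormal
  have hk : ∀ α β, ⟪k α, k β⟫_ℂ = if α = β then 1 else 0 :=
    orthonormal_iff_ite.mp k.orthonormal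
  funext γ δ α β
  rw [boxCoeff, matrixCoeff]
  rcases α with α | α <;> rcases β with β | β <;> rcases γ with γ | γ <;> rcases δ with δ | δ <;>
    simp [sumBasis_inl, sumBasis_inr, hll, hrr, hl, hr, boxSum_inl_inr, boxSum_inr_inl, boxMatrix,
      matrixCoeff, inner_inlL, inner_inrL, he, hk]

theorem IsExchangeFamily.tilde (hS : IsInvolutiveRMatrix S) :
    IsExchangeFamily (L := L) (tilde L S) (matrixCoeff e S) fun α f => e α ⊗ₜ f where
  exchange α β f g := by
    rw [tilde_tmul, apply_tmul_eq_sum_matrixCoeff]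
    simp only [TensorProduct.sum_tmul, map_sum, ← TensorProduct.smul_tmul', map_smul,
      exchangeInner_tmul]
  inner α β f g := by
    classical
    rw [TensorProduct.inner_tmul, orthonormal_iff_ite.mp e.orthonormal]
    simp only [ite_mul, one_mul, zero_mul]
  span := by
    intro x _
    induction x with
    | zero => exact Submodule.zero_mem _
    | add x y hx hy => exact Submodule.add_mem _ (hx trivial) (hy trivial)
    | tmul a f =>
      rw [← e.sum_repr a, TensorProduct.sum_tmul]
      refine Submodule.sum_mem _ fun α _ => ?_
      rw [← TensorProduct.smul_tmul']
      exact Submodule.smul_mem _ _ (Submodule.subset_span ⟨(α, f), rfl⟩)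
  hermitian := star_matrixCoeff e hS

/-- The operator is S̃ ⊞ R̃ but the matrix is that of S ⊞ R. The diagonal blocks are inherited from
S̃ and R̃; in the mixed blocks the flip exchanges the labels and the vectors of `L` together, which
is the matrix of a flip with `f` and `g` interchanged. -/
theorem isExchangeFamily_genVec (hS : IsInvolutiveRMatrix S) (hR : IsInvolutiveRMatrix R) :
    IsExchangeFamily (boxSum (tilde L S) (tilde L R)) (boxCoeff e k S R)
      (genVec (L := L) e k) where
  exchange α β f g := by
    classical
    rw [boxCoeff_eq_boxMatrix]
    have hs := IsExchangeFamily.tilde (L := L) e hS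
    have hr := IsExchangeFamily.tilde (L := L) k hR
    rcases α with α | α <;> rcases β with β | β
    · refine (boxSum_inl_inl (tilde L S) (tilde L R) ((e α ⊗ₜ f) ⊗ₜ (e β ⊗ₜ g))).trans ?_
      rw [hs.exchange]
      simp [Fintype.sum_sum_type, boxMatrix, genVec]
    · simp [Fintype.sum_sum_type, boxMatrix, genVec, boxSum_inl_inr]
    · simp [Fintype.sum_sum_type, boxMatrix, genVec, boxSum_inr_inl]
    · refine (boxSum_inr_inr (tilde L S) (tilde L R) ((k α ⊗ₜ f) ⊗ₜ (k β ⊗ₜ g))).trans ?_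
      rw [hr.exchange]
      simp [Fintype.sum_sum_type, boxMatrix, genVec]
  inner α β f g := by
    have hs := (IsExchangeFamily.tilde (L := L) e hS).inner
    have hr := (IsExchangeFamily.tilde (L := L) k hR).inner
    rcases α with α | α <;> rcases β with β | β <;>
      simp only [genVec, inner_inlL, inner_inrL, hs, hr, projL_inlL, projL_inrL, projR_inlL,
        projR_inrL, inner_zero_right, reduceCtorEq, if_false] <;>
      split_ifs <;> simp_all
  span := by
    intro x _
    rw [← inlL_add_inrL x]
    refine Submodule.add_mem _ ?_ ?_
    · have h := Submodule.mem_map_of_mem (f := (inlL (H ⊗[ℂ] L) (K ⊗[ℂ] L)).toLinearMap)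
        ((IsExchangeFamily.tilde (L := L) e hS).span (Submodule.mem_top (x := projL _ _ x)))
      rw [Submodule.map_span] at h
      refine Submodule.span_mono ?_ h
      rintro _ ⟨_, ⟨⟨α, f⟩, rfl⟩, rfl⟩
      exact ⟨(.inl α, f), rfl⟩
    · have h := Submodule.mem_map_of_mem (f := (inrL (H ⊗[ℂ] L) (K ⊗[ℂ] L)).toLinearMap)
        ((IsExchangeFamily.tilde (L := L) k hR).span (Submodule.mem_top (x := projR _ _ x)))
      rw [Submodule.map_span] at h
      refine Submodule.span_mono ?_ h
      rintro _ ⟨_, ⟨⟨α, f⟩, rfl⟩, rfl⟩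
      exact ⟨(.inr α, f), rfl⟩
  hermitian := star_matrixCoeff (sumBasis e k) (hS.boxSum hR)

end ExchangeFamilies

/-! ### Operators on the tensor product of two Fock spaces -/

section TensorFockOperators

variable {V : Type u} [NormedAddCommGroup V] [InnerProductSpace ℂ V]
  {W : Type v} [NormedAddCommGroup W] [InnerProductSpace ℂ W]
  {T : V ⊗[ℂ] V →L[ℂ] V ⊗[ℂ] V} {Q : W ⊗[ℂ] W →L[ℂ] W ⊗[ℂ] W}

/-- Removes the idle summand of `tensorCre` at a vector of `V` or of `W` alone. -/
theorem cre_zero (hT : IsInvolutiveRMatrix T) (φ : Fock0 T) : cre T 0 φ = 0 := by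
  have h : ∀ n y, creN T (0 : V) n y = 0 := fun n =>
    Particle.clm_ext (B := 0) fun x => by rw [creN_symVec hT]; simp
  refine Fock0.ext fun n => ?_
  cases n with
  | zero => rfl
  | succ n => exact (component_cre_succ 0 φ n).trans (h n _)

theorem ann_zero (hT : IsInvolutiveRMatrix T) (φ : Fock0 T) : ann T 0 φ = 0 :=
  ext_inner_left ℂ fun χ => by rw [← inner_cre, cre_zero hT, inner_zero_left, inner_zero_right]

/-- The elementary tensors. -/
def Fock0Tensor.tmul (T : V ⊗[ℂ] V →L[ℂ] V ⊗[ℂ] V) (Q : W ⊗[ℂ] W →L[ℂ] W ⊗[ℂ] W) :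
    Fock0 T →ₗ[ℂ] Fock0 Q →ₗ[ℂ] Fock0Tensor T Q :=
  TensorProduct.mk ℂ (Fock0 T) (Fock0 Q)

theorem Fock0Tensor.induction_on {p : Fock0Tensor T Q → Prop} (x : Fock0Tensor T Q) (zero : p 0)
    (add : ∀ x y, p x → p y → p (x + y)) (tmul : ∀ a b, p (Fock0Tensor.tmul T Q a b)) : p x :=
  TensorProduct.induction_on (motive := p) x zero tmul add

theorem Fock0Tensor.end_ext {A B : Module.End ℂ (Fock0Tensor T Q)}
    (h : ∀ a b, A (Fock0Tensor.tmul T Q a b) = B (Fock0Tensor.tmul T Q a b)) : A = B :=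
  TensorProduct.ext' h

theorem tensorAnn_tmul (ψ : DSum V W) (a : Fock0 T) (b : Fock0 Q) :
    tensorAnn T Q ψ (Fock0Tensor.tmul T Q a b) =
      Fock0Tensor.tmul T Q (ann T (projL V W ψ) a) b +
        Fock0Tensor.tmul T Q a (ann Q (projR V W ψ) b) := rfl

theorem tensorCre_tmul (ψ : DSum V W) (a : Fock0 T) (b : Fock0 Q) :
    tensorCre T Q ψ (Fock0Tensor.tmul T Q a b) =
      Fock0Tensor.tmul T Q (cre T (projL V W ψ) a) b +
        Fock0Tensor.tmul T Q a (cre Q (projR V W ψ) b) := rfl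

theorem tensorAnn_inlL_tmul (h : IsInvolutiveRMatrix Q) (ψ : V) (a : Fock0 T) (b : Fock0 Q) :
    tensorAnn T Q (inlL V W ψ) (Fock0Tensor.tmul T Q a b) =
      Fock0Tensor.tmul T Q (ann T ψ a) b := by
  rw [tensorAnn_tmul, projL_inlL, projR_inlL, ann_zero h, map_zero, add_zero]

theorem tensorAnn_inrL_tmul (h : IsInvolutiveRMatrix T) (ψ : W) (a : Fock0 T) (b : Fock0 Q) :
    tensorAnn T Q (inrL V W ψ) (Fock0Tensor.tmul T Q a b) =
      Fock0Tensor.tmul T Q a (ann Q ψ b) := by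
  rw [tensorAnn_tmul, projL_inrL, projR_inrL, ann_zero h, map_zero,
    LinearMap.zero_apply, zero_add]

theorem tensorCre_inlL_tmul (h : IsInvolutiveRMatrix Q) (ψ : V) (a : Fock0 T) (b : Fock0 Q) :
    tensorCre T Q (inlL V W ψ) (Fock0Tensor.tmul T Q a b) =
      Fock0Tensor.tmul T Q (cre T ψ a) b := by
  rw [tensorCre_tmul, projL_inlL, projR_inlL, cre_zero h, map_zero, add_zero]

theorem tensorCre_inrL_tmul (h : IsInvolutiveRMatrix T) (ψ : W) (a : Fock0 T) (b : Fock0 Q) :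
    tensorCre T Q (inrL V W ψ) (Fock0Tensor.tmul T Q a b) =
      Fock0Tensor.tmul T Q a (cre Q ψ b) := by
  rw [tensorCre_tmul, projL_inrL, projR_inrL, cre_zero h, map_zero,
    LinearMap.zero_apply, zero_add]

theorem inner_tensorCre (ψ : DSum V W) (x y : Fock0Tensor T Q) :
    ⟪tensorCre T Q ψ x, y⟫_ℂ = ⟪x, tensorAnn T Q ψ y⟫_ℂ := by
  have h1 : ∀ x y : Fock0 T ⊗[ℂ] Fock0 Q,
      ⟪TensorProduct.map (cre T (projL V W ψ)) LinearMap.id x, y⟫_ℂ =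
      ⟪x, TensorProduct.map (ann T (projL V W ψ)) LinearMap.id y⟫_ℂ :=
    inner_map_map_of_adjoint (inner_cre _) fun _ _ => rfl
  have h2 : ∀ x y : Fock0 T ⊗[ℂ] Fock0 Q,
      ⟪TensorProduct.map LinearMap.id (cre Q (projR V W ψ)) x, y⟫_ℂ =
      ⟪x, TensorProduct.map LinearMap.id (ann Q (projR V W ψ)) y⟫_ℂ :=
    inner_map_map_of_adjoint (fun _ _ => rfl) (inner_cre _)
  exact (inner_add_left _ _ _).trans ((congrArg₂ (· + ·) (h1 x y) (h2 x y)).trans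
    (inner_add_right _ _ _).symm)

theorem tensorAnn_tensorVac (ψ : DSum V W) : tensorAnn T Q ψ (tensorVac T Q) = 0 := by
  refine (tensorAnn_tmul ψ (vac T) (vac Q)).trans ?_
  rw [ann_vac, ann_vac, map_zero, map_zero, LinearMap.zero_apply, add_zero]

theorem inner_tensorVac_tensorVac : ⟪tensorVac T Q, tensorVac T Q⟫_ℂ = 1 := by
  refine (TensorProduct.inner_tmul (𝕜 := ℂ) (vac T) (vac T) (vac Q) (vac Q)).trans ?_
  rw [inner_vac_vac, inner_vac_vac, one_mul]

/-- The criterion for one Fock space is used in each variable in turn, the other being fixed; this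
is possible because `j` is a bounded bilinear map. -/
theorem FockTensor.eq_top_of_single_mem {C : Submodule ℂ (FockTensor T Q)}
    (hC : IsClosed (C : Set (FockTensor T Q)))
    (h : ∀ m x n y, tensorIncl T Q (Fock0Tensor.tmul T Q (Fock0.single T m (symVec T m x))
      (Fock0.single Q n (symVec Q n y))) ∈ C) : C = ⊤ := by
  let j : Fock T →L[ℂ] Fock Q →L[ℂ] FockTensor T Q :=
    (ContinuousLinearMap.compL ℂ (Fock Q) (Fock T ⊗[ℂ] Fock Q) (FockTensor T Q)
      (Completion.toComplₗᵢ (𝕜 := ℂ) (E := Fock T ⊗[ℂ] Fock Q)).toContinuousLinearMap) ∘L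
        TensorProduct.mkL ℂ (Fock T) (Fock Q)
  have hj : ∀ a b, j a b = ((a ⊗ₜ[ℂ] b : Fock T ⊗[ℂ] Fock Q) : Completion _) := fun _ _ => rfl
  have h1 : ∀ m x b, j (Fock0.single T m (symVec T m x) : Fock0 T) b ∈ C := by
    intro m x b
    have key := Fock.eq_top_of_single_mem (T := Q)
      (C := C.comap (j (Fock0.single T m (symVec T m x) : Fock0 T)).toLinearMap)
      (hC.preimage (j _).continuous) (h m x)
    exact key.ge (Submodule.mem_top (x := b))
  have h2 : ∀ a b, j a b ∈ C := by
    intro a b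
    have key := Fock.eq_top_of_single_mem (T := T) (C := C.comap (j.flip b).toLinearMap)
      (hC.preimage (j.flip b).continuous) (fun m x => h1 m x b)
    exact key.ge (Submodule.mem_top (x := a))
  rw [eq_top_iff]
  intro z _
  refine Completion.induction_on (p := fun z : Completion (Fock T ⊗[ℂ] Fock Q) =>
    (z : FockTensor T Q) ∈ C) z hC fun z => ?_
  induction z with
  | zero => rw [Completion.coe_zero]; exact C.zero_mem
  | add x y hx hy => rw [Completion.coe_add]; exact C.add_mem hx hy
  | tmul a b => exact h2 a b

end TensorFockOperators

/-! ### Unitary equivalence of cyclic vacuum representations -/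

theorem exists_linearIsometryEquiv_of_norm_eq {A E F : Type*} [AddCommGroup A] [Module ℂ A]
    [NormedAddCommGroup E] [InnerProductSpace ℂ E] [CompleteSpace E]
    [NormedAddCommGroup F] [InnerProductSpace ℂ F] [CompleteSpace F]
    (a : A →ₗ[ℂ] E) (b : A →ₗ[ℂ] F) (ha : DenseRange a) (hb : DenseRange b)
    (h : ∀ x, ‖a x‖ = ‖b x‖) : ∃ V : E ≃ₗᵢ[ℂ] F, ∀ x, V (a x) = b x :=
  ⟨(LinearEquiv.refl ℂ A).extendOfIsometry a b ha hb fun x => (h x).symm,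
    fun x => LinearEquiv.extendOfIsometry_eq (f := LinearEquiv.refl ℂ A) (e₁ := a) (e₂ := b) ha hb
      (fun x => (h x).symm) x⟩

section GNS

variable {ι : Type u} [Fintype ι] {L : Type w} [NormedAddCommGroup L] [InnerProductSpace ℂ L]
  {M : ι → ι → ι → ι → ℂ}
  {D₁ : Type*} [NormedAddCommGroup D₁] [InnerProductSpace ℂ D₁]
  {D₂ : Type*} [NormedAddCommGroup D₂] [InnerProductSpace ℂ D₂]
  {E : Type*} [NormedAddCommGroup E] [InnerProductSpace ℂ E] [CompleteSpace E]
  {F : Type*} [NormedAddCommGroup F] [InnerProductSpace ℂ F] [CompleteSpace F]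

/-- The *-representations of the Zamolodchikov algebra with cyclic vacuum vector are unitarily
equivalent. -/
theorem Zalg.exists_linearIsometryEquiv (i₁ : D₁ →ₗᵢ[ℂ] E) (i₂ : D₂ →ₗᵢ[ℂ] F)
    {π₁ : Zalg L M →ₐ[ℂ] Module.End ℂ D₁} {π₂ : Zalg L M →ₐ[ℂ] Module.End ℂ D₂}
    (h₁ : IsStarRep π₁) (h₂ : IsStarRep π₂) {Ω₁ : D₁} {Ω₂ : D₂}
    (hω₁ : IsVacuumFunctional (Zalg.vectorFunctional π₁ Ω₁))
    (hω₂ : IsVacuumFunctional (Zalg.vectorFunctional π₂ Ω₂))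
    (hd₁ : DenseRange fun X => i₁ (π₁ X Ω₁)) (hd₂ : DenseRange fun X => i₂ (π₂ X Ω₂)) :
    ∃ V : E ≃ₗᵢ[ℂ] F, (∀ X, V (i₁ (π₁ X Ω₁)) = i₂ (π₂ X Ω₂)) ∧
      ∀ φ ψ, V (i₁ φ) = i₂ ψ → ∀ X, V (i₁ (π₁ X φ)) = i₂ (π₂ X ψ) := by
  obtain ⟨V, hV⟩ := exists_linearIsometryEquiv_of_norm_eq
    (i₁.toLinearMap ∘ₗ LinearMap.applyₗ Ω₁ ∘ₗ π₁.toLinearMap)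
    -- The norms of `π(X)Ω` are values of a vacuum functional at `star X * X`, and there is only one
    -- such functional.
    (i₂.toLinearMap ∘ₗ LinearMap.applyₗ Ω₂ ∘ₗ π₂.toLinearMap) hd₁ hd₂ (fun X => by
      change ‖i₁ (π₁ X Ω₁)‖ = ‖i₂ (π₂ X Ω₂)‖
      rw [LinearIsometry.norm_map, LinearIsometry.norm_map, norm_eq_sqrt_re_inner (𝕜 := ℂ),
        norm_eq_sqrt_re_inner (𝕜 := ℂ), Zalg.inner_apply_apply h₁, Zalg.inner_apply_apply h₂,
        Zalg.vacuumFunctional_unique hω₁ hω₂])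
  have hV' : ∀ X, V (i₁ (π₁ X Ω₁)) = i₂ (π₂ X Ω₂) := hV
  refine ⟨V, hV', fun φ ψ h X => ?_⟩
  -- The vectors `φ`, `ψ` need not lie in the orbits of the vacua. So the identity is tested against
  -- the dense vectors `π₂(Y)Ω₂`, and `X` is moved onto them, where it becomes `star X * Y`.
  refine hd₂.eq_of_inner_right (𝕜 := ℂ) fun Y => ?_
  have e₁ : π₁ (star X) (π₁ Y Ω₁) = π₁ (star X * Y) Ω₁ := by rw [map_mul]; rfl
  have e₂ : π₂ (star X) (π₂ Y Ω₂) = π₂ (star X * Y) Ω₂ := by rw [map_mul]; rfl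
  rw [← hV' Y, LinearIsometryEquiv.inner_map_map, LinearIsometry.inner_map_map, hV',
    LinearIsometry.inner_map_map, ← h₁, ← h₂, e₁, e₂, ← i₁.inner_map_map, ← i₂.inner_map_map,
    ← hV', ← h, LinearIsometryEquiv.inner_map_map]

end GNS

/-! ### The two representations and cyclicity of their vacua -/

section Representations

theorem IsExchangeFamily.exists_isStarRep {V : Type u} [NormedAddCommGroup V]
    [InnerProductSpace ℂ V] {T : V ⊗[ℂ] V →L[ℂ] V ⊗[ℂ] V} (hT : IsInvolutiveRMatrix T)
    {ι : Type*} [Fintype ι] {L : Type w} [NormedAddCommGroup L] [InnerProductSpace ℂ L]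
    {M : ι → ι → ι → ι → ℂ} {v : ι → L → V} (hv : IsExchangeFamily T M v) :
    ∃ ρ : Zalg L M →ₐ[ℂ] Module.End ℂ (Fock0 T),
      (∀ α f, ρ (Zalg.Z M α f) = ann T (v α f) ∧ ρ (star (Zalg.Z M α f)) = cre T (v α f)) ∧
      IsStarRep ρ :=
  Zalg.exists_isStarRep (fun α f => ann T (v α f)) (fun α f => cre T (v α f))
    (fun _ _ => inner_cre _) (hv.ann_mul_ann hT) (hv.ann_mul_cre hT)

/-- The vacuum vector is cyclic. -/
theorem IsExchangeFamily.denseRange_vac {V : Type u} [NormedAddCommGroup V]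
    [InnerProductSpace ℂ V] {T : V ⊗[ℂ] V →L[ℂ] V ⊗[ℂ] V} (hT : IsInvolutiveRMatrix T)
    {ι : Type*} [Fintype ι] {L : Type w} [NormedAddCommGroup L] [InnerProductSpace ℂ L]
    {M : ι → ι → ι → ι → ℂ} {v : ι → L → V} (hv : IsExchangeFamily T M v)
    {ρ : Zalg L M →ₐ[ℂ] Module.End ℂ (Fock0 T)}
    (hρ : ∀ α f, ρ (star (Zalg.Z M α f)) = cre T (v α f)) :
    DenseRange fun X => ((ρ X (vac T) : Fock0 T) : Fock T) := by
  let D : Submodule ℂ (Fock0 T) := LinearMap.range (LinearMap.applyₗ (vac T) ∘ₗ ρ.toLinearMap)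
  have hD : ∀ n x, Fock0.single T n (symVec T n x) ∈ D := hv.single_mem hT
    ⟨1, by simp⟩ (by
      rintro α f _ ⟨X, rfl⟩
      refine ⟨star (Zalg.Z M α f) * X, ?_⟩
      simp [hρ])
  have key := Fock.eq_top_of_single_mem
    (C := (D.map (Fock0 T).subtype).topologicalClosure)
    (Submodule.isClosed_topologicalClosure _)
    (fun n x => Submodule.le_topologicalClosure _ ⟨_, hD n x, rfl⟩)
  have hd := (Submodule.dense_iff_topologicalClosure_eq_top).mpr key
  refine hd.mono ?_
  rintro _ ⟨_, ⟨X, rfl⟩, rfl⟩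
  exact ⟨X, rfl⟩

variable {H : Type u} [NormedAddCommGroup H] [InnerProductSpace ℂ H]
  {K : Type v} [NormedAddCommGroup K] [InnerProductSpace ℂ K]
  {L : Type w} [NormedAddCommGroup L] [InnerProductSpace ℂ L]
  {ι κ : Type*} [Fintype ι] [Fintype κ]
  (e : OrthonormalBasis ι ℂ H) (k : OrthonormalBasis κ ℂ K)
  {S : H ⊗[ℂ] H →L[ℂ] H ⊗[ℂ] H} {R : K ⊗[ℂ] K →L[ℂ] K ⊗[ℂ] K}

theorem tensorAnn_genVec_inl (hR : IsInvolutiveRMatrix R) (α : ι) (f : L)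
    (a : Fock0 (tilde L S)) (b : Fock0 (tilde L R)) :
    tensorAnn (tilde L S) (tilde L R) (genVec e k (.inl α) f) (Fock0Tensor.tmul _ _ a b) =
      Fock0Tensor.tmul _ _ (ann _ (e α ⊗ₜ f) a) b :=
  tensorAnn_inlL_tmul (hR.tilde L) _ a b

theorem tensorAnn_genVec_inr (hS : IsInvolutiveRMatrix S) (α : κ) (f : L)
    (a : Fock0 (tilde L S)) (b : Fock0 (tilde L R)) :
    tensorAnn (tilde L S) (tilde L R) (genVec e k (.inr α) f) (Fock0Tensor.tmul _ _ a b) =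
      Fock0Tensor.tmul _ _ a (ann _ (k α ⊗ₜ f) b) :=
  tensorAnn_inrL_tmul (hS.tilde L) _ a b

theorem tensorCre_genVec_inl (hR : IsInvolutiveRMatrix R) (α : ι) (f : L)
    (a : Fock0 (tilde L S)) (b : Fock0 (tilde L R)) :
    tensorCre (tilde L S) (tilde L R) (genVec e k (.inl α) f) (Fock0Tensor.tmul _ _ a b) =
      Fock0Tensor.tmul _ _ (cre _ (e α ⊗ₜ f) a) b :=
  tensorCre_inlL_tmul (hR.tilde L) _ a b

theorem tensorCre_genVec_inr (hS : IsInvolutiveRMatrix S) (α : κ) (f : L)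
    (a : Fock0 (tilde L S)) (b : Fock0 (tilde L R)) :
    tensorCre (tilde L S) (tilde L R) (genVec e k (.inr α) f) (Fock0Tensor.tmul _ _ a b) =
      Fock0Tensor.tmul _ _ a (cre _ (k α ⊗ₜ f) b) :=
  tensorCre_inrL_tmul (hS.tilde L) _ a b

/-- The diagonal blocks are the relations in one tensor factor. In the mixed blocks the operators
act on different factors and commute, as the flip prescribes. -/
theorem tensorAnn_mul_tensorAnn (hS : IsInvolutiveRMatrix S) (hR : IsInvolutiveRMatrix R)
    (α β : ι ⊕ κ) (f g : L) :
    tensorAnn (tilde L S) (tilde L R) (genVec e k α f) *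
        tensorAnn (tilde L S) (tilde L R) (genVec e k β g) =
      ∑ γ, ∑ δ, boxCoeff e k S R β α δ γ •
        (tensorAnn (tilde L S) (tilde L R) (genVec e k γ g) *
          tensorAnn (tilde L S) (tilde L R) (genVec e k δ f)) := by
  classical
  have hs := (IsExchangeFamily.tilde (L := L) e hS).ann_mul_ann (hS.tilde L)
  have hr := (IsExchangeFamily.tilde (L := L) k hR).ann_mul_ann (hR.tilde L)
  rw [boxCoeff_eq_boxMatrix]
  refine Fock0Tensor.end_ext fun a b => ?_
  rcases α with α | α <;> rcases β with β | β <;>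
    simp only [Fintype.sum_sum_type, Module.End.mul_apply, LinearMap.sum_apply, LinearMap.smul_apply,
      tensorAnn_genVec_inl e k hR, tensorAnn_genVec_inr e k hS, boxMatrix, zero_smul,
      Finset.sum_const_zero, add_zero, zero_add, ite_smul, one_smul, Finset.sum_ite_eq,
      Finset.mem_univ, if_true]
  · have h := LinearMap.congr_fun (hs α β f g) a
    simp only [Module.End.mul_apply, LinearMap.sum_apply, LinearMap.smul_apply] at h
    simp only [h, map_sum, map_smul, LinearMap.sum_apply, LinearMap.smul_apply]
  · have h := LinearMap.congr_fun (hr α β f g) b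
    simp only [Module.End.mul_apply, LinearMap.sum_apply, LinearMap.smul_apply] at h
    simp only [h, map_sum, map_smul]

theorem tensorAnn_mul_tensorCre (hS : IsInvolutiveRMatrix S) (hR : IsInvolutiveRMatrix R)
    (α β : ι ⊕ κ) (f g : L) :
    tensorAnn (tilde L S) (tilde L R) (genVec e k α f) *
        tensorCre (tilde L S) (tilde L R) (genVec e k β g) =
      (∑ γ, ∑ δ, boxCoeff e k S R α γ β δ •
        (tensorCre (tilde L S) (tilde L R) (genVec e k γ g) *
          tensorAnn (tilde L S) (tilde L R) (genVec e k δ f))) +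
        ⟪genVec e k α f, genVec e k β g⟫_ℂ • 1 := by
  classical
  have hs := (IsExchangeFamily.tilde (L := L) e hS).ann_mul_cre (hS.tilde L)
  have hr := (IsExchangeFamily.tilde (L := L) k hR).ann_mul_cre (hR.tilde L)
  simp only [← (IsExchangeFamily.tilde (L := L) e hS).inner] at hs
  simp only [← (IsExchangeFamily.tilde (L := L) k hR).inner] at hr
  rw [boxCoeff_eq_boxMatrix]
  refine Fock0Tensor.end_ext fun a b => ?_
  rcases α with α | α <;> rcases β with β | β <;>
    simp only [Fintype.sum_sum_type, Module.End.mul_apply, LinearMap.sum_apply, LinearMap.add_apply,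
      LinearMap.smul_apply, Module.End.one_apply, tensorAnn_genVec_inl e k hR,
      tensorAnn_genVec_inr e k hS, tensorCre_genVec_inl e k hR, tensorCre_genVec_inr e k hS,
      boxMatrix, zero_smul, Finset.sum_const_zero, add_zero, zero_add, ite_smul, one_smul,
      Finset.sum_ite_irrel, Finset.sum_ite_eq, Finset.sum_ite_eq', Finset.mem_univ, if_true]
  · have h := LinearMap.congr_fun (hs α β f g) a
    simp only [Module.End.mul_apply, LinearMap.sum_apply, LinearMap.smul_apply, LinearMap.add_apply,
      Module.End.one_apply] at h
    simp only [h, map_add, map_sum, map_smul, LinearMap.add_apply, LinearMap.sum_apply,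
      LinearMap.smul_apply, genVec, inner_inlL, projL_inlL]
  · simp only [genVec, inner_inlL, projL_inrL, inner_zero_right, zero_smul, add_zero]
  · simp only [genVec, inner_inrL, projR_inlL, inner_zero_right, zero_smul, add_zero]
  · have h := LinearMap.congr_fun (hr α β f g) b
    simp only [Module.End.mul_apply, LinearMap.sum_apply, LinearMap.smul_apply, LinearMap.add_apply,
      Module.End.one_apply] at h
    simp only [h, map_add, map_sum, map_smul, genVec, inner_inrL, projR_inrL]

theorem exists_isStarRep_tensor (hS : IsInvolutiveRMatrix S) (hR : IsInvolutiveRMatrix R) :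
    ∃ π : Zalg L (boxCoeff e k S R) →ₐ[ℂ] Module.End ℂ (Fock0Tensor (tilde L S) (tilde L R)),
      (∀ α f, π (Zalg.Z (boxCoeff e k S R) α f) =
          tensorAnn (tilde L S) (tilde L R) (genVec e k α f) ∧
        π (star (Zalg.Z (boxCoeff e k S R) α f)) =
          tensorCre (tilde L S) (tilde L R) (genVec e k α f)) ∧
      IsStarRep π :=
  Zalg.exists_isStarRep (fun α f => tensorAnn (tilde L S) (tilde L R) (genVec e k α f))
    (fun α f => tensorCre (tilde L S) (tilde L R) (genVec e k α f))
    (fun _ _ => inner_tensorCre _) (tensorAnn_mul_tensorAnn e k hS hR)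
    fun α β f g => by
      rw [← (isExchangeFamily_genVec e k hS hR).inner]
      exact tensorAnn_mul_tensorCre e k hS hR α β f g

/-- Creators from `H` first build the left factor over the right vacuum; creators from `K` then
build the right factor without disturbing the left one. Each stage is `IsExchangeFamily.single_mem`
for a preimage of the orbit `D`. -/
theorem denseRange_tensorVac (hS : IsInvolutiveRMatrix S) (hR : IsInvolutiveRMatrix R)
    {π : Zalg L (boxCoeff e k S R) →ₐ[ℂ] Module.End ℂ (Fock0Tensor (tilde L S) (tilde L R))}
    (hπ : ∀ α f, π (star (Zalg.Z (boxCoeff e k S R) α f)) =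
      tensorCre (tilde L S) (tilde L R) (genVec e k α f)) :
    DenseRange fun X => tensorIncl (tilde L S) (tilde L R)
      (π X (tensorVac (tilde L S) (tilde L R))) := by
  let D : Submodule ℂ (Fock0Tensor (tilde L S) (tilde L R)) :=
    LinearMap.range (LinearMap.applyₗ (tensorVac (tilde L S) (tilde L R)) ∘ₗ π.toLinearMap)
  have hD : ∀ α f, ∀ x ∈ D, tensorCre (tilde L S) (tilde L R) (genVec e k α f) x ∈ D := by
    rintro α f _ ⟨X, rfl⟩
    refine ⟨star (Zalg.Z _ α f) * X, ?_⟩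
    simp [hπ]
  have h1 : ∀ m x, Fock0Tensor.tmul (tilde L S) (tilde L R)
      (Fock0.single _ m (symVec _ m x)) (vac _) ∈ D :=
    (IsExchangeFamily.tilde (L := L) e hS).single_mem (hS.tilde L)
      (D := D.comap ((Fock0Tensor.tmul (tilde L S) (tilde L R)).flip (vac _)))
      ⟨1, by rw [LinearMap.comp_apply, AlgHom.toLinearMap_apply, map_one]; rfl⟩
      (fun α f a ha => by
        have h := hD (.inl α) f _ ha
        rwa [LinearMap.flip_apply, tensorCre_genVec_inl e k hR] at h)
  have h2 : ∀ m x n y, Fock0Tensor.tmul (tilde L S) (tilde L R)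
      (Fock0.single _ m (symVec _ m x)) (Fock0.single _ n (symVec _ n y)) ∈ D := fun m x =>
    (IsExchangeFamily.tilde (L := L) k hR).single_mem (hR.tilde L)
      (D := D.comap (Fock0Tensor.tmul (tilde L S) (tilde L R) (Fock0.single _ m (symVec _ m x))))
      (h1 m x)
      (fun α f b hb => by
        have h := hD (.inr α) f _ hb
        rwa [tensorCre_genVec_inr e k hS] at h)
  have key := FockTensor.eq_top_of_single_mem
    (C := (D.map (tensorIncl (tilde L S) (tilde L R)).toLinearMap).topologicalClosure)
    (Submodule.isClosed_topologicalClosure _)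
    (fun m x n y => Submodule.le_topologicalClosure _ ⟨_, h2 m x n y, rfl⟩)
  have hd := (Submodule.dense_iff_topologicalClosure_eq_top).mpr key
  refine hd.mono ?_
  rintro _ ⟨_, ⟨X, rfl⟩, rfl⟩
  exact ⟨X, rfl⟩

end Representations

/-! ### The unitary and the domains of finite particle number -/

section FiniteParticleNumber

variable {V : Type u} [NormedAddCommGroup V] [InnerProductSpace ℂ V]
  {W : Type v} [NormedAddCommGroup W] [InnerProductSpace ℂ W]
  {T : V ⊗[ℂ] V →L[ℂ] V ⊗[ℂ] V} {Q : W ⊗[ℂ] W →L[ℂ] W ⊗[ℂ] W}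

/-- The vectors with fewer than `N` particles. -/
def Fock0.lt (T : V ⊗[ℂ] V →L[ℂ] V ⊗[ℂ] V) (N : ℕ) : Submodule ℂ (Fock0 T) where
  carrier := {φ | ∀ n, N ≤ n → Fock.component n (φ : Fock T) = 0}
  zero_mem' _ _ := rfl
  add_mem' {φ χ} hφ hχ n hn := by
    rw [Submodule.coe_add, map_add, hφ n hn, hχ n hn, add_zero]
  smul_mem' c φ hφ n hn := by rw [Submodule.coe_smul, map_smul, hφ n hn, smul_zero]

theorem Fock0.exists_mem_lt (φ : Fock0 T) : ∃ N, φ ∈ Fock0.lt T N := by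
  obtain ⟨N, hN⟩ := φ.2.bddAbove
  refine ⟨N + 1, fun n hn => ?_⟩
  by_contra h
  have := hN h
  omega

theorem Fock0.eq_zero_of_mem_lt_zero {φ : Fock0 T} (h : φ ∈ Fock0.lt T 0) : φ = 0 :=
  Fock0.ext fun n => h n n.zero_le

theorem ann_mem_lt {φ : Fock0 T} {N : ℕ} (h : φ ∈ Fock0.lt T (N + 1)) (ψ : V) :
    ann T ψ φ ∈ Fock0.lt T N := fun n hn => by
  rw [component_ann, h (n + 1) (by omega), map_zero]

/-- The elements of the tensor product that are orthogonal to the vectors with fewer than `n`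
particles. -/
def Fock0Tensor.ge (T : V ⊗[ℂ] V →L[ℂ] V ⊗[ℂ] V) (Q : W ⊗[ℂ] W →L[ℂ] W ⊗[ℂ] W) (n : ℕ) :
    Submodule ℂ (Fock0Tensor T Q) where
  carrier := {χ | ∀ a b, a + b ≤ n → ∀ φ₁ ∈ Fock0.lt T a, ∀ φ₂ ∈ Fock0.lt Q b,
    ⟪χ, Fock0Tensor.tmul T Q φ₁ φ₂⟫_ℂ = 0}
  zero_mem' _ _ _ _ _ _ _ := inner_zero_left _
  add_mem' hx hy a b hab φ₁ h₁ φ₂ h₂ := by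
    rw [inner_add_left, hx a b hab φ₁ h₁ φ₂ h₂, hy a b hab φ₁ h₁ φ₂ h₂, add_zero]
  smul_mem' c x hx a b hab φ₁ h₁ φ₂ h₂ := by
    rw [inner_smul_left, hx a b hab φ₁ h₁ φ₂ h₂, mul_zero]

theorem Fock0Tensor.mem_ge_zero (χ : Fock0Tensor T Q) : χ ∈ Fock0Tensor.ge T Q 0 := by
  intro a b hab φ₁ h₁ φ₂ h₂
  obtain rfl : a = 0 := by omega
  rw [Fock0.eq_zero_of_mem_lt_zero h₁, map_zero, LinearMap.zero_apply, inner_zero_right]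

/-- The adjoint annihilator lowers one of the two bounds `a`, `b` by one; if a bound is zero, the
test vector vanishes. As both bounds are strict, a + b ≤ n tests at most n - 2 particles in total,
which is enough since only large `n` matter. -/
theorem tensorCre_mem_ge {n : ℕ} {χ : Fock0Tensor T Q} (h : χ ∈ Fock0Tensor.ge T Q n)
    (ψ : DSum V W) : tensorCre T Q ψ χ ∈ Fock0Tensor.ge T Q (n + 1) := by
  intro a b hab φ₁ h₁ φ₂ h₂
  rcases a with _ | a
  · rw [Fock0.eq_zero_of_mem_lt_zero h₁, map_zero, LinearMap.zero_apply, inner_zero_right]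
  rcases b with _ | b
  · rw [Fock0.eq_zero_of_mem_lt_zero h₂, map_zero, inner_zero_right]
  rw [inner_tensorCre, tensorAnn_tmul, inner_add_right,
    h a (b + 1) (by omega) _ (ann_mem_lt h₁ _) _ h₂,
    h (a + 1) b (by omega) _ h₁ _ (ann_mem_lt h₂ _), add_zero]

theorem Fock0Tensor.exists_inner_eq_zero (ψ : Fock0Tensor T Q) :
    ∃ N, ∀ n, N ≤ n → ∀ χ ∈ Fock0Tensor.ge T Q n, ⟪χ, ψ⟫_ℂ = 0 := by
  induction ψ using Fock0Tensor.induction_on with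
  | zero => exact ⟨0, fun _ _ _ _ => inner_zero_right _⟩
  | add x y hx hy =>
    obtain ⟨N, hN⟩ := hx
    obtain ⟨N', hN'⟩ := hy
    refine ⟨max N N', fun n hn χ hχ => ?_⟩
    rw [inner_add_right, hN n (by omega) χ hχ, hN' n (by omega) χ hχ, add_zero]
  | tmul φ₁ φ₂ =>
    obtain ⟨a, ha⟩ := Fock0.exists_mem_lt φ₁
    obtain ⟨b, hb⟩ := Fock0.exists_mem_lt φ₂
    exact ⟨a + b, fun n hn χ hχ => hχ a b hn φ₁ ha φ₂ hb⟩

theorem Fock.inner_single (n : ℕ) (y : Particle T n) (φ : Fock T) :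
    ⟪(Fock0.single T n y : Fock T), φ⟫_ℂ = ⟪y, Fock.component n φ⟫_ℂ :=
  lp.inner_single_left (𝕜 := ℂ) (G := fun n => Particle T n) n y φ

section

variable {B : DSum V W ⊗[ℂ] DSum V W →L[ℂ] DSum V W ⊗[ℂ] DSum V W}
  {ι : Type*} [Fintype ι] {L : Type w} [NormedAddCommGroup L]
  [InnerProductSpace ℂ L] {M : ι → ι → ι → ι → ℂ} {v : ι → L → DSum V W}

/-- An n-particle tensor arises from the vacuum by n creations, which `U` carries over to n
creations on the tensor vacuum; each raises the degree of orthogonality by one. The preimage `χ` is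
carried along because `tensorCre` is defined only on finite-particle vectors. -/
theorem exists_mem_ge_of_intertwines (hB : IsInvolutiveRMatrix B) (hv : IsExchangeFamily B M v)
    (U : Fock B →ₗ[ℂ] FockTensor T Q) (hvac : U (vac B) = tensorIncl T Q (tensorVac T Q))
    (hcre : ∀ α f φ χ, U (φ : Fock0 B) = tensorIncl T Q χ →
      U (cre B (v α f) φ) = tensorIncl T Q (tensorCre T Q (v α f) χ))
    (n : ℕ) (x : TPow (DSum V W) n) :
    ∃ χ ∈ Fock0Tensor.ge T Q n, tensorIncl T Q χ = U (Fock0.single B n (symVec B n x)) := by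
  induction n with
  | zero =>
    obtain ⟨c, rfl⟩ := TPow.eq_smul_one x
    refine ⟨c • tensorVac T Q, Fock0Tensor.mem_ge_zero _, ?_⟩
    rw [map_smul, map_smul, Fock0.single_smul, ← vac_eq_single, Submodule.coe_smul, map_smul, hvac]
  | succ n ih =>
    induction x using hv.cons_induction with
    | zero =>
      refine ⟨0, Submodule.zero_mem _, ?_⟩
      rw [map_zero, map_zero, ← zero_smul ℂ (0 : Particle B _), Fock0.single_smul, zero_smul,
        Submodule.coe_zero, map_zero]
    | add x y hx hy =>
      obtain ⟨χ, hχ, h⟩ := hx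
      obtain ⟨χ', hχ', h'⟩ := hy
      refine ⟨χ + χ', Submodule.add_mem _ hχ hχ', ?_⟩
      rw [map_add, map_add, Fock0.single_add, Submodule.coe_add, map_add, h, h']
    | smul c x hx =>
      obtain ⟨χ, hχ, h⟩ := hx
      refine ⟨c • χ, Submodule.smul_mem _ c hχ, ?_⟩
      rw [map_smul, map_smul, Fock0.single_smul, Submodule.coe_smul, map_smul, h]
    | cons α f x =>
      obtain ⟨χ, hχ, h⟩ := ih x
      have h' := hcre α f _ χ h.symm
      have hc : (Real.sqrt (n + 1) : ℂ) ≠ 0 := by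
        exact_mod_cast (Real.sqrt_pos.mpr (by positivity : (0 : ℝ) < n + 1)).ne'
      refine ⟨(Real.sqrt (n + 1) : ℂ)⁻¹ • tensorCre T Q (v α f) χ,
        Submodule.smul_mem _ _ (tensorCre_mem_ge hχ (v α f)), ?_⟩
      rw [map_smul, ← h', cre_single, creN_symVec hB, Fock0.single_smul, Submodule.coe_smul,
        map_smul, inv_smul_smul₀ hc]

/-- A unitary that intertwines the creation operators maps vectors of finite particle number to
vectors of finite particle number. -/
theorem symm_tensorIncl_mem_Fock0 (hB : IsInvolutiveRMatrix B) (hv : IsExchangeFamily B M v)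
    (U : Fock B ≃ₗᵢ[ℂ] FockTensor T Q) (hvac : U (vac B) = tensorIncl T Q (tensorVac T Q))
    (hcre : ∀ α f φ χ, U (φ : Fock0 B) = tensorIncl T Q χ →
      U (cre B (v α f) φ) = tensorIncl T Q (tensorCre T Q (v α f) χ)) (ψ : Fock0Tensor T Q) :
    U.symm (tensorIncl T Q ψ) ∈ Fock0 B := by
  obtain ⟨N, hN⟩ := ψ.exists_inner_eq_zero
  have h : ∀ n, N ≤ n → Fock.component n (U.symm (tensorIncl T Q ψ)) = 0 := by
    intro n hn
    -- The n-th component is tested against symmetrised tensors, whose images under `U` are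
    -- orthogonal to `ψ` for n ≥ N.
    refine (denseRange_symVec B n).eq_of_inner_right (𝕜 := ℂ) fun x => ?_
    obtain ⟨χ, hχ, hx⟩ := exists_mem_ge_of_intertwines hB hv U.toLinearEquiv.toLinearMap hvac
      hcre n x
    have hx' : tensorIncl T Q χ = U (Fock0.single B n (symVec B n x)) := hx
    rw [inner_zero_right, ← Fock.inner_single, ← U.inner_map_map, ← hx',
      LinearIsometryEquiv.apply_symm_apply, LinearIsometry.inner_map_map]
    exact hN n hn χ hχ
  refine (Set.finite_lt_nat N).subset fun n hn => ?_
  by_contra hlt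
  exact hn (h n (not_lt.mp hlt))

end

end FiniteParticleNumber

end Zam

end

/-! ### The main theorem -/

set_option maxHeartbeats 1000000 in
theorem mainTheorem1
    {H : Type u} [NormedAddCommGroup H] [InnerProductSpace ℂ H]
    {K : Type v} [NormedAddCommGroup K] [InnerProductSpace ℂ K]
    {L : Type w} [NormedAddCommGroup L] [InnerProductSpace ℂ L] [CompleteSpace L]
    {ι κ : Type*} [Fintype ι] [Fintype κ]
    (e : OrthonormalBasis ι ℂ H) (k : OrthonormalBasis κ ℂ K)
    (S : H ⊗[ℂ] H →L[ℂ] H ⊗[ℂ] H) (hS : Zam.IsInvolutiveRMatrix S)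
    (R : K ⊗[ℂ] K →L[ℂ] K ⊗[ℂ] K) (hR : Zam.IsInvolutiveRMatrix R) :
    -- part (a), with `π` the representation on `ℱ⁰_{S̃} ⊗ ℱ⁰_{R̃}`
    ∃ π : Zam.Zalg L (Zam.boxCoeff e k S R) →ₐ[ℂ]
        Module.End ℂ (Zam.Fock0Tensor (Zam.tilde L S) (Zam.tilde L R)),
      (∀ (α : ι ⊕ κ) (f : L),
        π (Zam.Zalg.Z (Zam.boxCoeff e k S R) α f) =
          Zam.tensorAnn (Zam.tilde L S) (Zam.tilde L R) (Zam.genVec e k α f) ∧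
        π (star (Zam.Zalg.Z (Zam.boxCoeff e k S R) α f)) =
          Zam.tensorCre (Zam.tilde L S) (Zam.tilde L R) (Zam.genVec e k α f)) ∧
      Zam.IsStarRep π ∧
      Dense (Set.range fun X => Zam.tensorIncl (Zam.tilde L S) (Zam.tilde L R)
        (π X (Zam.tensorVac (Zam.tilde L S) (Zam.tilde L R)))) ∧
      (∃! ω : Zam.Zalg L (Zam.boxCoeff e k S R) →ₗ[ℂ] ℂ, Zam.IsVacuumFunctional ω) ∧
      (∀ ω : Zam.Zalg L (Zam.boxCoeff e k S R) →ₗ[ℂ] ℂ, Zam.IsVacuumFunctional ω →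
        ∀ X, ω X = ⟪Zam.tensorVac (Zam.tilde L S) (Zam.tilde L R),
          π X (Zam.tensorVac (Zam.tilde L S) (Zam.tilde L R))⟫_ℂ) ∧
      -- part (b), with `ρ` the Fock representation on `ℱ⁰_{S̃ ⊞ R̃}`
      ∃ ρ : Zam.Zalg L (Zam.boxCoeff e k S R) →ₐ[ℂ]
          Module.End ℂ (Zam.Fock0 (Zam.boxSum (Zam.tilde L S) (Zam.tilde L R))),
        (∀ (α : ι ⊕ κ) (f : L),
          ρ (Zam.Zalg.Z (Zam.boxCoeff e k S R) α f) =
            Zam.ann (Zam.boxSum (Zam.tilde L S) (Zam.tilde L R)) (Zam.genVec e k α f) ∧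
          ρ (star (Zam.Zalg.Z (Zam.boxCoeff e k S R) α f)) =
            Zam.cre (Zam.boxSum (Zam.tilde L S) (Zam.tilde L R)) (Zam.genVec e k α f)) ∧
        Zam.IsStarRep ρ ∧
        ∃ V : Zam.Fock (Zam.boxSum (Zam.tilde L S) (Zam.tilde L R)) ≃ₗᵢ[ℂ]
            Zam.FockTensor (Zam.tilde L S) (Zam.tilde L R),
          V (Zam.vac (Zam.boxSum (Zam.tilde L S) (Zam.tilde L R))) =
            Zam.tensorIncl (Zam.tilde L S) (Zam.tilde L R)
              (Zam.tensorVac (Zam.tilde L S) (Zam.tilde L R)) ∧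
          -- `V ρ(X) V* = π(X)` on the domain of `π`, which `V*` maps into the domain of `ρ`
          ∀ ψ : Zam.Fock0Tensor (Zam.tilde L S) (Zam.tilde L R),
            ∃ φ : Zam.Fock0 (Zam.boxSum (Zam.tilde L S) (Zam.tilde L R)),
              (φ : Zam.Fock (Zam.boxSum (Zam.tilde L S) (Zam.tilde L R))) =
                V.symm (Zam.tensorIncl (Zam.tilde L S) (Zam.tilde L R) ψ) ∧
              ∀ X, V (ρ X φ) = Zam.tensorIncl (Zam.tilde L S) (Zam.tilde L R) (π X ψ) := by
  have hB := (hS.tilde L).boxSum (hR.tilde L)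
  have hv := Zam.isExchangeFamily_genVec (L := L) e k hS hR
  obtain ⟨π, hπ, hπs⟩ := Zam.exists_isStarRep_tensor (L := L) e k hS hR
  obtain ⟨ρ, hρ, hρs⟩ := hv.exists_isStarRep hB
  have hπd := Zam.denseRange_tensorVac e k hS hR fun α f => (hπ α f).2
  have hρd := hv.denseRange_vac hB fun α f => (hρ α f).2
  have hπω := Zam.Zalg.isVacuumFunctional_vectorFunctional hπs
    (Ω := Zam.tensorVac (Zam.tilde L S) (Zam.tilde L R)) Zam.inner_tensorVac_tensorVac
    fun α f => by rw [(hπ α f).1, Zam.tensorAnn_tensorVac]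
  have hρω := Zam.Zalg.isVacuumFunctional_vectorFunctional hρs
    (Ω := Zam.vac (Zam.boxSum (Zam.tilde L S) (Zam.tilde L R))) Zam.inner_vac_vac
    fun α f => by rw [(hρ α f).1, Zam.ann_vac]
  obtain ⟨V, hV, hVX⟩ := Zam.Zalg.exists_linearIsometryEquiv
    (Zam.Fock0 (Zam.boxSum (Zam.tilde L S) (Zam.tilde L R))).subtypeₗᵢ
    (Zam.tensorIncl (Zam.tilde L S) (Zam.tilde L R)) hρs hπs hρω hπω hρd hπd
  have hvac : V (Zam.vac (Zam.boxSum (Zam.tilde L S) (Zam.tilde L R))) =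
      Zam.tensorIncl (Zam.tilde L S) (Zam.tilde L R)
        (Zam.tensorVac (Zam.tilde L S) (Zam.tilde L R)) := by
    have h := hV 1
    rwa [map_one, map_one] at h
  refine ⟨π, hπ, hπs, hπd, ⟨_, hπω, fun ω hω => Zam.Zalg.vacuumFunctional_unique hω hπω⟩,
    fun ω hω X => ?_, ρ, hρ, hρs, V, hvac, fun ψ => ?_⟩
  · rw [Zam.Zalg.vacuumFunctional_unique hω hπω, Zam.Zalg.vectorFunctional_apply]
  -- The intertwining of creators is the case X = Z*_α(f) of `hVX`; with the domain thus secured,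
  -- `hVX` applied to V*ψ and ψ gives the full intertwining.
  · have hφ := Zam.symm_tensorIncl_mem_Fock0 hB hv V hvac (fun α f φ χ h => by
      have h' := hVX φ χ h (star (Zam.Zalg.Z _ α f))
      rwa [(hρ α f).2, (hπ α f).2] at h') ψ
    exact ⟨⟨_, hφ⟩, rfl, hVX ⟨_, hφ⟩ ψ (V.apply_symm_apply _)⟩
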